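/- Let $\mathbb F=\mathbb R$ or $\mathbb C$. For $A\in\mathbb F^{I\times R}$, $B\in\mathbb F^{J\times R}$, $C\in\mathbb F^{K\times R}$ with columns $a_r,b_r,c_r$ let $[A,B,C]_R=\sum_{r=1}^R a_r\circ b_r\circ c_r\in\mathbb F^{I\times J\times K}$ ($\circ$ is the outer product). The rank $r_{\mathcal T}$ of a tensor $\mathcal T$ is the least number of rank-one tensors (outer products of three nonzero vectors) with sum $\mathcal T$. A CPD of $\mathcal T$ is an equality $\mathcal T=[A,B,C]_R$ with $R=r_{\mathcal T}$; the CPD is unique if any two CPDs agree up to a common permutation of the columns of the three factor matrices and scalings $a_r,b_r,c_r\mapsto\alpha_ra_r,\beta_rb_r,\gamma_rc_r$ with $\alpha_r\beta_r\gamma_r=1$. Let $r_M$ be the rank of a matrix $M$, and $k_M$ the largest $k$ such that every $k$ columns of $M$ are linearly independent. Let $A\odot B$ be the matrix with columns $a_r\otimes b_r$. A matrix has full column rank if its columns are linearly independent. For integers $m\ge1$, $l\ge0$, consider the tuples $r=(r_1,\dots,r_{m+l})$ with $1\le r_1\le\dots\le r_{m+l}\le R$ and at least $m$ distinct entries. The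 matrices $\Phi_{m,l}(A,B)\in\mathbb F^{I^{m+l}J^{m+l}\times M}$ and $S_{m+l}(C)\in\mathbb F^{K^{m+l}\times M}$ have one column for each of these $M$ tuples. The entry of $\Phi_{m,l}(A,B)$ in row $(i_1,\dots,i_{m+l};j_1,\dots,j_{m+l})$ and column $r$ is $$\frac1{(m!)^2}\sum_{s}\det\bigl[a_{i_us_v}\bigr]_{u,v=1}^m\det\bigl[b_{j_us_v}\bigr]_{u,v=1}^m\prod_{p=1}^l a_{i_{m+p}s_{m+p}}b_{j_{m+p}s_{m+p}},$$ where $s$ runs over the distinct rearrangements of $r$ (each taken once), and column $r$ of $S_{m+l}(C)$ is $$\frac1{(m+l)!}\sum_{\sigma}c_{r_{\sigma(1)}}\otimes\dots\otimes c_{r_{\sigma(m+l)}},$$ where $\sigma$ runs over all permutations of $\{1,\dots,m+l\}$. For $\mathcal T\in\mathbb F^{I\times J\times K}$ the $I^{m+l}J^{m+l}\times K^{m+l}$ matrix $R_{m,l}(\mathcal T)$ has the entry $$\frac1{m!(m+l)!}\sum_{\sigma}\det\bigl[t_{i_uj_vk_{\sigma(v)}}\bigr]_{u,v=1}^m\prod_{p=1}^l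 t_{i_{m+p}j_{m+p}k_{\sigma(m+p)}}$$ in row $(i_1,\dots,i_{m+l};j_1,\dots,j_{m+l})$ and column $(k_1,\dots,k_{m+l})$. Let $\mathcal S^{m+l}\subseteq\mathbb F^{K^{m+l}}$ be the span of the vectors $x\otimes\dots\otimes x$ ($m+l$ factors), $x\in\mathbb F^K$. **Theorem.** Let $2\le K\le R$, $m=R-K+2$ and $l\ge0$. Let $\mathcal T=[A,B,C]_R\in\mathbb F^{I\times J\times K}$ with $r_C=k_C=K$, and let $U_m$ be a matrix whose columns form a basis of $\operatorname{range}(S_{m+l}(C)^T)$. 1. If $A\odot B$ and $\Phi_{m,l}(A,B)U_m$ have full column rank, then $r_{\mathcal T}=R$ and the CPD of $\mathcal T$ is unique. 2. If $\Phi_{m,l}(A,B)U_m$ has full column rank, then $\min(k_A,k_B)\ge m$. 3. $\Phi_{m,l}(A,B)U_m$ has full column rank if and only if $\dim\bigl(\ker R_{m,l}(\mathcal T)\cap\mathcal S^{m+l}\bigr)=\binom{R}{K-1}$. 4. The CPD is algebraically computable: for all given $I,J,K,R,l$ there is one procedure, composed of finitely many steps of standard linear algebra (arithmetic with rational constants,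 computation of a basis of the null space of a matrix, generalized eigenvalue decomposition of a matrix pencil, and branching on whether a number is zero), that takes the entries of $\mathcal T$ as input and returns factor matrices of a CPD of $\mathcal T$, for every $\mathcal T$ that has a decomposition $\mathcal T=[A,B,C]_R$ satisfying the hypotheses of 1, and whichever bases and eigenvalue decompositions the steps return. -/

import Mathlib

open scoped Matrix Nat

noncomputable section

namespace CPD

variable {𝕜 : Type*} [RCLike 𝕜] {I J K R : ℕ}

/-! ### Tensors, rank, and polyadic decompositions -/

/-- Third-order tensors of format `I × J × K`. -/
abbrev Tensor (𝕜 : Type*) (I J K : ℕ) : Type _ := Fin I → Fin J → Fin K → 𝕜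

/-- The outer product of three vectors. -/
def outer (a : Fin I → 𝕜) (b : Fin J → 𝕜) (c : Fin K → 𝕜) : Tensor 𝕜 I J K :=
  fun i j k => a i * b j * c k

/-- A tensor is rank-1 if it is the outer product of three nonzero vectors. -/
def IsRankOne (T : Tensor 𝕜 I J K) : Prop :=
  ∃ (a : Fin I → 𝕜) (b : Fin J → 𝕜) (c : Fin K → 𝕜),
    a ≠ 0 ∧ b ≠ 0 ∧ c ≠ 0 ∧ T = outer a b c

/-- The tensor `[A, B, C]_R`, the sum of the outer products of the columns. -/
def polyadic (A : Matrix (Fin I) (Fin R) 𝕜) (B : Matrix (Fin J) (Fin R) 𝕜)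
    (C : Matrix (Fin K) (Fin R) 𝕜) : Tensor 𝕜 I J K :=
  ∑ r : Fin R, outer (A.col r) (B.col r) (C.col r)

/-- The rank: the minimal number of rank-1 tensors that sum up to `T`. -/
def tensorRank (T : Tensor 𝕜 I J K) : ℕ :=
  sInf {n : ℕ | ∃ X : Fin n → Tensor 𝕜 I J K, (∀ r, IsRankOne (X r)) ∧ T = ∑ r, X r}

/-- `T = [A, B, C]_R` is a canonical polyadic decomposition: the number `R` of terms is the rank
(by minimality, every term is then rank-1). -/
def IsCPD (T : Tensor 𝕜 I J K) (A : Matrix (Fin I) (Fin R) 𝕜) (B : Matrix (Fin J) (Fin R) 𝕜)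
    (C : Matrix (Fin K) (Fin R) 𝕜) : Prop :=
  T = polyadic A B C ∧ tensorRank T = R

/-- Equality of two decompositions up to a permutation of the terms and a scaling of the three
vectors within each term that does not change the term. -/
def EssentiallyEqual (A A' : Matrix (Fin I) (Fin R) 𝕜) (B B' : Matrix (Fin J) (Fin R) 𝕜)
    (C C' : Matrix (Fin K) (Fin R) 𝕜) : Prop :=
  ∃ (σ : Equiv.Perm (Fin R)) (α β γ : Fin R → 𝕜), ∀ r : Fin R,
    α r * β r * γ r = 1 ∧
    A'.col r = α r • A.col (σ r) ∧ B'.col r = β r • B.col (σ r) ∧ C'.col r = γ r • C.col (σ r)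

/-- The CPD of `T` is unique. -/
def HasUniqueCPD (T : Tensor 𝕜 I J K) : Prop :=
  ∀ (n : ℕ) (A A' : Matrix (Fin I) (Fin n) 𝕜) (B B' : Matrix (Fin J) (Fin n) 𝕜)
    (C C' : Matrix (Fin K) (Fin n) 𝕜),
    IsCPD T A B C → IsCPD T A' B' C' → EssentiallyEqual A A' B B' C C'

/-! ### Matrix notions -/

/-- The columns are linearly independent. -/
def FullColumnRank {α β : Type*} (M : Matrix α β 𝕜) : Prop :=
  LinearIndependent 𝕜 M.col

/-- The k-rank: the largest `k` such that every `k` columns are linearly independent. -/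
def kRank (M : Matrix (Fin I) (Fin R) 𝕜) : ℕ :=
  sSup {k : ℕ | k ≤ R ∧ ∀ s : Finset (Fin R), s.card = k →
    LinearIndependent 𝕜 (fun r : s => M.col r)}

/-- The Khatri-Rao (column-wise Kronecker) product. -/
def khatriRao (A : Matrix (Fin I) (Fin R) 𝕜) (B : Matrix (Fin J) (Fin R) 𝕜) :
    Matrix (Fin I × Fin J) (Fin R) 𝕜 :=
  Matrix.of fun p r => A p.1 r * B p.2 r

/-- The range of a matrix. -/
def matRange {α β : Type*} [Fintype β] (M : Matrix α β 𝕜) : Submodule 𝕜 (α → 𝕜) :=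
  LinearMap.range M.mulVecLin

/-- The null space of a matrix. -/
def matKer {α β : Type*} [Fintype β] (M : Matrix α β 𝕜) : Submodule 𝕜 (β → 𝕜) :=
  LinearMap.ker M.mulVecLin

/-- The columns of `U` form a basis of the subspace `V`. -/
def ColumnsFormBasis {α β : Type*} (U : Matrix α β 𝕜) (V : Submodule 𝕜 (α → 𝕜)) : Prop :=
  LinearIndependent 𝕜 U.col ∧ Submodule.span 𝕜 (Set.range U.col) = V

/-! ### The matrices `Φ_{m,l}(A,B)`, `S_{m+l}(C)` and `R_{m,l}(T)`

A row or column that is enumerated by `n`-tuples of indices is labelled here by the tuple itself,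
instead of by its position in the lexicographic order. -/

/-- The nondecreasing `(m+l)`-tuples with at least `m` distinct entries. -/
abbrev Tuples (m l R : ℕ) : Type :=
  {r : Fin (m + l) → Fin R // Monotone r ∧ m ≤ (Finset.univ.image r).card}

instance instFintypeTuples (m l R : ℕ) : Fintype (Tuples m l R) := Fintype.ofFinite _

/-- The distinct rearrangements of a tuple. -/
def rearrangements {n : ℕ} (r : Fin n → Fin R) : Finset (Fin n → Fin R) :=
  Finset.univ.image fun σ : Equiv.Perm (Fin n) => r ∘ σ

/-- The matrix `Φ_{m,l}(A,B)`; every distinct rearrangement of the column label is summed once. -/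
def Phi (m l : ℕ) (A : Matrix (Fin I) (Fin R) 𝕜) (B : Matrix (Fin J) (Fin R) 𝕜) :
    Matrix ((Fin (m + l) → Fin I) × (Fin (m + l) → Fin J)) (Tuples m l R) 𝕜 :=
  Matrix.of fun ij r =>
    ((m ! : 𝕜) ^ 2)⁻¹ * ∑ s ∈ rearrangements r.1,
      (Matrix.of fun u v : Fin m => A (ij.1 (Fin.castAdd l u)) (s (Fin.castAdd l v))).det *
      (Matrix.of fun u v : Fin m => B (ij.2 (Fin.castAdd l u)) (s (Fin.castAdd l v))).det *
      ((∏ p : Fin l, A (ij.1 (Fin.natAdd m p)) (s (Fin.natAdd m p))) *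
        ∏ p : Fin l, B (ij.2 (Fin.natAdd m p)) (s (Fin.natAdd m p)))

/-- The matrix `S_{m+l}(C)`, whose columns are the symmetrized Kronecker products of columns
of `C`. -/
def SMat (m l : ℕ) (C : Matrix (Fin K) (Fin R) 𝕜) :
    Matrix (Fin (m + l) → Fin K) (Tuples m l R) 𝕜 :=
  Matrix.of fun k r =>
    ((m + l)! : 𝕜)⁻¹ * ∑ σ : Equiv.Perm (Fin (m + l)), ∏ p, C (k p) (r.1 (σ p))

/-- The matrix `R_{m,l}(T)`. -/
def RMat (m l : ℕ) (T : Tensor 𝕜 I J K) :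
    Matrix ((Fin (m + l) → Fin I) × (Fin (m + l) → Fin J)) (Fin (m + l) → Fin K) 𝕜 :=
  Matrix.of fun ij k =>
    ((m ! : 𝕜) * ((m + l)! : 𝕜))⁻¹ * ∑ σ : Equiv.Perm (Fin (m + l)),
      (Matrix.of fun u v : Fin m =>
        T (ij.1 (Fin.castAdd l u)) (ij.2 (Fin.castAdd l v)) (k (σ (Fin.castAdd l v)))).det *
      ∏ p : Fin l, T (ij.1 (Fin.natAdd m p)) (ij.2 (Fin.natAdd m p)) (k (σ (Fin.natAdd m p)))

/-- The span of all `x ⊗ ⋯ ⊗ x` (`n` factors), i.e. the vectorized symmetric tensors. -/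
def symSubspace (𝕜 : Type*) [RCLike 𝕜] (n K : ℕ) : Submodule 𝕜 ((Fin n → Fin K) → 𝕜) :=
  Submodule.span 𝕜 (Set.range fun (x : Fin K → 𝕜) (k : Fin n → Fin K) => ∏ p, x (k p))

/-! ### Algebraic procedures

A procedure transforms finitely many numbers into finitely many numbers. It is given by the
relation "`y` is a possible output for the input `x`", since a basis of a null space and an
eigenvalue decomposition are not unique. Whatever is proved about a procedure is proved for all
possible outputs of the steps. Every step has at least one output for every input. -/

/-- `N` is a possible result of the computation of the null space of `M`: its first
`dim ker M` columns form a basis of `ker M`, the other ones are zero. -/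
def IsNullSpaceOutput {p n : ℕ} (M : Matrix (Fin p) (Fin n) 𝕜) (N : Matrix (Fin n) (Fin n) 𝕜) :
    Prop :=
  Submodule.span 𝕜 (Set.range N.col) = matKer M ∧
    ∀ j : Fin n, Module.finrank 𝕜 (matKer M) ≤ (j : ℕ) → N.col j = 0

/-- `V` and `d` are generalized eigenvectors (forming a basis) and eigenvalues of the pencil
`(M, N)` with nonsingular `N`. -/
def IsGEVD {n : ℕ} (M N V : Matrix (Fin n) (Fin n) 𝕜) (d : Fin n → 𝕜) : Prop :=
  IsUnit N.det ∧ IsUnit V.det ∧ M * V = N * V * Matrix.diagonal d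

/-- The procedures that are composed of finitely many steps of standard linear algebra:
arithmetic with rational constants, computation of a null space, (generalized) eigenvalue
decomposition, and branching on whether a number is zero. -/
inductive AlgebraicProcedure (𝕜 : Type*) [RCLike 𝕜] :
    ∀ {ι κ : Type}, ((ι → 𝕜) → (κ → 𝕜) → Prop) → Prop
  /-- Arithmetic, with the convention that a division by zero returns zero. -/
  | arithmetic {ι κ : Type} [Finite ι] [Finite κ] (f g : κ → MvPolynomial ι ℚ) :
      AlgebraicProcedure 𝕜 fun (x : ι → 𝕜) (y : κ → 𝕜) =>
        ∀ k, y k = MvPolynomial.aeval x (f k) / MvPolynomial.aeval x (g k)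
  /-- Computation of the null space of a matrix. -/
  | nullSpace (p n : ℕ) :
      AlgebraicProcedure 𝕜 fun (x : Fin p × Fin n → 𝕜) (y : Fin n × Fin n → 𝕜) =>
        IsNullSpaceOutput (Matrix.of fun i j => x (i, j)) (Matrix.of fun i j => y (i, j))
  /-- Generalized eigenvalue decomposition of the pencil `(M, N)`. The output is arbitrary if
  there is no such decomposition (so nothing can be concluded from it). -/
  | gevd (n : ℕ) :
      AlgebraicProcedure 𝕜
        fun (x : (Fin n × Fin n) ⊕ (Fin n × Fin n) → 𝕜) (y : (Fin n × Fin n) ⊕ Fin n → 𝕜) =>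
          (∃ V d, IsGEVD (Matrix.of fun i j => x (Sum.inl (i, j)))
            (Matrix.of fun i j => x (Sum.inr (i, j))) V d) →
          IsGEVD (Matrix.of fun i j => x (Sum.inl (i, j)))
            (Matrix.of fun i j => x (Sum.inr (i, j)))
            (Matrix.of fun i j => y (Sum.inl (i, j))) (fun i => y (Sum.inr i))
  /-- Branching on whether the number in position `i` is zero. -/
  | branch {ι κ : Type} {P Q : (ι → 𝕜) → (κ → 𝕜) → Prop} (i : ι) :
      AlgebraicProcedure 𝕜 P → AlgebraicProcedure 𝕜 Q →
      AlgebraicProcedure 𝕜 fun x y => (x i = 0 → P x y) ∧ (x i ≠ 0 → Q x y)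
  /-- Two procedures applied to the same input. -/
  | pair {ι κ μ : Type} {P : (ι → 𝕜) → (κ → 𝕜) → Prop} {Q : (ι → 𝕜) → (μ → 𝕜) → Prop} :
      AlgebraicProcedure 𝕜 P → AlgebraicProcedure 𝕜 Q →
      AlgebraicProcedure 𝕜 fun (x : ι → 𝕜) (y : κ ⊕ μ → 𝕜) =>
        P x (fun k => y (Sum.inl k)) ∧ Q x (fun k => y (Sum.inr k))
  /-- One procedure after the other. -/
  | comp {ι κ μ : Type} {P : (ι → 𝕜) → (κ → 𝕜) → Prop} {Q : (κ → 𝕜) → (μ → 𝕜) → Prop} :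
      AlgebraicProcedure 𝕜 P → AlgebraicProcedure 𝕜 Q →
      AlgebraicProcedure 𝕜 fun x z => ∃ y, P x y ∧ Q y z

/-- A procedure has at least one possible output for every input. -/
theorem AlgebraicProcedure.exists_output {ι κ : Type} {P : (ι → 𝕜) → (κ → 𝕜) → Prop}
    (h : AlgebraicProcedure 𝕜 P) : ∀ x, ∃ y, P x y := by
  induction h with
  | arithmetic f g => intro x; exact ⟨fun k => _, fun k => rfl⟩
  | nullSpace p n =>
    intro x
    set M : Matrix (Fin p) (Fin n) 𝕜 := Matrix.of fun i j => x (i, j)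
    let b := Module.finBasis 𝕜 (matKer M)
    refine ⟨fun ij => if h : (ij.2 : ℕ) < Module.finrank 𝕜 (matKer M) then (b ⟨ij.2, h⟩ : Fin n → 𝕜) ij.1 else 0, ?_, ?_⟩
    · have hle : Module.finrank 𝕜 (matKer M) ≤ n := by simpa using (matKer M).finrank_le
      apply le_antisymm
      · rw [Submodule.span_le]
        rintro _ ⟨j, rfl⟩
        by_cases h : (j : ℕ) < Module.finrank 𝕜 (matKer M)
        · have e := (b ⟨j, h⟩).2
          refine (congrArg (· ∈ matKer M) ?_).mpr e
          ext i; simp [Matrix.col, h]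
        · have e := (matKer M).zero_mem
          refine (congrArg (· ∈ matKer M) ?_).mpr e
          ext i; simp [Matrix.col, h]
      · intro v hv
        have := b.mem_span ⟨v, hv⟩
        have h2 := Submodule.mem_map_of_mem (f := (matKer M).subtype) this
        rw [Submodule.map_span] at h2
        refine Submodule.span_mono ?_ h2
        rintro _ ⟨_, ⟨j, rfl⟩, rfl⟩
        refine ⟨⟨j, j.2.trans_le hle⟩, ?_⟩
        ext i; simp [Matrix.col]
    · intro j hj; ext i; simp only [Matrix.col, Matrix.transpose_apply, Matrix.of_apply]; exact dif_neg (not_lt.2 hj)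
  | gevd n =>
    intro x
    by_cases h : ∃ V d, IsGEVD (Matrix.of fun i j => x (Sum.inl (i, j)))
            (Matrix.of fun i j => x (Sum.inr (i, j))) V d
    · obtain ⟨V, d, hh⟩ := h
      exact ⟨Sum.elim (fun ij => V ij.1 ij.2) d, fun _ => hh⟩
    · exact ⟨0, fun h' => absurd h' h⟩
  | branch i _ _ hP hQ =>
    intro x
    by_cases h : x i = 0
    · obtain ⟨y, hy⟩ := hP x; exact ⟨y, fun _ => hy, fun h' => absurd h h'⟩
    · obtain ⟨y, hy⟩ := hQ x; exact ⟨y, fun h' => absurd h' h, fun _ => hy⟩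
  | pair _ _ hP hQ =>
    intro x
    obtain ⟨y, hy⟩ := hP x; obtain ⟨z, hz⟩ := hQ x
    exact ⟨Sum.elim y z, hy, hz⟩
  | comp _ _ hP hQ =>
    intro x
    obtain ⟨y, hy⟩ := hP x; obtain ⟨z, hz⟩ := hQ y
    exact ⟨z, y, hy, hz⟩

/-- There is one algebraic procedure that, for every tensor `T` in the set `D`, takes the entries
of `T` as input and always returns the entries of the factor matrices of a CPD of `T` with `R`
terms. -/
def CPDAlgebraicallyComputableOn (R : ℕ) (D : Set (Tensor 𝕜 I J K)) : Prop :=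
  ∃ P : (Fin I × Fin J × Fin K → 𝕜) →
      ((Fin I × Fin R) ⊕ (Fin J × Fin R) ⊕ (Fin K × Fin R) → 𝕜) → Prop,
    AlgebraicProcedure 𝕜 P ∧
    ∀ T ∈ D, (∃ y, P (fun t => T t.1 t.2.1 t.2.2) y) ∧
      ∀ y, P (fun t => T t.1 t.2.1 t.2.2) y →
        IsCPD T (Matrix.of fun i r => y (Sum.inl (i, r)))
          (Matrix.of fun j r => y (Sum.inr (Sum.inl (j, r))))
          (Matrix.of fun k r => y (Sum.inr (Sum.inr (k, r))))

end CPD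

end

open scoped Matrix Nat

noncomputable section

namespace CPD

variable {𝕜 : Type*} [RCLike 𝕜] {I J K R : ℕ}

/-! ### Symmetric tensors -/

/-! Contracting `T` with `x` in the third mode gives the matrix `A diag(Cᵀx) Bᵀ`. On a power `x ⊗ ⋯
⊗ x`, both `R_{m,l}(T)` and `Φ_{m,l}(A,B) S_{m+l}(C)ᵀ` give, up to the factor `1/m!`, the `m × m`
minors of this matrix times `l` of its entries (`RMat_mulVec_tensorPow`, `Phi_mulVec_tupleProd`).
Hence the two agree on symmetric tensors (`RMat_mulVec_eq`).

The normal vector `x` of a hyperplane spanned by `K - 1` columns of `C` leaves exactly `m - 1`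
nonzero entries in `Cᵀx`. The powers of these normal vectors form a basis of the symmetric part of
`ker S_{m+l}(C)ᵀ` (`ker_SMat_inf_symSubspace`). This space lies in `ker R_{m,l}(T)`, and it exhausts
the symmetric tensors there exactly when `Φ_{m,l}(A,B)` is injective on the range of `S_{m+l}(C)ᵀ`;
this is claim 3. Injectivity on powers says that a contraction of rank below `m` has fewer than `m`
nonzero weights (`card_supp_lt_of_rank_lt`); weights supported on a prescribed `m`-set give claim 2.

Uniqueness is of Kruskal type. In a competing decomposition with at most `R` terms, a nonzero `x`
orthogonal to `K - 1` columns of `C'` leaves at most `m - 1` weights, and rank counting forces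
equality everywhere (`IsRigid.hyperplane`). So no decomposition is shorter, and each hyperplane
through `K - 1` columns of `C'` contains `K - 1` columns of `C`. Descending to smaller spans matches
`C'` with `C` (`IsRigid.card_le_columnsInSpan`); ranges of contractions then match the other two
factors, and independence of the columns of `A ⊙ B` fixes the scalings.

For the procedure, a computed basis of the null space differs from the powers of the normal vectors
by an invertible matrix. The eigenvectors of a pencil of two contractions undo this matrix up to
order and scale (`IsGenericChoice.exists_perm`). Intersections of hyperplanes and of ranges yield
the factor columns up to scale, and a linear system yields the scales. The generic choices and the
labelling are unknown but come from finite lists fixed in advance; each attempt is checked against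
`T` and the next one is tried if it fails (`Solvable.search`). -/

/-- The vectorized tensor power `x ⊗ ⋯ ⊗ x` with `n` factors. -/
def tensorPow (n : ℕ) (x : Fin K → 𝕜) : (Fin n → Fin K) → 𝕜 := fun k => ∏ p, x (k p)

/-- Ryser's formula for the permanent. -/
theorem sum_perm_prod_eq_sum_finset {F : Type*} [CommRing F] {n : ℕ} (a : Fin n → Fin n → F) :
    ∑ σ : Equiv.Perm (Fin n), ∏ p, a (σ p) p =
      ∑ t : Finset (Fin n), (-1) ^ t.card * ∏ p, ∑ j ∈ tᶜ, a j p := by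
  classical
  have h1 : ∀ t : Finset (Fin n), ∏ p, ∑ j ∈ tᶜ, a j p =
      ∑ f : Fin n → Fin n, if t ⊆ (Finset.univ.image f)ᶜ then ∏ p, a (f p) p else 0 := by
    intro t
    rw [Finset.prod_univ_sum, ← Finset.sum_filter]
    refine Finset.sum_congr ?_ fun _ _ => rfl
    ext f
    simp only [Fintype.mem_piFinset, Finset.mem_compl, Finset.mem_filter, Finset.mem_univ,
      true_and, Finset.subset_iff, Finset.mem_image, not_exists]
    exact ⟨fun h x hx p hp => h p (hp ▸ hx), fun h p hp => h hp p rfl⟩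
  simp only [h1, Finset.mul_sum]
  rw [Finset.sum_comm]
  -- Inclusion-exclusion: the signed count of the sets `t` avoiding the image of `f` vanishes unless
  -- `f` is onto, so only permutations survive.
  have h2 : ∀ f : Fin n → Fin n,
      (∑ t : Finset (Fin n), (-1 : F) ^ t.card *
        if t ⊆ (Finset.univ.image f)ᶜ then ∏ p, a (f p) p else 0) =
      if Function.Bijective f then ∏ p, a (f p) p else 0 := by
    intro f
    have h3 := congrArg (Int.cast : ℤ → F)
      (Finset.sum_powerset_neg_one_pow_card (x := (Finset.univ.image f)ᶜ))
    have h4 : (Finset.univ.image f)ᶜ = ∅ ↔ Function.Bijective f := by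
      rw [Finset.compl_eq_empty_iff, ← Finite.surjective_iff_bijective,
        Finset.eq_univ_iff_forall]
      simp [Function.Surjective]
    simp only [h4] at h3
    have h5 : (∑ t : Finset (Fin n), (-1 : F) ^ t.card *
        if t ⊆ (Finset.univ.image f)ᶜ then ∏ p, a (f p) p else 0) =
        (∑ t ∈ (Finset.univ.image f)ᶜ.powerset, (-1 : F) ^ t.card) * ∏ p, a (f p) p := by
      rw [Finset.sum_mul]
      simp only [mul_ite, mul_zero]
      rw [← Finset.sum_filter]
      refine Finset.sum_congr ?_ fun _ _ => rfl
      ext t; simp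
    rw [h5]
    push_cast at h3
    rw [h3]
    split_ifs <;> simp
  simp only [h2]
  rw [← Finset.sum_filter]
  refine (Finset.sum_bij (fun f hf => Equiv.ofBijective f (Finset.mem_filter.1 hf).2)
    ?_ ?_ ?_ ?_).symm
  · intros; simp
  · intro f _ g _ h
    exact congrArg (fun e : Equiv.Perm (Fin n) => (e : Fin n → Fin n)) h
  · intro σ _
    exact ⟨σ, Finset.mem_filter.2 ⟨Finset.mem_univ _, σ.bijective⟩, by ext; rfl⟩
  · intros; rfl

theorem tensorPow_mem_symSubspace (n : ℕ) (x : Fin K → 𝕜) : tensorPow n x ∈ symSubspace 𝕜 n K :=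
  Submodule.subset_span ⟨x, rfl⟩

/-- Polarization: Ryser's formula for the 0-1 matrix `[k j = k' p]` writes the symmetrized basis
tensor as a signed sum of powers of partial sums of basis vectors. -/
theorem sum_perm_single_mem_symSubspace {n : ℕ} (k : Fin n → Fin K) :
    (fun k' : Fin n → Fin K => ∑ σ : Equiv.Perm (Fin n), if k ∘ σ = k' then (1 : 𝕜) else 0) ∈
      symSubspace 𝕜 n K := by
  classical
  have h : (fun k' : Fin n → Fin K => ∑ σ : Equiv.Perm (Fin n), if k ∘ σ = k' then (1 : 𝕜) else 0)
      = ∑ t : Finset (Fin n), (-1 : 𝕜) ^ t.card •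
        tensorPow n (fun i => ∑ j ∈ tᶜ, if k j = i then (1 : 𝕜) else 0) := by
    ext k'
    have := sum_perm_prod_eq_sum_finset (F := 𝕜) fun j p => if k j = k' p then (1 : 𝕜) else 0
    simp only [Finset.sum_apply, Pi.smul_apply, tensorPow, smul_eq_mul]
    rw [← this]
    refine Finset.sum_congr rfl fun σ _ => ?_
    rw [Finset.prod_ite_zero]
    simp [funext_iff]
  rw [h]
  exact Submodule.sum_mem _ fun t _ => Submodule.smul_mem _ _ (tensorPow_mem_symSubspace _ _)

/-- The span of the tensor powers consists of all symmetric tensors. -/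
theorem mem_symSubspace_iff {n : ℕ} {v : (Fin n → Fin K) → 𝕜} :
    v ∈ symSubspace 𝕜 n K ↔ ∀ (σ : Equiv.Perm (Fin n)) k, v (k ∘ σ) = v k := by
  classical
  constructor
  · intro hv σ k
    induction hv using Submodule.span_induction with
    | mem v hv =>
      obtain ⟨x, rfl⟩ := hv
      exact Equiv.prod_comp σ fun p => x (k p)
    | zero => rfl
    | add v w _ _ hv hw => simp [hv, hw]
    | smul a v _ hv => simp [hv]
  · intro hv
    -- A symmetric tensor is its own average over permutations, hence a combination of symmetrized
    -- basis tensors.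
    have h : (n ! : 𝕜) • v = ∑ k, v k • fun k' : Fin n → Fin K =>
        ∑ σ : Equiv.Perm (Fin n), if k ∘ σ = k' then (1 : 𝕜) else 0 := by
      ext k'
      simp only [Finset.sum_apply, Pi.smul_apply, smul_eq_mul, Finset.mul_sum]
      rw [Finset.sum_comm]
      have : ∀ σ : Equiv.Perm (Fin n),
          ∑ k, v k * (if k ∘ σ = k' then (1 : 𝕜) else 0) = v k' := by
        intro σ
        rw [Finset.sum_eq_single (k' ∘ σ.symm)]
        · have : (k' ∘ ⇑σ.symm) ∘ ⇑σ = k' := by ext; simp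
          rw [if_pos this, mul_one, hv]
        · intro k _ hk
          rw [if_neg, mul_zero]
          rintro rfl
          apply hk; ext; simp
        · simp
      rw [Finset.sum_congr rfl fun σ _ => this σ]
      simp [Fintype.card_perm]
    have hn : (n ! : 𝕜) ≠ 0 := by exact_mod_cast n.factorial_ne_zero
    rw [← inv_smul_smul₀ hn v, h]
    exact Submodule.smul_mem _ _ (Submodule.sum_mem _ fun k _ =>
      Submodule.smul_mem _ _ (sum_perm_single_mem_symSubspace k))

/-! ### The identity `R_{m,l}(T) = Φ_{m,l}(A,B) S_{m+l}(C)ᵀ` on symmetric tensors -/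

/-- The contraction of a tensor with a vector in the third mode. -/
def contract (T : Tensor 𝕜 I J K) (x : Fin K → 𝕜) : Matrix (Fin I) (Fin J) 𝕜 :=
  Matrix.of fun i j => ∑ k, T i j k * x k

/-- The products of `m × m` minors with `l` entries of a matrix. -/
def minors (m l : ℕ) (F : Matrix (Fin I) (Fin J) 𝕜) :
    (Fin (m + l) → Fin I) × (Fin (m + l) → Fin J) → 𝕜 :=
  fun ij => (Matrix.of fun u v : Fin m => F (ij.1 (Fin.castAdd l u)) (ij.2 (Fin.castAdd l v))).det *
    ∏ p : Fin l, F (ij.1 (Fin.natAdd m p)) (ij.2 (Fin.natAdd m p))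

/-- The products of the entries of a vector along the tuples that label columns of `Φ_{m,l}`. -/
def tupleProd (m l : ℕ) (d : Fin R → 𝕜) : Tuples m l R → 𝕜 := fun r => ∏ p, d (r.1 p)

theorem weighted_apply (A : Matrix (Fin I) (Fin R) 𝕜) (B : Matrix (Fin J) (Fin R) 𝕜)
    (d : Fin R → 𝕜) (i : Fin I) (j : Fin J) :
    (A * Matrix.diagonal d * Bᵀ) i j = ∑ r, A i r * B j r * d r := by
  rw [Matrix.mul_apply]
  exact Finset.sum_congr rfl fun r _ => by
    rw [Matrix.mul_diagonal, Matrix.transpose_apply]; ring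

theorem contract_polyadic (A : Matrix (Fin I) (Fin R) 𝕜) (B : Matrix (Fin J) (Fin R) 𝕜)
    (C : Matrix (Fin K) (Fin R) 𝕜) (x : Fin K → 𝕜) :
    contract (polyadic A B C) x = A * Matrix.diagonal (Cᵀ *ᵥ x) * Bᵀ := by
  ext i j
  rw [weighted_apply]
  simp only [contract, polyadic, outer, Matrix.of_apply, Finset.sum_apply, Matrix.col_apply,
    Matrix.mulVec, dotProduct, Matrix.transpose_apply, Finset.sum_mul, Finset.mul_sum]
  rw [Finset.sum_comm]
  exact Finset.sum_congr rfl fun r _ => Finset.sum_congr rfl fun k _ => by ring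

theorem sum_prod_castAdd_mul_prod_natAdd {m l : ℕ} {α : Type*} [Fintype α]
    (g : Fin m → α → 𝕜) (h : Fin l → α → 𝕜) :
    ∑ s : Fin (m + l) → α, (∏ u, g u (s (Fin.castAdd l u))) * ∏ p, h p (s (Fin.natAdd m p)) =
      (∏ u, ∑ t, g u t) * ∏ p, ∑ t, h p t := by
  classical
  have h1 := Finset.prod_univ_sum (fun _ : Fin (m + l) => (Finset.univ : Finset α))
    (fun q t => Fin.addCases (motive := fun _ => α → 𝕜) g h q t)
  rw [Fin.prod_univ_add, Fintype.piFinset_univ] at h1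
  simp only [Fin.prod_univ_add, Fin.addCases_left, Fin.addCases_right] at h1
  exact h1.symm

/-- Every permutation contributes the same product of inner products, so the average over
permutations is that product. -/
theorem SMat_transpose_mulVec_tensorPow (m l : ℕ) (C : Matrix (Fin K) (Fin R) 𝕜)
    (x : Fin K → 𝕜) :
    (SMat m l C)ᵀ *ᵥ tensorPow (m + l) x = tupleProd m l (Cᵀ *ᵥ x) := by
  ext r
  simp only [Matrix.mulVec, dotProduct, Matrix.transpose_apply, SMat, Matrix.of_apply, tensorPow,
    tupleProd]
  have h : ∀ σ : Equiv.Perm (Fin (m + l)),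
      ∑ k : Fin (m + l) → Fin K, (∏ p, C (k p) (r.1 (σ p))) * ∏ p, x (k p) =
        ∏ p, ∑ k, C k (r.1 p) * x k := by
    intro σ
    rw [← Equiv.prod_comp σ fun p => ∑ k, C k (r.1 p) * x k, Finset.prod_univ_sum,
      Fintype.piFinset_univ]
    simp only [Finset.prod_mul_distrib]
  simp only [mul_assoc, Finset.sum_mul, ← Finset.mul_sum]
  rw [Finset.sum_comm, Finset.sum_congr rfl fun σ _ => h σ]
  have hn : ((m + l)! : 𝕜) ≠ 0 := by exact_mod_cast (m + l).factorial_ne_zero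
  simp [Fintype.card_perm, inv_mul_cancel_left₀ hn]

/-- The power is invariant under permuting positions, so all `σ` contribute equally. In one such sum
the third indices separate, and every entry of `T` becomes an entry of the contraction. -/
theorem RMat_mulVec_tensorPow (m l : ℕ) (T : Tensor 𝕜 I J K) (x : Fin K → 𝕜) :
    RMat m l T *ᵥ tensorPow (m + l) x = (m ! : 𝕜)⁻¹ • minors m l (contract T x) := by
  ext ij
  set G : (Fin (m + l) → Fin K) → 𝕜 := fun k =>
    (Matrix.of fun u v : Fin m =>
        T (ij.1 (Fin.castAdd l u)) (ij.2 (Fin.castAdd l v)) (k (Fin.castAdd l v))).det *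
      (∏ p : Fin l, T (ij.1 (Fin.natAdd m p)) (ij.2 (Fin.natAdd m p)) (k (Fin.natAdd m p))) *
      tensorPow (m + l) x k with hG
  have h1 : (RMat m l T *ᵥ tensorPow (m + l) x) ij =
      ((m ! : 𝕜) * ((m + l)! : 𝕜))⁻¹ * ∑ σ : Equiv.Perm (Fin (m + l)), ∑ k, G (k ∘ σ) := by
    simp only [Matrix.mulVec, dotProduct, RMat, Matrix.of_apply, mul_assoc, Finset.sum_mul,
      ← Finset.mul_sum]
    rw [Finset.sum_comm]
    congr 1
    refine Finset.sum_congr rfl fun σ _ => Finset.sum_congr rfl fun k _ => ?_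
    have : tensorPow (m + l) x (k ∘ σ) = tensorPow (m + l) x k :=
      mem_symSubspace_iff.1 (tensorPow_mem_symSubspace _ _) σ k
    simp only [hG, this, mul_assoc]
    rfl
  have h2 : ∑ k, G k = minors m l (contract T x) ij := by
    simp only [hG, minors, Matrix.det_apply', Matrix.of_apply, tensorPow, Fin.prod_univ_add,
      Finset.sum_mul]
    rw [Finset.sum_comm]
    refine Finset.sum_congr rfl fun π _ => ?_
    have := sum_prod_castAdd_mul_prod_natAdd
      (fun u k => T (ij.1 (Fin.castAdd l (π u))) (ij.2 (Fin.castAdd l u)) k * x k)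
      (fun p k => T (ij.1 (Fin.natAdd m p)) (ij.2 (Fin.natAdd m p)) k * x k)
    simp only [contract, Matrix.of_apply]
    rw [mul_assoc, ← this, Finset.mul_sum]
    refine Finset.sum_congr rfl fun k _ => ?_
    simp only [Finset.prod_mul_distrib]
    ring
  have h3 : ∀ σ : Equiv.Perm (Fin (m + l)), ∑ k, G (k ∘ σ) = ∑ k, G k := fun σ =>
    Equiv.sum_comp (Equiv.arrowCongr σ.symm (Equiv.refl (Fin K))) G
  have hn : ((m + l)! : 𝕜) ≠ 0 := by exact_mod_cast (m + l).factorial_ne_zero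
  rw [h1, Finset.sum_congr rfl fun σ _ => h3 σ, h2]
  simp only [Finset.sum_const, Finset.card_univ, Fintype.card_perm, Fintype.card_fin, nsmul_eq_mul,
    Pi.smul_apply, smul_eq_mul]
  field_simp

/-- A tuple has exactly one nondecreasing rearrangement, so the rearrangement classes are disjoint
and cover all tuples except those on which `G` vanishes. -/
theorem sum_rearrangements {m l : ℕ} (G : (Fin (m + l) → Fin R) → 𝕜)
    (hG : ∀ s, (Finset.univ.image s).card < m → G s = 0) :
    ∑ r : Tuples m l R, ∑ s ∈ rearrangements r.1, G s = ∑ s, G s := by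
  classical
  rw [← Finset.sum_biUnion]
  · refine Finset.sum_subset (Finset.subset_univ _) fun s _ hs => hG s ?_
    by_contra h
    refine hs (Finset.mem_biUnion.2 ⟨⟨s ∘ Tuple.sort s, Tuple.monotone_sort s, ?_⟩,
      Finset.mem_univ _, ?_⟩)
    · rw [← Finset.image_image, Finset.image_univ_equiv]
      omega
    · refine Finset.mem_image.2 ⟨(Tuple.sort s).symm, Finset.mem_univ _, ?_⟩
      ext; simp
  · rintro r - r' - hr
    refine Finset.disjoint_left.2 fun s hs hs' => hr ?_
    obtain ⟨σ, -, rfl⟩ := Finset.mem_image.1 hs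
    obtain ⟨τ, -, h⟩ := Finset.mem_image.1 hs'
    have h' : r'.1 = r.1 ∘ (τ.symm.trans σ) := by
      ext p
      have := congrFun h (τ.symm p)
      simp only [Function.comp_apply, Equiv.apply_symm_apply] at this
      simp [this]
    refine Subtype.ext ?_
    have h2 := Tuple.unique_monotone (f := r.1) (σ := Equiv.refl _) (τ := τ.symm.trans σ)
      (by simpa using r.2.1) (h' ▸ r'.2.1)
    rw [h', ← h2]
    rfl

/-- A Cauchy–Binet argument: expand both determinants and sum over all tuples `s`; the sum factors
position by position into entries of `A diag(d) Bᵀ`. -/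
theorem Phi_mulVec_tupleProd (m l : ℕ) (A : Matrix (Fin I) (Fin R) 𝕜)
    (B : Matrix (Fin J) (Fin R) 𝕜) (d : Fin R → 𝕜) :
    Phi m l A B *ᵥ tupleProd m l d =
      (m ! : 𝕜)⁻¹ • minors m l (A * Matrix.diagonal d * Bᵀ) := by
  ext ij
  set F := A * Matrix.diagonal d * Bᵀ with hF
  set DA : (Fin (m + l) → Fin R) → 𝕜 := fun s =>
    (Matrix.of fun u v : Fin m => A (ij.1 (Fin.castAdd l u)) (s (Fin.castAdd l v))).det with hDA
  set DB : (Fin (m + l) → Fin R) → 𝕜 := fun s =>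
    (Matrix.of fun u v : Fin m => B (ij.2 (Fin.castAdd l u)) (s (Fin.castAdd l v))).det with hDB
  set G : (Fin (m + l) → Fin R) → 𝕜 := fun s => DA s * DB s *
      ((∏ p : Fin l, A (ij.1 (Fin.natAdd m p)) (s (Fin.natAdd m p))) *
        ∏ p : Fin l, B (ij.2 (Fin.natAdd m p)) (s (Fin.natAdd m p))) * ∏ p, d (s p) with hG
  have h1 : (Phi m l A B *ᵥ tupleProd m l d) ij =
      ((m ! : 𝕜) ^ 2)⁻¹ * ∑ r : Tuples m l R, ∑ s ∈ rearrangements r.1, G s := by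
    simp only [Matrix.mulVec, dotProduct, Phi, Matrix.of_apply, mul_assoc, Finset.sum_mul,
      ← Finset.mul_sum]
    congr 1
    refine Finset.sum_congr rfl fun r _ => Finset.sum_congr rfl fun s hs => ?_
    obtain ⟨σ, -, rfl⟩ := Finset.mem_image.1 hs
    have : ∏ p, d ((r.1 ∘ σ) p) = tupleProd m l d r := Equiv.prod_comp σ fun p => d (r.1 p)
    simp only [hG, this, mul_assoc]
    rfl
  -- With fewer than `m` distinct entries, two of the first `m` coincide and the determinant from
  -- `A` has equal columns.
  have h2 : ∀ s, (Finset.univ.image s).card < m → G s = 0 := by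
    intro s hs
    have : ¬ Function.Injective fun v : Fin m => s (Fin.castAdd l v) := by
      intro h
      have h3 := Finset.card_image_of_injective Finset.univ h
      have h4 : (Finset.univ.image fun v : Fin m => s (Fin.castAdd l v)) ⊆ Finset.univ.image s := by
        intro t ht
        obtain ⟨v, -, rfl⟩ := Finset.mem_image.1 ht
        exact Finset.mem_image_of_mem _ (Finset.mem_univ _)
      have := Finset.card_le_card h4
      simp at h3
      omega
    simp only [Function.Injective, not_forall] at this
    obtain ⟨u, v, huv, hne⟩ := this
    have : DA s = 0 := Matrix.det_zero_of_column_eq hne fun i => by simp [huv]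
    simp [hG, this]
  -- The sign of `π` appears twice and cancels, so the sum over `π` counts one minor `m!` times;
  -- this turns `1/(m!)²` into `1/m!`.
  have h3 : ∀ π : Equiv.Perm (Fin m), ∑ τ : Equiv.Perm (Fin m), ((τ.sign : ℤ) : 𝕜) *
      ∏ v, F (ij.1 (Fin.castAdd l (τ v))) (ij.2 (Fin.castAdd l (π v))) = ((π.sign : ℤ) : 𝕜) *
      (Matrix.of fun u v : Fin m => F (ij.1 (Fin.castAdd l u)) (ij.2 (Fin.castAdd l v))).det := by
    intro π
    rw [← Matrix.det_permute', Matrix.det_apply']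
    rfl
  have h4 : ∑ s, G s = ∑ π : Equiv.Perm (Fin m), ((π.sign : ℤ) : 𝕜) *
      ((∑ τ : Equiv.Perm (Fin m), ((τ.sign : ℤ) : 𝕜) *
        ∏ v, F (ij.1 (Fin.castAdd l (τ v))) (ij.2 (Fin.castAdd l (π v)))) *
        ∏ p : Fin l, F (ij.1 (Fin.natAdd m p)) (ij.2 (Fin.natAdd m p))) := by
    have : ∀ s, G s = ∑ π : Equiv.Perm (Fin m), ∑ τ : Equiv.Perm (Fin m),
        ((π.sign : ℤ) : 𝕜) * ((τ.sign : ℤ) : 𝕜) *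
        ((∏ v, A (ij.1 (Fin.castAdd l (τ v))) (s (Fin.castAdd l v)) *
          B (ij.2 (Fin.castAdd l (π v))) (s (Fin.castAdd l v)) * d (s (Fin.castAdd l v))) *
        ∏ p, A (ij.1 (Fin.natAdd m p)) (s (Fin.natAdd m p)) *
          B (ij.2 (Fin.natAdd m p)) (s (Fin.natAdd m p)) * d (s (Fin.natAdd m p))) := by
      intro s
      simp only [hG, hDA, hDB, Matrix.det_apply', Matrix.of_apply, Fin.prod_univ_add,
        Finset.prod_mul_distrib]
      rw [mul_comm (∑ _, _) (∑ _, _), Finset.sum_mul_sum, Finset.sum_mul, Finset.sum_mul]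
      refine Finset.sum_congr rfl fun π _ => ?_
      rw [Finset.sum_mul, Finset.sum_mul]
      refine Finset.sum_congr rfl fun τ _ => ?_
      ring
    rw [Finset.sum_congr rfl fun s _ => this s, Finset.sum_comm]
    refine Finset.sum_congr rfl fun π _ => ?_
    rw [Finset.sum_comm, Finset.sum_mul, Finset.mul_sum]
    refine Finset.sum_congr rfl fun τ _ => ?_
    rw [← Finset.mul_sum, sum_prod_castAdd_mul_prod_natAdd
      (fun v t => A (ij.1 (Fin.castAdd l (τ v))) t * B (ij.2 (Fin.castAdd l (π v))) t * d t)
      (fun p t => A (ij.1 (Fin.natAdd m p)) t * B (ij.2 (Fin.natAdd m p)) t * d t)]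
    simp only [hF, weighted_apply]
    ring
  have h5 : ∀ π : Equiv.Perm (Fin m), ((π.sign : ℤ) : 𝕜) * ((π.sign : ℤ) : 𝕜) = 1 := by
    intro π
    rw [← Int.cast_mul, ← Units.val_mul, Int.units_mul_self]; simp
  have hn : (m ! : 𝕜) ≠ 0 := by exact_mod_cast m.factorial_ne_zero
  rw [h1, sum_rearrangements G h2, h4]
  simp only [h3, mul_assoc]
  simp only [← mul_assoc, h5, one_mul]
  simp only [Finset.sum_const, Finset.card_univ, Fintype.card_perm, Fintype.card_fin, nsmul_eq_mul,
    Pi.smul_apply, smul_eq_mul, minors]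
  field_simp

/-- `R_{m,l}(T)` and `Φ_{m,l}(A,B) S_{m+l}(C)ᵀ` agree on symmetric tensors. -/
theorem RMat_mulVec_eq {m l : ℕ} (A : Matrix (Fin I) (Fin R) 𝕜) (B : Matrix (Fin J) (Fin R) 𝕜)
    (C : Matrix (Fin K) (Fin R) 𝕜) {v : (Fin (m + l) → Fin K) → 𝕜}
    (hv : v ∈ symSubspace 𝕜 (m + l) K) :
    RMat m l (polyadic A B C) *ᵥ v = Phi m l A B *ᵥ ((SMat m l C)ᵀ *ᵥ v) := by
  induction hv using Submodule.span_induction with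
  | mem v hv =>
    obtain ⟨x, rfl⟩ := hv
    change RMat m l _ *ᵥ tensorPow (m + l) x = Phi m l A B *ᵥ (_ *ᵥ tensorPow (m + l) x)
    rw [SMat_transpose_mulVec_tensorPow, RMat_mulVec_tensorPow, Phi_mulVec_tupleProd,
      contract_polyadic]
  | zero => simp
  | add v w _ _ hv hw => simp only [Matrix.mulVec_add, hv, hw]
  | smul a v _ hv => simp only [Matrix.mulVec_smul, hv]

/-- Every element of the range of `S_{m+l}(C)ᵀ` is the image of a symmetric tensor. -/
theorem exists_mem_symSubspace_SMat {m l : ℕ} (C : Matrix (Fin K) (Fin R) 𝕜)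
    (v : (Fin (m + l) → Fin K) → 𝕜) :
    ∃ w ∈ symSubspace 𝕜 (m + l) K, (SMat m l C)ᵀ *ᵥ w = (SMat m l C)ᵀ *ᵥ v := by
  have hS : ∀ (τ : Equiv.Perm (Fin (m + l))) k r, SMat m l C (k ∘ τ) r = SMat m l C k r := by
    intro τ k r
    simp only [SMat, Matrix.of_apply]
    congr 1
    rw [← Equiv.sum_comp (Equiv.mulRight τ)]
    refine (Finset.sum_congr rfl fun σ _ => ?_).symm
    rw [← Equiv.prod_comp τ]
    simp
  have hn : ((m + l)! : 𝕜) ≠ 0 := by exact_mod_cast (m + l).factorial_ne_zero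
  -- The average of `v` over permutations works because the columns of `S_{m+l}(C)` are symmetric.
  refine ⟨((m + l)! : 𝕜)⁻¹ • fun k => ∑ τ : Equiv.Perm (Fin (m + l)), v (k ∘ τ), ?_, ?_⟩
  · rw [mem_symSubspace_iff]
    intro σ k
    simp only [Pi.smul_apply, smul_eq_mul]
    congr 1
    exact Equiv.sum_comp (Equiv.mulLeft σ) fun τ => v (k ∘ τ)
  · ext r
    simp only [Pi.smul_apply, smul_eq_mul, Matrix.mulVec, dotProduct,
      Matrix.transpose_apply, Finset.mul_sum]
    rw [Finset.sum_comm]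
    have : ∀ τ : Equiv.Perm (Fin (m + l)), ∑ k, SMat m l C k r * (((m + l)! : 𝕜)⁻¹ * v (k ∘ τ)) =
        ((m + l)! : 𝕜)⁻¹ * ∑ k, SMat m l C k r * v k := by
      intro τ
      simp only [mul_left_comm (SMat m l C _ r)]
      rw [← Finset.mul_sum, ← Equiv.sum_comp (Equiv.arrowCongr τ.symm (Equiv.refl (Fin K)))
        fun k => SMat m l C k r * v k]
      congr 1
      refine Finset.sum_congr rfl fun k _ => ?_
      rw [← hS τ k r]
      rfl
    rw [Finset.sum_congr rfl fun τ _ => this τ]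
    simp [Fintype.card_perm, mul_inv_cancel_left₀ hn]

/-! ### Vectors in general position -/

/-- Any at most `q` of the vectors are linearly independent. -/
def GeneralPosition (q : ℕ) (v : Fin R → Fin K → 𝕜) : Prop :=
  ∀ s : Finset (Fin R), s.card ≤ q → LinearIndepOn 𝕜 v (s : Set (Fin R))

theorem generalPosition_of_card_eq {q : ℕ} (hq : q ≤ R) {v : Fin R → Fin K → 𝕜}
    (h : ∀ s : Finset (Fin R), s.card = q → LinearIndepOn 𝕜 v (s : Set (Fin R))) :
    GeneralPosition q v := by
  intro s hs
  obtain ⟨t, hst, -, ht⟩ := Finset.exists_subsuperset_card_eq (Finset.subset_univ s) hs (by simpa)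
  exact (h t ht).mono (by exact_mod_cast hst)

theorem bddAbove_kRank (M : Matrix (Fin I) (Fin R) 𝕜) :
    BddAbove {k : ℕ | k ≤ R ∧ ∀ s : Finset (Fin R), s.card = k →
      LinearIndependent 𝕜 (fun r : s => M.col r)} := ⟨R, fun _ h => h.1⟩

theorem generalPosition_kRank (M : Matrix (Fin I) (Fin R) 𝕜) :
    GeneralPosition (kRank M) M.col := by
  have h : kRank M ∈ {k : ℕ | k ≤ R ∧ ∀ s : Finset (Fin R), s.card = k →
      LinearIndependent 𝕜 (fun r : s => M.col r)} := by
    -- The value `0` is admissible, so the supremum is attained.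
    refine Nat.sSup_mem ⟨0, Nat.zero_le _, fun s hs => ?_⟩ (bddAbove_kRank M)
    rw [Finset.card_eq_zero] at hs
    subst hs
    exact linearIndependent_empty_type
  exact generalPosition_of_card_eq h.1 h.2

theorem le_kRank {q : ℕ} (hq : q ≤ R) {M : Matrix (Fin I) (Fin R) 𝕜}
    (h : ∀ s : Finset (Fin R), s.card = q → LinearIndepOn 𝕜 M.col (s : Set (Fin R))) :
    q ≤ kRank M :=
  le_csSup (bddAbove_kRank M) ⟨hq, h⟩

theorem exists_eq_dotProduct (g : (Fin K → 𝕜) →ₗ[𝕜] 𝕜) :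
    ∃ x : Fin K → 𝕜, ∀ v, g v = v ⬝ᵥ x := by
  refine ⟨fun k => g (Pi.single k 1), fun v => ?_⟩
  rw [LinearMap.pi_apply_eq_sum_univ g v]
  refine Finset.sum_congr rfl fun k _ => congrArg (fun w => v k * g w) ?_
  ext k'
  simp [Pi.single_apply, eq_comm]

theorem exists_dotProduct_eq {ι : Type*} {v : ι → Fin K → 𝕜} {s : Set ι}
    (hv : LinearIndepOn 𝕜 v s) (t : ι → 𝕜) : ∃ x : Fin K → 𝕜, ∀ r ∈ s, v r ⬝ᵥ x = t r := by
  have hv' : LinearIndependent 𝕜 (fun r : s => v r) := hv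
  obtain ⟨g, hg⟩ := ((Module.Basis.span hv').constr 𝕜 fun r : s => t r).exists_extend
  obtain ⟨x, hx⟩ := exists_eq_dotProduct g
  refine ⟨x, fun r hr => ?_⟩
  rw [← hx]
  have h := LinearMap.congr_fun hg (Module.Basis.span hv' ⟨r, hr⟩)
  rw [Module.Basis.constr_basis] at h
  rw [← h]
  simp [Module.Basis.span_apply]

/-- A vector that is orthogonal to everything orthogonal to `p` belongs to `p`. -/
theorem mem_of_forall_dotProduct_eq_zero {p : Submodule 𝕜 (Fin K → 𝕜)} {v : Fin K → 𝕜}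
    (h : ∀ x, (∀ w ∈ p, w ⬝ᵥ x = 0) → v ⬝ᵥ x = 0) : v ∈ p := by
  by_contra hv
  obtain ⟨g, hg, hp⟩ := Submodule.exists_le_ker_of_notMem hv
  obtain ⟨x, hx⟩ := exists_eq_dotProduct g
  exact hg (by rw [hx]; exact h x fun w hw => by rw [← hx]; exact hp hw)

theorem GeneralPosition.span_eq_top {c : Fin R → Fin K → 𝕜} (hc : GeneralPosition K c)
    {s : Finset (Fin R)} (hs : K ≤ s.card) : Submodule.span 𝕜 (c '' s) = ⊤ := by
  obtain ⟨t, hts, ht⟩ := Finset.exists_subset_card_eq hs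
  have h : LinearIndependent 𝕜 (fun r : t => c r) := hc t ht.le
  have h2 := h.span_eq_top_of_card_eq_finrank' (by simp [ht])
  rw [eq_top_iff, ← h2]
  refine Submodule.span_mono ?_
  rintro _ ⟨r, rfl⟩
  exact ⟨r, hts r.2, rfl⟩

theorem GeneralPosition.linearMap_eq_zero {c : Fin R → Fin K → 𝕜} (hc : GeneralPosition K c)
    {s : Finset (Fin R)} (hs : K ≤ s.card) (g : (Fin K → 𝕜) →ₗ[𝕜] 𝕜) (hg : ∀ r ∈ s, g (c r) = 0) :
    g = 0 := by
  refine LinearMap.ext_on (hc.span_eq_top hs) ?_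
  rintro _ ⟨r, hr, rfl⟩
  simpa using hg r hr

theorem GeneralPosition.eq_zero {c : Fin R → Fin K → 𝕜} (hc : GeneralPosition K c)
    {s : Finset (Fin R)} (hs : K ≤ s.card) {x : Fin K → 𝕜} (hx : ∀ r ∈ s, c r ⬝ᵥ x = 0) :
    x = 0 := by
  have h := hc.linearMap_eq_zero hs
    (LinearMap.mk ⟨fun y => y ⬝ᵥ x, fun y z => add_dotProduct y z x⟩ fun a y => smul_dotProduct a y x)
    hx
  ext k
  simpa using LinearMap.congr_fun h (Pi.single k 1)

/-- The normal vector of the hyperplane spanned by `K - 1` of the vectors. -/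
theorem GeneralPosition.exists_normal {c : Fin R → Fin K → 𝕜} (hc : GeneralPosition K c)
    (hK : 1 ≤ K) (hKR : K ≤ R) {s : Finset (Fin R)} (hs : s.card = K - 1) :
    ∃ x : Fin K → 𝕜, ∀ r, c r ⬝ᵥ x = 0 ↔ r ∈ s := by
  classical
  obtain ⟨t, ht⟩ : ∃ t, t ∉ s := by
    by_contra! h
    have := Finset.eq_univ_iff_forall.2 h
    simp [this] at hs
    omega
  -- Prescribe the value 0 on `s` and 1 at one further index. A zero outside `s` would make `x`
  -- orthogonal to `K` vectors in general position, hence zero.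
  obtain ⟨x, hx⟩ := exists_dotProduct_eq (hc (insert t s)
    (by rw [Finset.card_insert_of_notMem ht]; omega)) (Pi.single t 1)
  have h0 : ∀ r ∈ s, c r ⬝ᵥ x = 0 := fun r hr => by
    rw [hx r (by simp [hr]), Pi.single_eq_of_ne (ne_of_mem_of_not_mem hr ht)]
  refine ⟨x, fun r => ⟨fun hr => ?_, h0 r⟩⟩
  by_contra hrs
  have hx0 : x = 0 := hc.eq_zero (s := insert r s)
    (by rw [Finset.card_insert_of_notMem hrs]; omega) (by
      intro r' hr'
      rcases Finset.mem_insert.1 hr' with rfl | h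
      exacts [hr, h0 _ h])
  have := hx t (by simp)
  simp [hx0] at this

/-- By duality it suffices that every `y` orthogonal to the vectors of `s` is a multiple of `x`.
After subtracting the multiple that fits at one index outside `s`, the difference is orthogonal to
`K` vectors in general position. -/
theorem GeneralPosition.mem_span_of_dotProduct_eq_zero {c : Fin R → Fin K → 𝕜}
    (hc : GeneralPosition K c) (hK : 1 ≤ K) (hKR : K ≤ R) {s : Finset (Fin R)}
    (hs : s.card = K - 1) {x : Fin K → 𝕜} (hx : ∀ r, c r ⬝ᵥ x = 0 ↔ r ∈ s) {v : Fin K → 𝕜}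
    (hv : v ⬝ᵥ x = 0) : v ∈ Submodule.span 𝕜 (c '' s) := by
  classical
  obtain ⟨t, ht⟩ : ∃ t, t ∉ s := by
    by_contra! hall
    have := Finset.eq_univ_iff_forall.2 hall
    simp [this] at hs
    omega
  have hxt : c t ⬝ᵥ x ≠ 0 := fun h0 => ht ((hx t).1 h0)
  refine mem_of_forall_dotProduct_eq_zero fun y hy => ?_
  have h0 : y - ((c t ⬝ᵥ y) / (c t ⬝ᵥ x)) • x = 0 := by
    refine hc.eq_zero (s := insert t s)
      (by rw [Finset.card_insert_of_notMem ht]; omega) fun q hq => ?_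
    rw [dotProduct_sub, dotProduct_smul, smul_eq_mul]
    rcases Finset.mem_insert.1 hq with rfl | hq
    · field_simp
      simp
    · rw [hy _ (Submodule.subset_span ⟨q, hq, rfl⟩), (hx q).2 hq, mul_zero, sub_zero]
  rw [sub_eq_zero.1 h0, dotProduct_smul, hv, smul_zero]

/-- Coordinates with respect to an independent family are unique, and omitting `i` forces the `i`-th
one to vanish. This isolates single columns from intersections of spans, for all three factors. -/
theorem mem_span_singleton_of_forall_mem_span {ι : Type*} [DecidableEq ι] {E : Type*}
    [AddCommGroup E] [Module 𝕜 E] {u : ι → E} {s : Finset ι}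
    (hu : LinearIndepOn 𝕜 u (s : Set ι)) {r : ι} (hr : r ∈ s) (hs : 2 ≤ s.card) {y : E}
    (hy : ∀ i ∈ s, i ≠ r → y ∈ Submodule.span 𝕜 (u '' (s.erase i : Finset ι))) :
    ∃ a : 𝕜, y = a • u r := by
  have hu' := (linearIndepOn_finset_iff (R := 𝕜) (v := u)).1 hu
  obtain ⟨i0, hi0, hne⟩ := Finset.exists_mem_ne (by omega : 1 < s.card) r
  have key : ∀ i ∈ s, i ≠ r → ∃ a : ι → 𝕜, a i = 0 ∧ y = ∑ j ∈ s, a j • u j := by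
    intro i hi hir
    obtain ⟨a, ha⟩ := (Submodule.mem_span_image_finset_iff_exists_fun' 𝕜).1 (hy i hi hir)
    refine ⟨Function.update a i 0, by simp, ?_⟩
    rw [← Finset.sum_erase_add _ _ hi, ← ha]
    simp only [Function.update_self, zero_smul, add_zero]
    exact Finset.sum_congr rfl fun j hj => by
      rw [Function.update_of_ne (Finset.ne_of_mem_erase hj)]
  obtain ⟨a, -, ha⟩ := key i0 hi0 hne
  refine ⟨a r, ?_⟩
  rw [ha]
  refine Finset.sum_eq_single_of_mem r hr fun i hi hir => ?_
  obtain ⟨b, hb0, hb⟩ := key i hi hir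
  have h := hu' (fun j => a j - b j) (by simp [sub_smul, ← ha, ← hb]) i hi
  simp only [hb0, sub_zero] at h
  rw [h, zero_smul]

/-! ### Normal vectors and the null space of `S_{m+l}(C)ᵀ` -/

/-- `x j` is orthogonal to exactly those vectors `c r` with `r ∈ S j`, where `S` enumerates the
subsets with `K - 1` elements. -/
def IsNormalFamily {N : ℕ} (c : Fin R → Fin K → 𝕜)
    (S : Fin N ≃ {s : Finset (Fin R) // s.card = K - 1}) (x : Fin N → Fin K → 𝕜) : Prop :=
  ∀ j r, c r ⬝ᵥ x j = 0 ↔ r ∈ (S j).1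

theorem GeneralPosition.exists_isNormalFamily {c : Fin R → Fin K → 𝕜} (hc : GeneralPosition K c)
    (hK : 1 ≤ K) (hKR : K ≤ R) :
    ∃ (S : Fin (R.choose (K - 1)) ≃ {s : Finset (Fin R) // s.card = K - 1})
      (x : Fin (R.choose (K - 1)) → Fin K → 𝕜), IsNormalFamily c S x := by
  let S : Fin (R.choose (K - 1)) ≃ {s : Finset (Fin R) // s.card = K - 1} :=
    (Fintype.equivFinOfCardEq (by simp)).symm
  choose x hx using fun j => hc.exists_normal hK hKR (S j).2
  exact ⟨S, x, hx⟩

theorem exists_map_onto {n : ℕ} {s : Finset (Fin R)} {P : Finset (Fin n)} (hs : s.Nonempty)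
    (h : s.card ≤ P.card) : ∃ ρ : Fin n → Fin R, (∀ p, ρ p ∈ s) ∧ s ⊆ P.image ρ := by
  classical
  obtain ⟨r0, hr0⟩ := hs
  obtain ⟨e⟩ : Nonempty (s ↪ P) := Function.Embedding.nonempty_of_card_le (by simpa using h)
  refine ⟨fun p => if h : ∃ r : s, (e r : Fin n) = p then (h.choose : Fin R) else r0, ?_, ?_⟩
  · intro p
    dsimp only
    split_ifs with h
    exacts [h.choose.2, hr0]
  · intro r hr
    refine Finset.mem_image.2 ⟨e ⟨r, hr⟩, (e ⟨r, hr⟩).2, ?_⟩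
    have h : ∃ r' : s, (e r' : Fin n) = e ⟨r, hr⟩ := ⟨_, rfl⟩
    rw [dif_pos h]
    exact congrArg Subtype.val (e.injective (Subtype.ext h.choose_spec))

/-- Pair with a product of vectors `c (ρ p)`, where `ρ` maps `P` onto the complement of `S j0`. Any
other `S j` meets this complement, so a factor vanishes, while at `j0` none does. Leaving positions
outside `P` unused allows one position to be reserved for the pencil. -/
theorem IsNormalFamily.linearIndependent {N n : ℕ} {c : Fin R → Fin K → 𝕜}
    {S : Fin N ≃ {s : Finset (Fin R) // s.card = K - 1}} {x : Fin N → Fin K → 𝕜}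
    (hx : IsNormalFamily c S x) (hK : 1 ≤ K) (hKR : K ≤ R) {P : Finset (Fin n)}
    (hP : R - (K - 1) ≤ P.card) :
    LinearIndependent 𝕜 (fun j (k : Fin n → Fin K) => ∏ p ∈ P, x j (k p)) := by
  classical
  rw [Fintype.linearIndependent_iff]
  intro α hα j0
  have hcard : ((S j0).1ᶜ).card = R - (K - 1) := by rw [Finset.card_compl, (S j0).2]; simp
  obtain ⟨ρ, hρ1, hρ2⟩ := exists_map_onto (s := (S j0).1ᶜ) (P := P)
    (Finset.card_pos.1 (by omega)) (by omega)
  -- Outside `P` a unit vector fixes the index, so that position contributes a factor 1.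
  let h : Fin n → Fin K → 𝕜 := fun p => if p ∈ P then c (ρ p) else Pi.single ⟨0, hK⟩ 1
  have key : ∀ j, ∑ k : Fin n → Fin K, (∏ p, h p (k p)) * ∏ p ∈ P, x j (k p) =
      ∏ p ∈ P, c (ρ p) ⬝ᵥ x j := by
    intro j
    have h1 := Finset.prod_univ_sum (fun _ : Fin n => (Finset.univ : Finset (Fin K)))
      (fun p t => h p t * if p ∈ P then x j t else 1)
    rw [Fintype.piFinset_univ] at h1
    have h2 : ∀ k : Fin n → Fin K, ∏ p ∈ P, x j (k p) = ∏ p, if p ∈ P then x j (k p) else 1 := by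
      intro k
      rw [Finset.prod_ite_mem, Finset.univ_inter]
    simp only [h2, ← Finset.prod_mul_distrib]
    rw [← h1, ← Finset.prod_subset (Finset.subset_univ P)]
    · refine Finset.prod_congr rfl fun p hp => ?_
      simp [h, hp, dotProduct]
    · intro p _ hp
      simp [h, hp, Pi.single_apply]
  have h3 : ∑ j, α j * ∏ p ∈ P, c (ρ p) ⬝ᵥ x j = 0 := by
    simp only [← key, Finset.mul_sum]
    rw [Finset.sum_comm]
    refine Finset.sum_eq_zero fun k _ => ?_
    have := congrFun hα k
    simp only [Finset.sum_apply, Pi.smul_apply, smul_eq_mul, Pi.zero_apply] at this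
    simp only [mul_left_comm (α _), ← Finset.mul_sum, this, mul_zero]
  rw [Finset.sum_eq_single j0] at h3
  · refine (mul_eq_zero.1 h3).resolve_right (Finset.prod_ne_zero_iff.2 fun p _ => ?_)
    rw [Ne, hx]
    exact Finset.mem_compl.1 (hρ1 p)
  · intro j _ hj
    have hne : ¬ (S j).1 ⊆ (S j0).1 := fun hsub =>
      hj (S.injective (Subtype.ext (Finset.eq_of_subset_of_card_le hsub
        (by rw [(S j).2, (S j0).2]))))
    obtain ⟨r, hr, hr0⟩ := Finset.not_subset.1 hne
    obtain ⟨p, hp, hpr⟩ := Finset.mem_image.1 (hρ2 (Finset.mem_compl.2 hr0))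
    rw [Finset.prod_eq_zero hp (by rw [hx, hpr]; exact hr), mul_zero]
  · simp

/-! ### Multilinear forms and the dimension of the symmetric null space -/

/-- The multilinear form given by a tensor. -/
def tensorForm {n : ℕ} (v : (Fin n → Fin K) → 𝕜) :
    MultilinearMap 𝕜 (fun _ : Fin n => Fin K → 𝕜) 𝕜 :=
  ∑ k, v k • (MultilinearMap.mkPiAlgebra 𝕜 (Fin n) 𝕜).compLinearMap
    fun p => LinearMap.proj (k p)

theorem tensorForm_apply {n : ℕ} (v : (Fin n → Fin K) → 𝕜) (y : Fin n → Fin K → 𝕜) :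
    tensorForm v y = ∑ k, v k * ∏ p, y p (k p) := by
  simp [tensorForm]

theorem tensorForm_single {n : ℕ} (v : (Fin n → Fin K) → 𝕜) (k : Fin n → Fin K) :
    tensorForm v (fun p => Pi.single (k p) 1) = v k := by
  classical
  rw [tensorForm_apply, Finset.sum_eq_single k]
  · simp
  · intro k' _ hk
    obtain ⟨p, hp⟩ := Function.ne_iff.1 hk
    rw [Finset.prod_eq_zero (Finset.mem_univ p) (by simp [hp]), mul_zero]
  · simp

theorem tensorForm_comp_perm {n : ℕ} {v : (Fin n → Fin K) → 𝕜} (hv : v ∈ symSubspace 𝕜 n K)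
    (y : Fin n → Fin K → 𝕜) (σ : Equiv.Perm (Fin n)) :
    tensorForm v (fun p => y (σ p)) = tensorForm v y := by
  rw [tensorForm_apply, tensorForm_apply,
    ← Equiv.sum_comp (Equiv.arrowCongr σ.symm (Equiv.refl (Fin K)))]
  refine Finset.sum_congr rfl fun k _ => ?_
  have h := mem_symSubspace_iff.1 hv σ k
  refine congr_arg₂ _ h ?_
  exact Equiv.prod_comp σ fun p => y p (k p)

/-- After sorting, `ρ` labels a column of `S_{m+l}(C)`. The corresponding entry of `S_{m+l}(C)ᵀ v`
averages values of the form that all agree because `v` is symmetric. -/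
theorem tensorForm_eq_zero_of_SMat {m l : ℕ} (C : Matrix (Fin K) (Fin R) 𝕜)
    {v : (Fin (m + l) → Fin K) → 𝕜} (hv : v ∈ symSubspace 𝕜 (m + l) K)
    (h0 : (SMat m l C)ᵀ *ᵥ v = 0) {ρ : Fin (m + l) → Fin R}
    (hρ : m ≤ (Finset.univ.image ρ).card) : tensorForm v (fun p => C.col (ρ p)) = 0 := by
  have hr : m ≤ (Finset.univ.image (ρ ∘ Tuple.sort ρ)).card := by
    rwa [← Finset.image_image, Finset.image_univ_equiv]
  have h1 := congrFun h0 ⟨ρ ∘ Tuple.sort ρ, Tuple.monotone_sort ρ, hr⟩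
  have h2 : ((SMat m l C)ᵀ *ᵥ v) ⟨ρ ∘ Tuple.sort ρ, Tuple.monotone_sort ρ, hr⟩ =
      ((m + l)! : 𝕜)⁻¹ * ∑ σ : Equiv.Perm (Fin (m + l)),
        tensorForm v (fun p => C.col (ρ (Tuple.sort ρ (σ p)))) := by
    simp only [Matrix.mulVec, dotProduct, Matrix.transpose_apply, SMat, Matrix.of_apply,
      tensorForm_apply, mul_assoc, ← Finset.mul_sum, Finset.sum_mul]
    rw [Finset.sum_comm]
    congr 1
    exact Finset.sum_congr rfl fun σ _ => Finset.sum_congr rfl fun k _ => by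
      rw [mul_comm]; rfl
  have hn : ((m + l)! : 𝕜) ≠ 0 := by exact_mod_cast (m + l).factorial_ne_zero
  rw [h1] at h2
  have h3 : ∀ σ : Equiv.Perm (Fin (m + l)),
      tensorForm v (fun p => C.col (ρ (Tuple.sort ρ (σ p)))) =
        tensorForm v (fun p => C.col (ρ p)) := fun σ =>
    tensorForm_comp_perm hv (fun p => C.col (ρ p)) (σ.trans (Tuple.sort ρ))
  simp only [h3, Finset.sum_const, Finset.card_univ, Fintype.card_perm, Fintype.card_fin,
    nsmul_eq_mul, inv_mul_cancel_left₀ hn] at h2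
  exact h2.symm

/-- A tensor vanishes if its form vanishes on all tuples of vectors in general position. -/
theorem eq_zero_of_tensorForm_eq_zero {n : ℕ} {c : Fin R → Fin K → 𝕜}
    (hc : GeneralPosition K c) (hKR : K ≤ R) {v : (Fin n → Fin K) → 𝕜}
    (h : ∀ ρ : Fin n → Fin R, tensorForm v (fun p => c (ρ p)) = 0) : v = 0 := by
  obtain ⟨s, hs⟩ := Finset.exists_subset_card_eq (s := (Finset.univ : Finset (Fin R))) (n := K)
    (by simpa)
  have hli : LinearIndependent 𝕜 (fun r : s => c r) := hc s hs.2.le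
  let b := basisOfLinearIndependentOfCardEqFinrank' _ hli (by simp [hs.2])
  have h0 : tensorForm v = 0 := Module.Basis.ext_multilinear (fun _ => b) fun ρ => by
    simpa [b] using h fun p => ρ p
  ext k
  rw [← tensorForm_single v k, h0]
  rfl

/-- With the other slots fixed the form is linear in slot `p`, and `K` vectors in general position
span the whole space. -/
theorem tensorForm_update {n : ℕ} {c : Fin R → Fin K → 𝕜} (hc : GeneralPosition K c)
    {v : (Fin n → Fin K) → 𝕜} {ρ : Fin n → Fin R} (p : Fin n) {s : Finset (Fin R)}
    (hs : K ≤ s.card)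
    (h : ∀ r ∈ s, tensorForm v (fun q => c (Function.update ρ p r q)) = 0) :
    tensorForm v (fun q => c (ρ q)) = 0 := by
  have h1 : ∀ r, (fun q => c (Function.update ρ p r q)) =
      Function.update (fun q => c (ρ q)) p (c r) := fun r =>
    Function.comp_update c ρ p r
  simp only [h1] at h
  have h2 := hc.linearMap_eq_zero hs ((tensorForm v).toLinearMap (fun q => c (ρ q)) p) h
  have h3 := LinearMap.congr_fun h2 (c (ρ p))
  simpa using h3

theorem image_update_of_repeated {n : ℕ} {ρ : Fin n → Fin R} {p q : Fin n} (hpq : p ≠ q)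
    (h : ρ p = ρ q) (r : Fin R) :
    Finset.univ.image (Function.update ρ p r) = insert r (Finset.univ.image ρ) := by
  classical
  ext t
  simp only [Finset.mem_image, Finset.mem_univ, true_and, Finset.mem_insert]
  constructor
  · rintro ⟨a, rfl⟩
    by_cases ha : a = p
    · subst ha; simp
    · right; exact ⟨a, by rw [Function.update_of_ne ha]⟩
  · rintro (rfl | ⟨a, rfl⟩)
    · exact ⟨p, by simp⟩
    · by_cases ha : a = p
      · subst ha
        exact ⟨q, by rw [Function.update_of_ne hpq.symm, h]⟩
      · exact ⟨a, by rw [Function.update_of_ne ha]⟩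

/-- An admissible tuple uses at least `m` indices; conversely, `m` indices with nonzero weights can
be listed in `m + l` positions with repetitions. -/
theorem tupleProd_eq_zero_iff {m l : ℕ} (hm : 1 ≤ m) (d : Fin R → 𝕜) :
    tupleProd m l d = 0 ↔ (Finset.univ.filter fun r => d r ≠ 0).card < m := by
  classical
  constructor
  · intro h
    by_contra! hc
    obtain ⟨t, ht, htm⟩ := Finset.exists_subset_card_eq hc
    obtain ⟨ρ, hρ1, hρ2⟩ := exists_map_onto (s := t) (P := (Finset.univ : Finset (Fin (m + l))))
      (Finset.card_pos.1 (by omega)) (by simp [htm])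
    have hr : m ≤ (Finset.univ.image (ρ ∘ Tuple.sort ρ)).card := by
      rw [← Finset.image_image, Finset.image_univ_equiv]
      exact htm.ge.trans (Finset.card_le_card hρ2)
    have h1 := congrFun h ⟨ρ ∘ Tuple.sort ρ, Tuple.monotone_sort ρ, hr⟩
    obtain ⟨p, -, hp⟩ := Finset.prod_eq_zero_iff.1 h1
    exact (Finset.mem_filter.1 (ht (hρ1 (Tuple.sort ρ p)))).2 hp
  · intro h
    ext r
    obtain ⟨t, ht, hd⟩ : ∃ t ∈ Finset.univ.image r.1, d t = 0 := by
      by_contra! hc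
      have := Finset.card_le_card (s := Finset.univ.image r.1)
        (t := Finset.univ.filter fun r => d r ≠ 0) fun t ht => by simpa using hc t ht
      have := r.2.2
      omega
    obtain ⟨p, -, rfl⟩ := Finset.mem_image.1 ht
    exact Finset.prod_eq_zero (Finset.mem_univ p) hd

/-- In a slot not needed to represent `E`, the `K - 1` vectors with labels outside `E` give zero,
since `m` labels then occur. The form in that slot is thus fixed by its value at one label of `E`,
so tuples with image `E` can be changed into each other slot by slot. -/
theorem tensorForm_eq_zero_of_image_eq {m n : ℕ} {c : Fin R → Fin K → 𝕜}
    (hc : GeneralPosition K c) {v : (Fin n → Fin K) → 𝕜} (hv : v ∈ symSubspace 𝕜 n K)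
    (h0 : ∀ ρ : Fin n → Fin R, m ≤ (Finset.univ.image ρ).card →
      tensorForm v (fun p => c (ρ p)) = 0)
    {E : Finset (Fin R)} (hE : E.card + 1 = m) (hm : m + K = R + 2) {ρ₀ ρ : Fin n → Fin R}
    (hρ₀ : Finset.univ.image ρ₀ = E) (hρ : Finset.univ.image ρ = E)
    (hz : tensorForm v (fun p => c (ρ₀ p)) = 0) : tensorForm v (fun p => c (ρ p)) = 0 := by
  classical
  have hs₀ : ∀ e : E, ∃ p, ρ₀ p = e := fun e => by
    simpa using hρ₀.ge e.2
  have hs : ∀ e : E, ∃ p, ρ p = e := fun e => by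
    simpa using hρ.ge e.2
  choose f hf using hs₀
  choose g hg using hs
  have hfi : Function.Injective f := fun a b h => Subtype.ext (by rw [← hf, ← hf, h])
  have hgi : Function.Injective g := fun a b h => Subtype.ext (by rw [← hg, ← hg, h])
  -- By symmetry of the form, the slots that represent `E` in `ρ` may be moved to those that
  -- represent it in `ρ₀`.
  let e := (Equiv.ofInjective f hfi).symm.trans (Equiv.ofInjective g hgi)
  let σ : Equiv.Perm (Fin n) := e.extendSubtype
  have hσ : ∀ a, σ (f a) = g a := fun a => by
    have := Equiv.extendSubtype_apply_of_mem e (f a) ⟨a, rfl⟩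
    rw [this]
    simp [e, Equiv.ofInjective_symm_apply hfi a]
  -- Induction on the set `t` of slots where `τ` may still differ from `ρ₀`.
  have key : ∀ (t : Finset (Fin n)) (τ : Fin n → Fin R), (∀ p ∉ t, τ p = ρ₀ p) →
      (∀ a, τ (f a) = a) → (∀ p, τ p ∈ E) → tensorForm v (fun p => c (τ p)) = 0 := by
    intro t
    induction t using Finset.induction_on with
    | empty =>
      intro τ h1 _ _
      have : τ = ρ₀ := funext fun p => h1 p (by simp)
      rw [this, hz]
    | insert p t hp ih =>
      intro τ h1 h2 h3
      by_cases hpf : ∃ a, f a = p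
      · obtain ⟨a, rfl⟩ := hpf
        refine ih τ (fun q hq => ?_) h2 h3
        by_cases hqa : q = f a
        · subst hqa; rw [h2, hf]
        · exact h1 q (by simp [hqa, hq])
      · push Not at hpf
        have hp0 : ρ₀ p ∈ E := by rw [← hρ₀]; exact Finset.mem_image_of_mem _ (Finset.mem_univ _)
        -- Here `Eᶜ` has `R - (m - 1) = K - 1` elements, so one label of `E` completes a spanning
        -- set of `K` vectors.
        refine tensorForm_update hc p (s := insert (ρ₀ p) Eᶜ) ?_ fun r hr => ?_
        · rw [Finset.card_insert_of_notMem (by simpa using hp0), Finset.card_compl]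
          have := E.card_le_univ
          simp at this ⊢
          omega
        · rcases Finset.mem_insert.1 hr with rfl | hr
          · refine ih _ (fun q hq => ?_) (fun a => ?_) fun q => ?_
            · by_cases hqp : q = p
              · subst hqp; simp
              · rw [Function.update_of_ne hqp]; exact h1 q (by simp [hqp, hq])
            · rw [Function.update_of_ne (hpf a), h2]
            · by_cases hqp : q = p
              · subst hqp; simpa using hp0
              · rw [Function.update_of_ne hqp]; exact h3 q
          · apply h0
            have : insert r E ⊆ Finset.univ.image (Function.update τ p r) := by
              intro q hq
              rcases Finset.mem_insert.1 hq with rfl | hq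
              · exact Finset.mem_image.2 ⟨p, Finset.mem_univ _, by simp⟩
              · exact Finset.mem_image.2 ⟨f ⟨q, hq⟩, Finset.mem_univ _, by
                  rw [Function.update_of_ne (hpf _), h2]⟩
            have := Finset.card_le_card this
            rw [Finset.card_insert_of_notMem (Finset.mem_compl.1 hr)] at this
            omega
  rw [← tensorForm_comp_perm hv (fun p => c (ρ p)) σ]
  refine key Finset.univ (fun p => ρ (σ p)) (by simp) (fun a => by rw [hσ, hg]) fun p => ?_
  rw [← hρ]
  exact Finset.mem_image_of_mem _ (Finset.mem_univ _)

/-- Downward induction on the number of distinct labels. From `m` on the form vanishes by the kernel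
condition, and at `m - 1` by `hz`. Below that some label repeats, and its slot can be filled with at
least `K` new labels, each increasing the number of distinct ones. -/
theorem eq_zero_of_SMat_of_tensorForm {N m l : ℕ} {C : Matrix (Fin K) (Fin R) 𝕜}
    (hC : GeneralPosition K C.col) (hK : 2 ≤ K) (hKR : K ≤ R) (hm : m + K = R + 2)
    {S : Fin N ≃ {s : Finset (Fin R) // s.card = K - 1}} {ρ₀ : Fin N → Fin (m + l) → Fin R}
    (hρ₀ : ∀ j, Finset.univ.image (ρ₀ j) = (S j).1ᶜ) {v : (Fin (m + l) → Fin K) → 𝕜}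
    (hv : v ∈ symSubspace 𝕜 (m + l) K) (h0 : (SMat m l C)ᵀ *ᵥ v = 0)
    (hz : ∀ j, tensorForm v (fun p => C.col (ρ₀ j p)) = 0) : v = 0 := by
  classical
  have hbig : ∀ ρ : Fin (m + l) → Fin R, m ≤ (Finset.univ.image ρ).card →
      tensorForm v (fun p => C.col (ρ p)) = 0 := fun ρ hρ => tensorForm_eq_zero_of_SMat C hv h0 hρ
  refine eq_zero_of_tensorForm_eq_zero hC hKR fun ρ => ?_
  induction hd : m - (Finset.univ.image ρ).card using Nat.strong_induction_on generalizing ρ with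
  | _ d ih =>
    rcases lt_trichotomy ((Finset.univ.image ρ).card + 1) m with hlt | heq | hgt
    · have hni : ¬ Function.Injective ρ := fun hi => by
        have := Finset.card_image_of_injective Finset.univ hi
        simp at this
        omega
      simp only [Function.Injective, not_forall] at hni
      obtain ⟨p, q, hpq, hne⟩ := hni
      refine tensorForm_update hC p (s := (Finset.univ.image ρ)ᶜ) ?_ fun r hr => ?_
      · rw [Finset.card_compl, Fintype.card_fin]
        omega
      · refine ih _ ?_ _ rfl
        rw [image_update_of_repeated hne hpq, Finset.card_insert_of_notMem (Finset.mem_compl.1 hr)]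
        omega
    · have hcard : ((Finset.univ.image ρ)ᶜ).card = K - 1 := by
        rw [Finset.card_compl, Fintype.card_fin]
        omega
      obtain ⟨j, hj⟩ := S.surjective ⟨_, hcard⟩
      refine tensorForm_eq_zero_of_image_eq hC hv hbig heq hm ?_ rfl (hz j)
      rw [hρ₀, hj, compl_compl]
    · exact hbig ρ (by omega)

/-- One value of the form for each complement of a `(K - 1)`-set determines the tensor. -/
theorem finrank_ker_SMat_inf_symSubspace_le {m l : ℕ} {C : Matrix (Fin K) (Fin R) 𝕜}
    (hC : GeneralPosition K C.col) (hK : 2 ≤ K) (hKR : K ≤ R) (hm : m + K = R + 2) :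
    Module.finrank 𝕜 ↥(matKer (SMat m l C)ᵀ ⊓ symSubspace 𝕜 (m + l) K) ≤ R.choose (K - 1) := by
  classical
  obtain ⟨S, -⟩ := hC.exists_isNormalFamily (by omega) hKR
  have hcard : ∀ j, ((S j).1ᶜ).card = R - (K - 1) := fun j => by
    rw [Finset.card_compl, (S j).2]; simp
  have hex : ∀ j, ∃ ρ : Fin (m + l) → Fin R, Finset.univ.image ρ = (S j).1ᶜ := fun j => by
    obtain ⟨ρ, h1, h2⟩ := exists_map_onto (s := (S j).1ᶜ)
      (P := (Finset.univ : Finset (Fin (m + l)))) (Finset.card_pos.1 (by have := hcard j; omega))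
      (by have := hcard j; simp only [Finset.card_univ, Fintype.card_fin]; omega)
    exact ⟨ρ, (Finset.image_subset_iff.2 fun p _ => h1 p).antisymm h2⟩
  choose ρ₀ hρ₀ using hex
  let F : ((Fin (m + l) → Fin K) → 𝕜) →ₗ[𝕜] (Fin (R.choose (K - 1)) → 𝕜) :=
    LinearMap.pi fun j => ∑ k, (∏ p, C.col (ρ₀ j p) (k p)) • LinearMap.proj k
  have hF : ∀ v j, F v j = tensorForm v (fun p => C.col (ρ₀ j p)) := fun v j => by
    simp [F, tensorForm_apply, mul_comm]
  have hinj : Function.Injective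
      (F ∘ₗ (matKer (SMat m l C)ᵀ ⊓ symSubspace 𝕜 (m + l) K).subtype) := by
    rw [← LinearMap.ker_eq_bot, LinearMap.ker_eq_bot']
    rintro ⟨v, hv1, hv2⟩ h
    refine Subtype.ext (eq_zero_of_SMat_of_tensorForm hC hK hKR hm hρ₀ hv2 hv1 fun j => ?_)
    rw [← hF]
    exact congrFun h j
  simpa using LinearMap.finrank_le_finrank_of_injective hinj

theorem IsNormalFamily.card_filter_ne_zero {N : ℕ} {c : Fin R → Fin K → 𝕜}
    {S : Fin N ≃ {s : Finset (Fin R) // s.card = K - 1}} {x : Fin N → Fin K → 𝕜}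
    (hx : IsNormalFamily c S x) (j : Fin N) :
    (Finset.univ.filter fun r => c r ⬝ᵥ x j ≠ 0).card = R - (K - 1) := by
  classical
  have : (Finset.univ.filter fun r => c r ⬝ᵥ x j ≠ 0) = (S j).1ᶜ := by
    ext r; simp [hx j r]
  rw [this, Finset.card_compl, (S j).2, Fintype.card_fin]

theorem IsNormalFamily.linearIndependent_tensorPow {N n : ℕ} {c : Fin R → Fin K → 𝕜}
    {S : Fin N ≃ {s : Finset (Fin R) // s.card = K - 1}} {x : Fin N → Fin K → 𝕜}
    (hx : IsNormalFamily c S x) (hK : 1 ≤ K) (hKR : K ≤ R) (hn : R - (K - 1) ≤ n) :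
    LinearIndependent 𝕜 (fun j => tensorPow n (x j)) :=
  hx.linearIndependent hK hKR (P := Finset.univ) (by rwa [Finset.card_univ, Fintype.card_fin])

/-- The powers lie in the kernel because a normal vector leaves only `m - 1` nonzero weights; their
independence and number match the upper bound on the dimension. -/
theorem ker_SMat_inf_symSubspace {m l : ℕ} {C : Matrix (Fin K) (Fin R) 𝕜}
    (hC : GeneralPosition K C.col) (hK : 2 ≤ K) (hKR : K ≤ R) (hm : m + K = R + 2)
    {S : Fin (R.choose (K - 1)) ≃ {s : Finset (Fin R) // s.card = K - 1}}
    {x : Fin (R.choose (K - 1)) → Fin K → 𝕜} (hx : IsNormalFamily C.col S x) :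
    matKer (SMat m l C)ᵀ ⊓ symSubspace 𝕜 (m + l) K =
      Submodule.span 𝕜 (Set.range fun j => tensorPow (m + l) (x j)) := by
  refine (Submodule.eq_of_le_of_finrank_le ?_ ?_).symm
  · rw [Submodule.span_le]
    rintro _ ⟨j, rfl⟩
    refine ⟨?_, tensorPow_mem_symSubspace _ _⟩
    change (SMat m l C)ᵀ *ᵥ tensorPow (m + l) (x j) = 0
    rw [SMat_transpose_mulVec_tensorPow, tupleProd_eq_zero_iff (by omega)]
    have h := hx.card_filter_ne_zero j
    change (Finset.univ.filter fun r => C.col r ⬝ᵥ x j ≠ 0).card < m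
    omega
  · rw [finrank_span_eq_card (hx.linearIndependent_tensorPow (by omega) hKR (by omega))]
    simpa using finrank_ker_SMat_inf_symSubspace_le hC hK hKR hm

theorem finrank_ker_SMat_inf_symSubspace {m l : ℕ} {C : Matrix (Fin K) (Fin R) 𝕜}
    (hC : GeneralPosition K C.col) (hK : 2 ≤ K) (hKR : K ≤ R) (hm : m + K = R + 2) :
    Module.finrank 𝕜 ↥(matKer (SMat m l C)ᵀ ⊓ symSubspace 𝕜 (m + l) K) = R.choose (K - 1) := by
  obtain ⟨S, x, hx⟩ := hC.exists_isNormalFamily (by omega) hKR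
  rw [ker_SMat_inf_symSubspace hC hK hKR hm hx,
    finrank_span_eq_card (hx.linearIndependent_tensorPow (by omega) hKR (by omega))]
  simp

/-! ### Ranges and minors of `A D Bᵀ` -/

/-- The positions of the nonzero entries. -/
def supp (d : Fin R → 𝕜) : Finset (Fin R) := by
  classical exact Finset.univ.filter fun r => d r ≠ 0

theorem mem_supp {d : Fin R → 𝕜} {r : Fin R} : r ∈ supp d ↔ d r ≠ 0 := by simp [supp]

theorem weighted_mulVec (A : Matrix (Fin I) (Fin R) 𝕜) (B : Matrix (Fin J) (Fin R) 𝕜)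
    (d : Fin R → 𝕜) (w : Fin J → 𝕜) :
    (A * Matrix.diagonal d * Bᵀ) *ᵥ w = ∑ r, (d r * (B.col r ⬝ᵥ w)) • A.col r := by
  ext i
  rw [← Matrix.mulVec_mulVec, ← Matrix.mulVec_mulVec]
  simp only [Matrix.mulVec, dotProduct, Matrix.diagonal_apply, Finset.sum_apply, Pi.smul_apply,
    smul_eq_mul, ite_mul, zero_mul, Finset.sum_ite_eq, Finset.mem_univ, if_true, Matrix.col_apply,
    Matrix.transpose_apply]
  exact Finset.sum_congr rfl fun r _ => by ring

theorem matRange_weighted_le (A : Matrix (Fin I) (Fin R) 𝕜) (B : Matrix (Fin J) (Fin R) 𝕜)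
    (d : Fin R → 𝕜) :
    matRange (A * Matrix.diagonal d * Bᵀ) ≤ Submodule.span 𝕜 (A.col '' supp d) := by
  rintro _ ⟨w, rfl⟩
  rw [Matrix.mulVecLin_apply, weighted_mulVec]
  refine Submodule.sum_mem _ fun r _ => ?_
  by_cases h : d r = 0
  · simp [h]
  · exact Submodule.smul_mem _ _ (Submodule.subset_span ⟨r, mem_supp.2 h, rfl⟩)

/-- Independent columns of `B` can be separated by a vector `w`, so each column of `A` with nonzero
weight is reached on its own. -/
theorem matRange_weighted {A : Matrix (Fin I) (Fin R) 𝕜} {B : Matrix (Fin J) (Fin R) 𝕜}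
    {d : Fin R → 𝕜} (hB : LinearIndepOn 𝕜 B.col (supp d : Set (Fin R))) :
    matRange (A * Matrix.diagonal d * Bᵀ) = Submodule.span 𝕜 (A.col '' supp d) := by
  classical
  refine (matRange_weighted_le A B d).antisymm (Submodule.span_le.2 ?_)
  rintro _ ⟨r, hr, rfl⟩
  obtain ⟨w, hw⟩ := exists_dotProduct_eq hB (Pi.single r (d r)⁻¹)
  refine ⟨w, ?_⟩
  rw [Matrix.mulVecLin_apply, weighted_mulVec, Finset.sum_eq_single r]
  · rw [hw r hr, Pi.single_eq_same, mul_inv_cancel₀ (mem_supp.1 hr), one_smul]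
  · intro s _ hs
    by_cases h : d s = 0
    · simp [h]
    · rw [hw s (mem_supp.2 h), Pi.single_eq_of_ne hs]; simp
  · simp

theorem finrank_span_image_le (v : Fin R → Fin K → 𝕜) (s : Finset (Fin R)) :
    Module.finrank 𝕜 (Submodule.span 𝕜 (v '' s)) ≤ s.card := by
  classical
  rw [← Finset.coe_image]
  exact (finrank_span_finset_le_card _).trans Finset.card_image_le

theorem finrank_span_image {v : Fin R → Fin K → 𝕜} {s : Finset (Fin R)}
    (h : LinearIndepOn 𝕜 v (s : Set (Fin R))) :
    Module.finrank 𝕜 (Submodule.span 𝕜 (v '' s)) = s.card := by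
  have h1 : LinearIndependent 𝕜 (fun r : s => v r) := h
  have h2 := finrank_span_eq_card h1
  rw [Fintype.card_coe] at h2
  rw [← h2, Set.image_eq_range]
  rfl

theorem rank_eq_finrank_matRange (F : Matrix (Fin I) (Fin J) 𝕜) :
    F.rank = Module.finrank 𝕜 (matRange F) := rfl

theorem minors_eq_zero_of_rank_lt {m : ℕ} (l : ℕ) {F : Matrix (Fin I) (Fin J) 𝕜}
    (h : F.rank < m) : minors m l F = 0 := by
  ext ij
  have hdet : (Matrix.of fun u v : Fin m =>
      F (ij.1 (Fin.castAdd l u)) (ij.2 (Fin.castAdd l v))).det = 0 := by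
    by_contra hne
    have h1 := Matrix.rank_of_isUnit (R := 𝕜) (Matrix.of fun u v : Fin m =>
      F (ij.1 (Fin.castAdd l u)) (ij.2 (Fin.castAdd l v)))
      ((Matrix.isUnit_iff_isUnit_det _).2 (isUnit_iff_ne_zero.2 hne))
    have h2 := F.rank_submatrix_le (fun u => ij.1 (Fin.castAdd l u))
      (fun v : Fin m => ij.2 (Fin.castAdd l v))
    have h3 : (F.submatrix (fun u : Fin m => ij.1 (Fin.castAdd l u))
        fun v : Fin m => ij.2 (Fin.castAdd l v)).rank = m :=
      h1.trans (Fintype.card_fin m)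
    omega
  simp [minors, hdet]

/-! ### The rank conditions -/

/-- This removes the chosen basis: the condition is injectivity of `Φ_{m,l}(A,B)` on the range of
`S_{m+l}(C)ᵀ`. -/
theorem fullColumnRank_Phi_mul_iff {m l d : ℕ} {A : Matrix (Fin I) (Fin R) 𝕜}
    {B : Matrix (Fin J) (Fin R) 𝕜} {C : Matrix (Fin K) (Fin R) 𝕜}
    {U : Matrix (Tuples m l R) (Fin d) 𝕜} (hU : ColumnsFormBasis U (matRange (SMat m l C)ᵀ)) :
    FullColumnRank (Phi m l A B * U) ↔
      ∀ v, Phi m l A B *ᵥ ((SMat m l C)ᵀ *ᵥ v) = 0 → (SMat m l C)ᵀ *ᵥ v = 0 := by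
  have hspan : matRange U = matRange (SMat m l C)ᵀ := by
    rw [← hU.2, matRange, Matrix.range_mulVecLin]
  have hinj : Function.Injective U.mulVec := Matrix.mulVec_injective_iff.2 hU.1
  rw [FullColumnRank, ← Matrix.mulVec_injective_iff,
    ← Matrix.coe_mulVecLin, ← LinearMap.ker_eq_bot, LinearMap.ker_eq_bot']
  constructor
  · intro h v hv
    have hv' : (SMat m l C)ᵀ *ᵥ v ∈ matRange U := by rw [hspan]; exact ⟨v, rfl⟩
    obtain ⟨w, hw⟩ := hv'
    rw [Matrix.mulVecLin_apply] at hw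
    rw [← hw] at hv ⊢
    rw [h w (by rw [Matrix.mulVecLin_apply, ← Matrix.mulVec_mulVec, hv]), Matrix.mulVec_zero]
  · intro h w hw
    rw [Matrix.mulVecLin_apply, ← Matrix.mulVec_mulVec] at hw
    have hw' : U *ᵥ w ∈ matRange (SMat m l C)ᵀ := by rw [← hspan]; exact ⟨w, rfl⟩
    obtain ⟨v, hv⟩ := hw'
    rw [Matrix.mulVecLin_apply] at hv
    have h0 : U *ᵥ w = 0 := by
      rw [← hv]; exact h v (by rw [hv, hw])
    exact hinj (by rw [h0, Matrix.mulVec_zero])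

theorem ker_SMat_le_ker_RMat {m l : ℕ} (A : Matrix (Fin I) (Fin R) 𝕜)
    (B : Matrix (Fin J) (Fin R) 𝕜) (C : Matrix (Fin K) (Fin R) 𝕜) :
    matKer (SMat m l C)ᵀ ⊓ symSubspace 𝕜 (m + l) K ≤
      matKer (RMat m l (polyadic A B C)) ⊓ symSubspace 𝕜 (m + l) K := by
  rintro v ⟨hv1, hv2⟩
  refine ⟨?_, hv2⟩
  have hv1' : (SMat m l C)ᵀ *ᵥ v = 0 := hv1
  change RMat m l (polyadic A B C) *ᵥ v = 0
  rw [RMat_mulVec_eq A B C hv2, hv1', Matrix.mulVec_zero]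

theorem ker_RMat_eq {m l : ℕ} {A : Matrix (Fin I) (Fin R) 𝕜} {B : Matrix (Fin J) (Fin R) 𝕜}
    {C : Matrix (Fin K) (Fin R) 𝕜}
    (h : ∀ v, Phi m l A B *ᵥ ((SMat m l C)ᵀ *ᵥ v) = 0 → (SMat m l C)ᵀ *ᵥ v = 0) :
    matKer (RMat m l (polyadic A B C)) ⊓ symSubspace 𝕜 (m + l) K =
      matKer (SMat m l C)ᵀ ⊓ symSubspace 𝕜 (m + l) K := by
  refine le_antisymm ?_ (ker_SMat_le_ker_RMat A B C)
  rintro v ⟨hv1, hv2⟩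
  have hv1' : RMat m l (polyadic A B C) *ᵥ v = 0 := hv1
  rw [RMat_mulVec_eq A B C hv2] at hv1'
  exact ⟨h v hv1', hv2⟩

/-- One kernel contains the other, whose dimension is known; equality of dimensions is equality of
kernels. -/
theorem injective_iff_finrank_ker_RMat {m l : ℕ} {A : Matrix (Fin I) (Fin R) 𝕜}
    {B : Matrix (Fin J) (Fin R) 𝕜} {C : Matrix (Fin K) (Fin R) 𝕜}
    (hC : GeneralPosition K C.col) (hK : 2 ≤ K) (hKR : K ≤ R) (hm : m + K = R + 2) :
    (∀ v, Phi m l A B *ᵥ ((SMat m l C)ᵀ *ᵥ v) = 0 → (SMat m l C)ᵀ *ᵥ v = 0) ↔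
      Module.finrank 𝕜 ↥(matKer (RMat m l (polyadic A B C)) ⊓ symSubspace 𝕜 (m + l) K) =
        R.choose (K - 1) := by
  constructor
  · intro h
    rw [ker_RMat_eq h, finrank_ker_SMat_inf_symSubspace hC hK hKR hm]
  · intro h v hv
    have heq := Submodule.eq_of_le_of_finrank_eq (ker_SMat_le_ker_RMat (m := m) (l := l) A B C)
      (by rw [h, finrank_ker_SMat_inf_symSubspace hC hK hKR hm])
    -- A symmetric representative is needed, since the two matrices agree only on symmetric tensors.
    obtain ⟨w, hw, hwv⟩ := exists_mem_symSubspace_SMat (m := m) (l := l) C v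
    rw [← hwv] at hv ⊢
    have hmem : w ∈ matKer (RMat m l (polyadic A B C)) ⊓ symSubspace 𝕜 (m + l) K := by
      refine ⟨?_, hw⟩
      change RMat m l (polyadic A B C) *ᵥ w = 0
      rw [RMat_mulVec_eq A B C hw, hv]
    rw [← heq] at hmem
    exact hmem.1

/-- Apply injectivity to the power of `x`: its image consists of `m × m` minors times entries, so
rank below `m` makes it zero. -/
theorem card_supp_lt_of_rank_lt {m l : ℕ} (hm : 1 ≤ m) {A : Matrix (Fin I) (Fin R) 𝕜}
    {B : Matrix (Fin J) (Fin R) 𝕜} {C : Matrix (Fin K) (Fin R) 𝕜}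
    (h : ∀ v, Phi m l A B *ᵥ ((SMat m l C)ᵀ *ᵥ v) = 0 → (SMat m l C)ᵀ *ᵥ v = 0)
    (x : Fin K → 𝕜) (hx : (A * Matrix.diagonal (Cᵀ *ᵥ x) * Bᵀ).rank < m) :
    (supp (Cᵀ *ᵥ x)).card < m := by
  have h1 := h (tensorPow (m + l) x)
  rw [SMat_transpose_mulVec_tensorPow, Phi_mulVec_tupleProd, minors_eq_zero_of_rank_lt l hx,
    smul_zero, tupleProd_eq_zero_iff hm] at h1
  convert h1 rfl
  ext r
  simp [mem_supp]

/-- Orthogonality to the `K - 2` columns outside `s` leaves a space on which no column of `s`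
vanishes identically. Finitely many nonzero functionals over an infinite field are all nonzero at a
common point. -/
theorem GeneralPosition.exists_supp_eq {C : Matrix (Fin K) (Fin R) 𝕜}
    (hC : GeneralPosition K C.col) (hK : 2 ≤ K) {s : Finset (Fin R)} (hs : s.card + K = R + 2) :
    ∃ x : Fin K → 𝕜, supp (Cᵀ *ᵥ x) = s := by
  classical
  have hsc : (sᶜ).card = K - 2 := by
    have := s.card_le_univ
    rw [Fintype.card_fin] at this
    rw [Finset.card_compl, Fintype.card_fin]; omega
  let V : Submodule 𝕜 (Fin K → 𝕜) :=
    LinearMap.ker (LinearMap.pi fun r : (sᶜ : Finset (Fin R)) =>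
      (Matrix.of fun _ : Unit => C.col r).mulVecLin)
  have hV : ∀ x, x ∈ V ↔ ∀ r ∉ s, C.col r ⬝ᵥ x = 0 := by
    intro x
    simp only [V, LinearMap.mem_ker]
    constructor
    · intro h r hr
      exact congrFun (congrFun h ⟨r, Finset.mem_compl.2 hr⟩) ()
    · intro h
      ext r u
      exact h r.1 (Finset.mem_compl.1 r.2)
  obtain ⟨x, hx⟩ := Module.Dual.exists_forall_ne_zero_of_forall_exists
    (fun r : s => (LinearMap.proj () ∘ₗ (Matrix.of fun _ : Unit => C.col r).mulVecLin) ∘ₗ V.subtype)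
    (fun r => by
      obtain ⟨x, hx⟩ := exists_dotProduct_eq (hC (insert r.1 sᶜ)
        ((Finset.card_insert_le _ _).trans (by omega))) (Pi.single r.1 1)
      refine ⟨⟨x, (hV x).2 fun t ht => ?_⟩, ?_⟩
      · rw [hx t (by simp [ht]), Pi.single_eq_of_ne]
        rintro rfl
        exact ht r.2
      · change C.col r ⬝ᵥ x ≠ 0
        rw [hx r (by simp)]; simp)
  refine ⟨x, Finset.ext fun r => ?_⟩
  rw [mem_supp]
  constructor
  · intro h
    by_contra hr
    exact h ((hV x).1 x.2 r hr)
  · intro h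
    exact hx ⟨r, h⟩

/-- Weights supported exactly on `s` give a contraction of rank at least `m`, while its range lies
in the span of the `m` columns of `A` in `s`; the transpose treats `B`. -/
theorem linearIndepOn_of_injective {m l : ℕ} {A : Matrix (Fin I) (Fin R) 𝕜}
    {B : Matrix (Fin J) (Fin R) 𝕜} {C : Matrix (Fin K) (Fin R) 𝕜}
    (hC : GeneralPosition K C.col) (hK : 2 ≤ K) (hKR : K ≤ R) (hm : m + K = R + 2)
    (h : ∀ v, Phi m l A B *ᵥ ((SMat m l C)ᵀ *ᵥ v) = 0 → (SMat m l C)ᵀ *ᵥ v = 0)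
    {s : Finset (Fin R)} (hs : s.card = m) :
    LinearIndepOn 𝕜 A.col (s : Set (Fin R)) ∧ LinearIndepOn 𝕜 B.col (s : Set (Fin R)) := by
  obtain ⟨x, hx⟩ := hC.exists_supp_eq hK (s := s) (by omega)
  have key : m ≤ (A * Matrix.diagonal (Cᵀ *ᵥ x) * Bᵀ).rank := by
    by_contra! hlt
    have := card_supp_lt_of_rank_lt (by omega) h x hlt
    rw [hx] at this
    omega
  have li : ∀ {q : ℕ} (v : Fin R → Fin q → 𝕜), m ≤ Module.finrank 𝕜 (Submodule.span 𝕜 (v '' s)) →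
      LinearIndepOn 𝕜 v (s : Set (Fin R)) := by
    intro q v hv
    have : LinearIndependent 𝕜 (fun r : s => v r) := by
      rw [linearIndependent_iff_card_le_finrank_span, Fintype.card_coe, hs, Set.finrank]
      rw [Set.image_eq_range] at hv
      exact hv
    exact this
  constructor
  · refine li _ (key.trans ?_)
    rw [← hx, rank_eq_finrank_matRange]
    exact Submodule.finrank_mono (matRange_weighted_le _ _ _)
  · refine li _ (key.trans ?_)
    rw [← Matrix.rank_transpose, Matrix.transpose_mul, Matrix.transpose_mul,
      Matrix.transpose_transpose, Matrix.diagonal_transpose, ← Matrix.mul_assoc, ← hx,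
      rank_eq_finrank_matRange]
    exact Submodule.finrank_mono (matRange_weighted_le _ _ _)

/-! ### Uniqueness -/

/-- The properties of a decomposition that imply that it is the only one. -/
structure IsRigid (m : ℕ) (A : Matrix (Fin I) (Fin R) 𝕜) (B : Matrix (Fin J) (Fin R) 𝕜)
    (C : Matrix (Fin K) (Fin R) 𝕜) : Prop where
  two_le : 2 ≤ K
  le : K ≤ R
  add_eq : m + K = R + 2
  posA : GeneralPosition m A.col
  posB : GeneralPosition m B.col
  posC : GeneralPosition K C.col
  khatriRao : FullColumnRank (khatriRao A B)
  card_supp_lt : ∀ x : Fin K → 𝕜, (A * Matrix.diagonal (Cᵀ *ᵥ x) * Bᵀ).rank < m →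
    (supp (Cᵀ *ᵥ x)).card < m

theorem eq_zero_of_khatriRao {A : Matrix (Fin I) (Fin R) 𝕜} {B : Matrix (Fin J) (Fin R) 𝕜}
    (h : FullColumnRank (khatriRao A B)) {d : Fin R → 𝕜}
    (hd : ∀ i j, ∑ r, A i r * B j r * d r = 0) : d = 0 := by
  have h1 := Matrix.mulVec_injective_iff.2 h
  refine h1 ?_
  rw [Matrix.mulVec_zero]
  ext p
  exact hd p.1 p.2

theorem weighted_eq {R' : ℕ} {A : Matrix (Fin I) (Fin R) 𝕜} {B : Matrix (Fin J) (Fin R) 𝕜}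
    {C : Matrix (Fin K) (Fin R) 𝕜} {A' : Matrix (Fin I) (Fin R') 𝕜}
    {B' : Matrix (Fin J) (Fin R') 𝕜} {C' : Matrix (Fin K) (Fin R') 𝕜}
    (hT : polyadic A B C = polyadic A' B' C') (x : Fin K → 𝕜) :
    A * Matrix.diagonal (Cᵀ *ᵥ x) * Bᵀ = A' * Matrix.diagonal (C'ᵀ *ᵥ x) * B'ᵀ := by
  rw [← contract_polyadic, ← contract_polyadic, hT]

theorem card_supp_add {d : Fin R → 𝕜} (s : Finset (Fin R)) (h : ∀ r ∈ s, d r = 0) :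
    (supp d).card + s.card ≤ R := by
  have hdisj : Disjoint (supp d) s :=
    Finset.disjoint_left.2 fun r h1 h2 => mem_supp.1 h1 (h r h2)
  have := (Finset.card_union_of_disjoint hdisj).symm.le.trans (Finset.card_le_univ _)
  simpa using this

/-! ### Competing decompositions with at most `R` terms -/

section

variable {m R' : ℕ} {A : Matrix (Fin I) (Fin R) 𝕜} {B : Matrix (Fin J) (Fin R) 𝕜}
  {C : Matrix (Fin K) (Fin R) 𝕜} {A' : Matrix (Fin I) (Fin R') 𝕜}
  {B' : Matrix (Fin J) (Fin R') 𝕜} {C' : Matrix (Fin K) (Fin R') 𝕜}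

theorem IsRigid.eq_zero (h : IsRigid m A B C) {x : Fin K → 𝕜} (hx : Cᵀ *ᵥ x = 0) : x = 0 :=
  h.posC.eq_zero (s := Finset.univ) (by simpa using h.le) fun r _ => congrFun hx r

/-- Fewer than `m - 1` nonzero weights would make `x` orthogonal to `K` columns of `C`. -/
theorem IsRigid.card_supp (h : IsRigid m A B C) {x : Fin K → 𝕜} (hx : x ≠ 0)
    (hr : (A * Matrix.diagonal (Cᵀ *ᵥ x) * Bᵀ).rank < m) : (supp (Cᵀ *ᵥ x)).card + 1 = m := by
  have h1 := h.card_supp_lt x hr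
  have h2 := h.add_eq
  by_contra hne
  refine hx (h.posC.eq_zero (s := (supp (Cᵀ *ᵥ x))ᶜ) ?_ fun r hr => ?_)
  · rw [Finset.card_compl, Fintype.card_fin]; omega
  · by_contra h3
    exact Finset.mem_compl.1 hr (mem_supp.2 h3)

theorem IsRigid.finrank_matRange (h : IsRigid m A B C) {x : Fin K → 𝕜}
    (hx : (supp (Cᵀ *ᵥ x)).card + 1 = m) :
    matRange (A * Matrix.diagonal (Cᵀ *ᵥ x) * Bᵀ) =
      Submodule.span 𝕜 (A.col '' supp (Cᵀ *ᵥ x)) ∧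
    Module.finrank 𝕜 (matRange (A * Matrix.diagonal (Cᵀ *ᵥ x) * Bᵀ)) = (supp (Cᵀ *ᵥ x)).card := by
  have h1 := matRange_weighted (A := A) (h.posB (supp (Cᵀ *ᵥ x)) (by omega))
  refine ⟨h1, ?_⟩
  rw [h1, finrank_span_image (h.posA _ (by omega))]

/-- At most `R' - (K - 1) ≤ m - 1` weights of the second decomposition survive, so the rank is below
`m`. Then the first decomposition has exactly `m - 1` nonzero weights and the contraction has rank
`m - 1`, which leaves no slack. -/
theorem IsRigid.hyperplane (h : IsRigid m A B C) (hR : R' ≤ R)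
    (hT : polyadic A B C = polyadic A' B' C') {x : Fin K → 𝕜} (hx : x ≠ 0)
    {s : Finset (Fin R')} (hs : K - 1 ≤ s.card) (hs0 : ∀ r ∈ s, C'.col r ⬝ᵥ x = 0) :
    R' = R ∧ s.card = K - 1 ∧ (supp (Cᵀ *ᵥ x)).card + 1 = m ∧
      (supp (C'ᵀ *ᵥ x)).card + 1 = m := by
  have hle : (A * Matrix.diagonal (Cᵀ *ᵥ x) * Bᵀ).rank ≤ (supp (C'ᵀ *ᵥ x)).card := by
    rw [weighted_eq hT, rank_eq_finrank_matRange]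
    exact (Submodule.finrank_mono (matRange_weighted_le _ _ _)).trans (finrank_span_image_le _ _)
  have h1 := card_supp_add (d := C'ᵀ *ᵥ x) s hs0
  have h2 := h.add_eq
  have h3 := h.two_le
  have h4 := h.card_supp hx (by omega)
  have h5 := (h.finrank_matRange h4).2
  rw [rank_eq_finrank_matRange] at hle
  omega

/-- A vector orthogonal to all columns of `C'` contracts the tensor to zero; independence of the
columns of `A ⊙ B` gives `Cᵀx = 0`, and so `x = 0`. -/
theorem IsRigid.span_eq_top (h : IsRigid m A B C) (hT : polyadic A B C = polyadic A' B' C') :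
    Submodule.span 𝕜 (C'.col '' Set.univ) = ⊤ := by
  refine eq_top_iff.2 fun v _ => mem_of_forall_dotProduct_eq_zero fun x hx => ?_
  have h0 : C'ᵀ *ᵥ x = 0 := funext fun r => hx _ (Submodule.subset_span ⟨r, trivial, rfl⟩)
  have h1 : Cᵀ *ᵥ x = 0 := by
    refine eq_zero_of_khatriRao h.khatriRao fun i j => ?_
    rw [← weighted_apply, weighted_eq hT, h0, weighted_apply]
    simp
  rw [h.eq_zero h1, dotProduct_zero]

theorem IsRigid.exists_extension (h : IsRigid m A B C)
    (hT : polyadic A B C = polyadic A' B' C') {s : Finset (Fin R')}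
    (hs : LinearIndepOn 𝕜 C'.col (s : Set (Fin R'))) :
    ∃ t : Finset (Fin R'), s ⊆ t ∧ LinearIndepOn 𝕜 C'.col (t : Set (Fin R')) ∧ t.card = K := by
  classical
  obtain ⟨b, -, hsb, hspan, hb⟩ := exists_linearIndepOn_extension hs (Set.subset_univ _)
  lift b to Finset (Fin R') using Set.toFinite b
  refine ⟨b, by exact_mod_cast hsb, hb, ?_⟩
  rw [← finrank_span_image hb]
  have : Submodule.span 𝕜 (C'.col '' (b : Set (Fin R'))) = ⊤ := by
    rw [eq_top_iff, ← h.span_eq_top hT]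
    exact Submodule.span_le.2 hspan
  rw [this]
  simp

/-- A vector dual to one element of a basis of columns of `C'` is orthogonal to the other `K - 1`,
so `IsRigid.hyperplane` applies. -/
theorem IsRigid.eq_of_le (h : IsRigid m A B C) (hR : R' ≤ R)
    (hT : polyadic A B C = polyadic A' B' C') : R' = R := by
  classical
  have h2 := h.two_le
  obtain ⟨t, -, ht, htK⟩ := h.exists_extension hT (s := ∅) (by simp)
  obtain ⟨e, he⟩ := Finset.card_pos.1 (by omega : 0 < t.card)
  obtain ⟨x, hx⟩ := exists_dotProduct_eq ht (Pi.single e 1)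
  refine (h.hyperplane hR hT (x := x) ?_ (s := t.erase e) ?_ fun r hr => ?_).1
  · rintro rfl
    have := hx e he
    simp at this
  · rw [Finset.card_erase_of_mem he]; omega
  · rw [hx r (Finset.mem_of_mem_erase hr), Pi.single_eq_of_ne (Finset.ne_of_mem_erase hr)]

end

/-! ### Competing decompositions with exactly `R` terms -/

section

variable {m : ℕ} {A A' : Matrix (Fin I) (Fin R) 𝕜} {B B' : Matrix (Fin J) (Fin R) 𝕜}
  {C C' : Matrix (Fin K) (Fin R) 𝕜}

/-- If `K` columns of `C'` were dependent, some `x ≠ 0` would be orthogonal to all of them, whereas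
`IsRigid.hyperplane` allows only `K - 1`. -/
theorem IsRigid.generalPosition (h : IsRigid m A B C) (hT : polyadic A B C = polyadic A' B' C') :
    GeneralPosition K C'.col := by
  classical
  refine generalPosition_of_card_eq h.le fun s hs => ?_
  obtain ⟨b, hbs, -, hspan, hb⟩ := exists_linearIndepOn_extension
    (linearIndepOn_empty 𝕜 C'.col) (Set.empty_subset (s : Set (Fin R)))
  lift b to Finset (Fin R) using Set.toFinite b
  have hbs' : b ⊆ s := by exact_mod_cast hbs
  by_contra hns
  have hlt : b.card < K := by
    rw [← hs]
    refine Finset.card_lt_card (Finset.ssubset_iff_subset_ne.2 ⟨hbs', ?_⟩)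
    rintro rfl
    exact hns hb
  obtain ⟨t, hbt, ht, htK⟩ := h.exists_extension hT hb
  obtain ⟨e, het, heb⟩ := Finset.exists_mem_notMem_of_card_lt_card (by omega : b.card < t.card)
  obtain ⟨x, hx⟩ := exists_dotProduct_eq ht (Pi.single e 1)
  have hx0 : x ≠ 0 := by
    rintro rfl
    have := hx e het
    simp at this
  have hbx : ∀ y ∈ Submodule.span 𝕜 (C'.col '' (b : Set (Fin R))), y ⬝ᵥ x = 0 := by
    intro y hy
    induction hy using Submodule.span_induction with
    | mem y hy =>
      obtain ⟨r, hr, rfl⟩ := hy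
      rw [hx r (hbt hr), Pi.single_eq_of_ne (ne_of_mem_of_not_mem hr heb)]
    | zero => simp
    | add y z _ _ hy hz => rw [add_dotProduct, hy, hz, add_zero]
    | smul a y _ hy => rw [smul_dotProduct, hy, smul_zero]
  have h2 := h.hyperplane le_rfl hT hx0 (s := s) (by omega)
    fun r hr => hbx _ (hspan ⟨r, hr, rfl⟩)
  have := h.two_le
  omega

/-! ### Kruskal's permutation argument -/

/-- The columns of `C` in the span of the columns of `C'` with labels in `s`. -/
def columnsInSpan (C C' : Matrix (Fin K) (Fin R) 𝕜) (s : Finset (Fin R)) : Finset (Fin R) := by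
  classical exact Finset.univ.filter fun t => C.col t ∈ Submodule.span 𝕜 (C'.col '' s)

theorem mem_columnsInSpan {s : Finset (Fin R)} {t : Fin R} :
    t ∈ columnsInSpan C C' s ↔ C.col t ∈ Submodule.span 𝕜 (C'.col '' s) := by
  simp [columnsInSpan]

/-- The normal vector leaves exactly `m - 1` nonzero weights on `C`, so the remaining `R - (m - 1) =
K - 1` columns lie in the hyperplane. -/
theorem IsRigid.card_columnsInSpan_hyperplane (h : IsRigid m A B C)
    (hT : polyadic A B C = polyadic A' B' C') {s : Finset (Fin R)} (hs : s.card = K - 1) :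
    K - 1 ≤ (columnsInSpan C C' s).card := by
  classical
  have h2 := h.two_le
  have h3 := h.le
  have h4 := h.add_eq
  have hC' := h.generalPosition hT
  obtain ⟨x, hx⟩ := hC'.exists_normal (by omega) h.le hs
  obtain ⟨t, ht⟩ : ∃ t, t ∉ s := by
    by_contra! hall
    have := Finset.eq_univ_iff_forall.2 hall
    simp [this] at hs
    omega
  have hxt : C'.col t ⬝ᵥ x ≠ 0 := fun h0 => ht ((hx t).1 h0)
  have h5 := (h.hyperplane le_rfl hT (x := x) (by rintro rfl; simp at hxt) hs.ge
    fun r hr => (hx r).2 hr).2.2.1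
  have hsub : (supp (Cᵀ *ᵥ x))ᶜ ⊆ columnsInSpan C C' s := by
    intro r hr
    rw [Finset.mem_compl, mem_supp, not_not] at hr
    rw [mem_columnsInSpan]
    exact hC'.mem_span_of_dotProduct_eq_zero (by omega) h3 hs hx hr
  have h6 := Finset.card_le_card hsub
  rw [Finset.card_compl, Fintype.card_fin] at h6
  omega

/-- Descending induction on `s.card`. If the span of `s` had too few columns of `C`, each
enlargement by some `r ∉ s` would gain at least two; the gains for different `r` are disjoint, and
together they exceed `R`. -/
theorem IsRigid.card_le_columnsInSpan (h : IsRigid m A B C)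
    (hT : polyadic A B C = polyadic A' B' C') {s : Finset (Fin R)} (hs : 1 ≤ s.card)
    (hsK : s.card + 1 ≤ K) : s.card ≤ (columnsInSpan C C' s).card := by
  classical
  have hC' := h.generalPosition hT
  have hKR := h.le
  induction hd : K - 1 - s.card generalizing s with
  | zero =>
    have hs' : s.card = K - 1 := by omega
    have := h.card_columnsInSpan_hyperplane hT hs'
    omega
  | succ d ih =>
    by_contra! hlt
    have hins : ∀ r ∈ sᶜ, (insert r s).card = s.card + 1 := fun r hr =>
      Finset.card_insert_of_notMem (Finset.mem_compl.1 hr)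
    have hmono : ∀ r, columnsInSpan C C' s ⊆ columnsInSpan C C' (insert r s) := fun r t ht =>
      mem_columnsInSpan.2 (Submodule.span_mono
        (Set.image_mono (by exact_mod_cast Finset.subset_insert r s)) (mem_columnsInSpan.1 ht))
    have hge : ∀ r ∈ sᶜ, s.card + 1 - (columnsInSpan C C' s).card ≤
        (columnsInSpan C C' (insert r s) \ columnsInSpan C C' s).card := by
      intro r hr
      have h1 := ih (s := insert r s) (by rw [hins r hr]; omega) (by rw [hins r hr]; omega)
        (by rw [hins r hr]; omega)
      rw [hins r hr] at h1
      rw [Finset.card_sdiff_of_subset (hmono r)]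
      omega
    have hdisj : (↑(sᶜ) : Set (Fin R)).PairwiseDisjoint fun r =>
        columnsInSpan C C' (insert r s) \ columnsInSpan C C' s := by
      intro r hr r' hr' hne
      refine Finset.disjoint_left.2 fun t ht ht' => (Finset.mem_sdiff.1 ht).2 ?_
      have h1 := mem_columnsInSpan.1 (Finset.mem_sdiff.1 ht).1
      have h2 := mem_columnsInSpan.1 (Finset.mem_sdiff.1 ht').1
      rw [mem_columnsInSpan]
      have hr1 : r ∉ s := by simpa using hr
      have hr1' : r' ∉ s := by simpa using hr'
      -- Since `s.card + 2 ≤ K`, the enlarged family is independent, so the spans of `s ∪ {r}` and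
      -- `s ∪ {r'}` meet only in the span of `s`.
      have hli := hC' (insert r (insert r' s)) (by
        rw [Finset.card_insert_of_notMem (by simp [hne, hr1]),
          Finset.card_insert_of_notMem hr1']
        omega)
      obtain ⟨f, hf⟩ := (Submodule.mem_span_image_finset_iff_exists_fun' 𝕜).1 h1
      obtain ⟨g, hg⟩ := (Submodule.mem_span_image_finset_iff_exists_fun' 𝕜).1 h2
      rw [Finset.sum_insert hr1] at hf
      rw [Finset.sum_insert hr1'] at hg
      have hzero := (linearIndepOn_finset_iff (R := 𝕜) (v := C'.col)).1 hli
        (fun q => if q = r then f r else if q = r' then - g r' else f q - g q) (by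
          rw [Finset.sum_insert (by simp [hne, hr1]), Finset.sum_insert hr1']
          have : ∑ q ∈ s, (if q = r then f r else if q = r' then - g r' else f q - g q) • C'.col q =
              ∑ q ∈ s, f q • C'.col q - ∑ q ∈ s, g q • C'.col q := by
            rw [← Finset.sum_sub_distrib]
            refine Finset.sum_congr rfl fun q hq => ?_
            rw [if_neg (ne_of_mem_of_not_mem hq hr1), if_neg (ne_of_mem_of_not_mem hq hr1'),
              sub_smul]
          rw [this, if_pos rfl, if_neg hne.symm, if_pos rfl, neg_smul]
          rw [← hg] at hf
          have h3 := sub_eq_zero.2 hf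
          rw [← h3]
          abel) r (by simp)
      simp only [if_true] at hzero
      rw [hzero, zero_smul, zero_add] at hf
      exact (Submodule.mem_span_image_finset_iff_exists_fun' 𝕜).2 ⟨f, hf⟩
    have h1 := Finset.card_biUnion hdisj
    have h2 : Disjoint (columnsInSpan C C' s)
        ((sᶜ).biUnion fun r => columnsInSpan C C' (insert r s) \ columnsInSpan C C' s) :=
      (Finset.disjoint_biUnion_right _ _ _).2 fun r _ => Finset.disjoint_sdiff
    have h3 := (Finset.card_union_of_disjoint h2).symm.le.trans (Finset.card_le_univ _)
    rw [h1, Fintype.card_fin] at h3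
    have h4 := Finset.card_nsmul_le_sum _ _ _ hge
    rw [Finset.card_compl, Fintype.card_fin, smul_eq_mul] at h4
    obtain ⟨a, ha⟩ := Nat.exists_eq_add_of_lt hlt
    obtain ⟨b, hb⟩ := Nat.exists_eq_add_of_le (show s.card + 2 ≤ R by omega)
    have h5 : s.card + 1 - (columnsInSpan C C' s).card = a + 2 := by omega
    have h6 : R - s.card = b + 2 := by omega
    rw [h5, h6] at h4
    nlinarith

/-- For singletons the count says that each line through a column of `C'` contains a column of `C`.
Columns of `C'` are pairwise independent because `K ≥ 2`, which makes the matching injective. -/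
theorem IsRigid.exists_perm (h : IsRigid m A B C) (hT : polyadic A B C = polyadic A' B' C') :
    ∃ (σ : Equiv.Perm (Fin R)) (γ : Fin R → 𝕜),
      ∀ r, γ r ≠ 0 ∧ C'.col r = γ r • C.col (σ r) := by
  classical
  have hC' := h.generalPosition hT
  have hK := h.two_le
  have hCne : ∀ r, C.col r ≠ 0 := fun r => (h.posC {r} (by simp; omega)).ne_zero (by simp)
  have h1 : ∀ r, ∃ s, ∃ g : 𝕜, g ≠ 0 ∧ C'.col r = g • C.col s := by
    intro r
    have h2 := h.card_le_columnsInSpan hT (s := {r}) (by simp) (by simpa using hK)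
    obtain ⟨s, hs⟩ := Finset.card_pos.1 (by simpa using h2)
    rw [mem_columnsInSpan] at hs
    simp only [Finset.coe_singleton, Set.image_singleton] at hs
    obtain ⟨a, ha⟩ := Submodule.mem_span_singleton.1 hs
    have ha0 : a ≠ 0 := by
      rintro rfl
      exact hCne s (by rw [← ha, zero_smul])
    exact ⟨s, a⁻¹, inv_ne_zero ha0, by rw [← ha, inv_smul_smul₀ ha0]⟩
  choose σ γ hγ hσ using h1
  have hinj : Function.Injective σ := by
    intro r r' hrr
    by_contra hne
    have hli := (linearIndepOn_finset_iff (R := 𝕜) (v := C'.col)).1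
      (hC' {r, r'} (by rw [Finset.card_pair hne]; omega))
      (fun q => if q = r then γ r' else - γ r) (by
        rw [Finset.sum_pair hne, if_pos rfl, if_neg (Ne.symm hne), hσ r, hσ r', hrr, smul_smul,
          smul_smul, ← add_smul]
        rw [show γ r' * γ r + -γ r * γ r' = 0 by ring, zero_smul]) r (by simp)
    exact hγ r' (by simpa using hli)
  exact ⟨Equiv.ofBijective σ (Finite.injective_iff_bijective.1 hinj), γ,
    fun r => ⟨hγ r, hσ r⟩⟩

/-- Exchanging the first two modes transposes every contraction, so results about `A` serve for `B`.
-/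
theorem IsRigid.transpose (h : IsRigid m A B C) : IsRigid m B A C where
  two_le := h.two_le
  le := h.le
  add_eq := h.add_eq
  posA := h.posB
  posB := h.posA
  posC := h.posC
  khatriRao := by
    refine Matrix.mulVec_injective_iff.1 fun v w hvw => ?_
    refine Matrix.mulVec_injective_iff.2 h.khatriRao ?_
    ext p
    have := congrFun hvw p.swap
    simp only [Matrix.mulVec, dotProduct, CPD.khatriRao, Matrix.of_apply, Prod.fst_swap,
      Prod.snd_swap] at this ⊢
    simpa only [mul_comm (A _ _)] using this
  card_supp_lt := fun x hx => by
    refine h.card_supp_lt x ?_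
    rwa [← Matrix.rank_transpose, Matrix.transpose_mul, Matrix.transpose_mul,
      Matrix.transpose_transpose, Matrix.diagonal_transpose, ← Matrix.mul_assoc]

theorem polyadic_swap (hT : polyadic A B C = polyadic A' B' C') :
    polyadic B A C = polyadic B' A' C' := by
  ext j i k
  have := congrFun (congrFun (congrFun hT i) j) k
  simp only [polyadic, outer, Finset.sum_apply] at this ⊢
  simpa only [mul_comm (B.col _ _), mul_comm (B'.col _ _)] using this

/-- Choose `x` so that exactly the labels of `s.erase i` have nonzero weight. The range of the
contraction is spanned by the corresponding columns of `A` and, by dimension, also by those of `A'`.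
Intersecting over `i` leaves the line of one column of `A`. -/
theorem IsRigid.exists_smul (h : IsRigid m A B C) (hT : polyadic A B C = polyadic A' B' C')
    {σ : Equiv.Perm (Fin R)} {γ : Fin R → 𝕜}
    (hσ : ∀ r, γ r ≠ 0 ∧ C'.col r = γ r • C.col (σ r)) (r : Fin R) :
    ∃ a : 𝕜, A'.col r = a • A.col (σ r) := by
  classical
  have hK := h.two_le
  have hKR := h.le
  have hm := h.add_eq
  obtain ⟨s, hrs, -, hs⟩ := Finset.exists_subsuperset_card_eq (Finset.subset_univ {σ r})
    (by simp; omega : _ ≤ m) (by simp; omega)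
  have hrs' : σ r ∈ s := hrs (by simp)
  refine mem_span_singleton_of_forall_mem_span (h.posA s hs.le) hrs' (by omega)
    fun i hi hir => ?_
  obtain ⟨x, hx⟩ := h.posC.exists_normal (by omega) hKR (s := (s.erase i)ᶜ)
    (by rw [Finset.card_compl, Finset.card_erase_of_mem hi, Fintype.card_fin]; omega)
  have hsupp : supp (Cᵀ *ᵥ x) = s.erase i := by
    ext q
    rw [mem_supp, Ne, show (Cᵀ *ᵥ x) q = C.col q ⬝ᵥ x from rfl, hx, Finset.mem_compl, not_not]
  have hsupp' : supp (C'ᵀ *ᵥ x) = (s.erase i).image σ.symm := by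
    ext q
    rw [mem_supp, show (C'ᵀ *ᵥ x) q = C'.col q ⬝ᵥ x from rfl, (hσ q).2, smul_dotProduct,
      smul_eq_mul, mul_ne_zero_iff, and_iff_right (hσ q).1, Ne, hx, Finset.mem_compl, not_not,
      Finset.mem_image]
    exact ⟨fun hq => ⟨_, hq, by simp⟩, fun ⟨t, ht, htq⟩ => by rw [← htq]; simpa using ht⟩
  have hcard : (supp (Cᵀ *ᵥ x)).card + 1 = m := by
    rw [hsupp, Finset.card_erase_of_mem hi]; omega
  have h1 := h.finrank_matRange hcard
  have h2 : matRange (A * Matrix.diagonal (Cᵀ *ᵥ x) * Bᵀ) =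
      Submodule.span 𝕜 (A'.col '' supp (C'ᵀ *ᵥ x)) := by
    refine Submodule.eq_of_le_of_finrank_le ?_ ?_
    · rw [weighted_eq hT]
      exact matRange_weighted_le _ _ _
    · rw [h1.2, hsupp, hsupp', ← Finset.card_image_of_injective (s.erase i) σ.symm.injective]
      exact finrank_span_image_le _ _
  rw [h1.1, hsupp] at h2
  rw [h2]
  refine Submodule.subset_span ⟨r, ?_, rfl⟩
  rw [hsupp']
  exact Finset.mem_image.2 ⟨σ r, Finset.mem_erase.2 ⟨hir.symm, hrs'⟩, by simp⟩

theorem IsRigid.essentiallyEqual (h : IsRigid m A B C)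
    (hT : polyadic A B C = polyadic A' B' C') : EssentiallyEqual A A' B B' C C' := by
  classical
  obtain ⟨σ, γ, hσ⟩ := h.exists_perm hT
  choose α hα using h.exists_smul hT hσ
  choose β hβ using h.transpose.exists_smul (polyadic_swap hT) hσ
  refine ⟨σ, α, β, γ, fun r => ⟨?_, hα r, hβ r, (hσ r).2⟩⟩
  have hCne : C.col (σ r) ≠ 0 :=
    (h.posC {σ r} (by have := h.two_le; simp; omega)).ne_zero (by simp)
  obtain ⟨k, hk⟩ := Function.ne_iff.1 hCne
  -- Fix a coordinate `k` at which the column of `C` is nonzero; subtracting the two decompositions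
  -- gives a relation between the columns of `A ⊙ B`.
  have hz : (fun s => (α (σ.symm s) * β (σ.symm s) * γ (σ.symm s) - 1) * C.col s k) = 0 := by
    refine eq_zero_of_khatriRao h.khatriRao fun i j => ?_
    have h1 := congrFun (congrFun (congrFun hT i) j) k
    simp only [polyadic, outer, Finset.sum_apply, hα, hβ, (hσ _).2, Pi.smul_apply,
      smul_eq_mul] at h1
    rw [← Equiv.sum_comp σ] at h1
    rw [← Equiv.sum_comp σ]
    simp only [Equiv.symm_apply_apply, sub_mul, one_mul, mul_sub, Finset.sum_sub_distrib]
    rw [sub_eq_zero]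
    refine Eq.trans ?_ (h1.symm.trans ?_)
    · exact Finset.sum_congr rfl fun q _ => by simp only [Matrix.col_apply]; ring
    · exact Finset.sum_congr rfl fun q _ => by simp only [Matrix.col_apply]
  have := congrFun hz (σ r)
  simp only [Equiv.symm_apply_apply, Pi.zero_apply, mul_eq_zero] at this
  exact sub_eq_zero.1 (this.resolve_right hk)

theorem IsRigid.hasUniqueCPD (h : IsRigid m A B C) (hr : tensorRank (polyadic A B C) = R) :
    HasUniqueCPD (polyadic A B C) := by
  intro n A₁ A₂ B₁ B₂ C₁ C₂ h1 h2
  obtain rfl : R = n := by rw [← hr, h1.2]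
  obtain ⟨σ, α, β, γ, hσ⟩ := h.essentiallyEqual h1.1
  obtain ⟨τ, α', β', γ', hτ⟩ := h.essentiallyEqual h2.1
  refine ⟨τ.trans σ.symm, fun r => α' r / α (σ.symm (τ r)), fun r => β' r / β (σ.symm (τ r)),
    fun r => γ' r / γ (σ.symm (τ r)), fun r => ?_⟩
  obtain ⟨e1, e2, e3, e4⟩ := hσ (σ.symm (τ r))
  obtain ⟨f1, f2, f3, f4⟩ := hτ r
  have hα : α (σ.symm (τ r)) ≠ 0 := by rintro h0; simp [h0] at e1
  have hβ : β (σ.symm (τ r)) ≠ 0 := by rintro h0; simp [h0] at e1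
  have hγ : γ (σ.symm (τ r)) ≠ 0 := by rintro h0; simp [h0] at e1
  refine ⟨?_, ?_, ?_, ?_⟩
  · rw [div_mul_div_comm, div_mul_div_comm, e1, f1, div_one]
  · simp only [Equiv.trans_apply]
    rw [e2, f2, smul_smul, div_mul_cancel₀ _ hα, Equiv.apply_symm_apply]
  · simp only [Equiv.trans_apply]
    rw [e3, f3, smul_smul, div_mul_cancel₀ _ hβ, Equiv.apply_symm_apply]
  · simp only [Equiv.trans_apply]
    rw [e4, f4, smul_smul, div_mul_cancel₀ _ hγ, Equiv.apply_symm_apply]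

/-- All columns are nonzero because `m` and `K` are positive, so `R` rank-one terms occur; a shorter
sum contradicts `IsRigid.eq_of_le`. -/
theorem IsRigid.tensorRank_eq (h : IsRigid m A B C) : tensorRank (polyadic A B C) = R := by
  have hK := h.two_le
  have hKR := h.le
  have hm := h.add_eq
  have hmem : R ∈ {n : ℕ | ∃ X : Fin n → Tensor 𝕜 I J K, (∀ r, IsRankOne (X r)) ∧
      polyadic A B C = ∑ r, X r} := by
    refine ⟨fun r => outer (A.col r) (B.col r) (C.col r), fun r => ?_, rfl⟩
    exact ⟨_, _, _, (h.posA {r} (by simp; omega)).ne_zero (by simp),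
      (h.posB {r} (by simp; omega)).ne_zero (by simp),
      (h.posC {r} (by simp; omega)).ne_zero (by simp), rfl⟩
  refine le_antisymm (Nat.sInf_le hmem) (le_csInf ⟨R, hmem⟩ ?_)
  rintro n ⟨X, hX, hT⟩
  by_contra! hlt
  choose a b c _ _ _ habc using hX
  have h1 : polyadic A B C = polyadic (Matrix.of fun i r => a r i) (Matrix.of fun j r => b r j)
      (Matrix.of fun k r => c r k) := by
    rw [hT]
    exact Finset.sum_congr rfl fun r _ => habc r
  have := h.eq_of_le hlt.le h1
  omega

end

/-! ### Polynomial functions -/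

/-- The functions that are given by a polynomial with rational coefficients. -/
def IsPoly {ι : Type} (F : (ι → 𝕜) → 𝕜) : Prop :=
  ∃ f : MvPolynomial ι ℚ, ∀ x, F x = MvPolynomial.aeval x f

section IsPoly

variable {ι : Type}

theorem IsPoly.coord (i : ι) : IsPoly fun x : ι → 𝕜 => x i := ⟨MvPolynomial.X i, fun x => by simp⟩

theorem IsPoly.ratCast (q : ℚ) : IsPoly fun _ : ι → 𝕜 => (q : 𝕜) :=
  ⟨MvPolynomial.C q, fun x => by simp⟩

theorem IsPoly.natCast (q : ℕ) : IsPoly fun _ : ι → 𝕜 => (q : 𝕜) := by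
  simpa using IsPoly.ratCast (𝕜 := 𝕜) (ι := ι) (q : ℚ)

theorem IsPoly.intCast (q : ℤ) : IsPoly fun _ : ι → 𝕜 => (q : 𝕜) := by
  simpa using IsPoly.ratCast (𝕜 := 𝕜) (ι := ι) (q : ℚ)

theorem IsPoly.zero : IsPoly fun _ : ι → 𝕜 => (0 : 𝕜) := by simpa using IsPoly.natCast 0

theorem IsPoly.one : IsPoly fun _ : ι → 𝕜 => (1 : 𝕜) := by simpa using IsPoly.natCast 1

theorem IsPoly.add {F G : (ι → 𝕜) → 𝕜} (hF : IsPoly F) (hG : IsPoly G) :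
    IsPoly fun x => F x + G x := by
  obtain ⟨f, hf⟩ := hF
  obtain ⟨g, hg⟩ := hG
  exact ⟨f + g, fun x => by simp [hf, hg]⟩

theorem IsPoly.mul {F G : (ι → 𝕜) → 𝕜} (hF : IsPoly F) (hG : IsPoly G) :
    IsPoly fun x => F x * G x := by
  obtain ⟨f, hf⟩ := hF
  obtain ⟨g, hg⟩ := hG
  exact ⟨f * g, fun x => by simp [hf, hg]⟩

theorem IsPoly.neg {F : (ι → 𝕜) → 𝕜} (hF : IsPoly F) : IsPoly fun x => - F x := by
  obtain ⟨f, hf⟩ := hF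
  exact ⟨-f, fun x => by simp [hf]⟩

theorem IsPoly.sub {F G : (ι → 𝕜) → 𝕜} (hF : IsPoly F) (hG : IsPoly G) :
    IsPoly fun x => F x - G x := by
  simpa only [sub_eq_add_neg] using hF.add hG.neg

theorem IsPoly.sum {α : Type*} (s : Finset α) {F : α → (ι → 𝕜) → 𝕜} (hF : ∀ a ∈ s, IsPoly (F a)) :
    IsPoly fun x => ∑ a ∈ s, F a x := by
  classical
  induction s using Finset.induction_on with
  | empty => simpa using IsPoly.zero
  | insert a s ha ih =>
    simp only [Finset.sum_insert ha]
    exact (hF a (by simp)).add (ih fun b hb => hF b (by simp [hb]))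

theorem IsPoly.prod {α : Type*} (s : Finset α) {F : α → (ι → 𝕜) → 𝕜}
    (hF : ∀ a ∈ s, IsPoly (F a)) : IsPoly fun x => ∏ a ∈ s, F a x := by
  classical
  induction s using Finset.induction_on with
  | empty => simpa using IsPoly.one
  | insert a s ha ih =>
    simp only [Finset.prod_insert ha]
    exact (hF a (by simp)).mul (ih fun b hb => hF b (by simp [hb]))

theorem IsPoly.det {n : ℕ} {M : (ι → 𝕜) → Matrix (Fin n) (Fin n) 𝕜}
    (hM : ∀ i j, IsPoly fun x => M x i j) : IsPoly fun x => (M x).det := by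
  simp only [Matrix.det_apply']
  exact IsPoly.sum _ fun σ _ => (IsPoly.intCast _).mul (IsPoly.prod _ fun i _ => hM _ _)

theorem IsPoly.ite (p : Prop) [Decidable p] {F G : (ι → 𝕜) → 𝕜} (hF : IsPoly F) (hG : IsPoly G) :
    IsPoly fun x => if p then F x else G x := by
  by_cases h : p <;> simpa [h]

end IsPoly

/-! ### Specifications of algebraic procedures -/

/-- There is an algebraic procedure whose outputs satisfy `Post` for every input that
satisfies `Pre`. -/
def Solvable {ι κ : Type} (Pre : (ι → 𝕜) → Prop) (Post : (ι → 𝕜) → (κ → 𝕜) → Prop) : Prop :=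
  ∃ P : (ι → 𝕜) → (κ → 𝕜) → Prop, AlgebraicProcedure 𝕜 P ∧ ∀ x, Pre x → ∀ y, P x y → Post x y

namespace Solvable

variable {ι κ μ : Type}

theorem mono {Pre Pre' : (ι → 𝕜) → Prop} {Post Post' : (ι → 𝕜) → (κ → 𝕜) → Prop}
    (h : Solvable Pre Post) (h1 : ∀ x, Pre' x → Pre x)
    (h2 : ∀ x y, Pre' x → Post x y → Post' x y) : Solvable Pre' Post' := by
  obtain ⟨P, hP, hPP⟩ := h
  exact ⟨P, hP, fun x hx y hy => h2 x y hx (hPP x (h1 x hx) y hy)⟩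

theorem arith_div [Finite ι] [Finite κ] (F G : (ι → 𝕜) → κ → 𝕜)
    (hF : ∀ k, IsPoly fun x => F x k) (hG : ∀ k, IsPoly fun x => G x k) :
    Solvable (fun _ : ι → 𝕜 => True) fun x y => ∀ k, y k = F x k / G x k := by
  choose f hf using hF
  choose g hg using hG
  refine ⟨_, AlgebraicProcedure.arithmetic f g, fun x _ y hy k => ?_⟩
  rw [hy, ← hf, ← hg]

theorem arith [Finite ι] [Finite κ] (F : (ι → 𝕜) → κ → 𝕜)
    (hF : ∀ k, IsPoly fun x => F x k) :
    Solvable (fun _ : ι → 𝕜 => True) fun x y => y = F x :=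
  (arith_div F (fun _ _ => 1) hF fun _ => IsPoly.one).mono (fun _ _ => trivial)
    fun x y _ h => funext fun k => by rw [h k, div_one]

theorem comp {Pre : (ι → 𝕜) → Prop} {Mid : (ι → 𝕜) → (κ → 𝕜) → Prop}
    {Pre' : (κ → 𝕜) → Prop} {Post : (κ → 𝕜) → (μ → 𝕜) → Prop} (h : Solvable Pre Mid)
    (h' : Solvable Pre' Post) (hmid : ∀ x y, Pre x → Mid x y → Pre' y) :
    Solvable Pre fun x z => ∃ y, Mid x y ∧ Post y z := by
  obtain ⟨P, hP, hPP⟩ := h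
  obtain ⟨Q, hQ, hQQ⟩ := h'
  refine ⟨_, AlgebraicProcedure.comp hP hQ, ?_⟩
  rintro x hx z ⟨y, hy, hz⟩
  exact ⟨y, hPP x hx y hy, hQQ y (hmid x y hx (hPP x hx y hy)) z hz⟩

theorem pair {Pre : (ι → 𝕜) → Prop} {Q₁ : (ι → 𝕜) → (κ → 𝕜) → Prop}
    {Q₂ : (ι → 𝕜) → (μ → 𝕜) → Prop} (h₁ : Solvable Pre Q₁) (h₂ : Solvable Pre Q₂) :
    Solvable Pre fun (x : ι → 𝕜) (y : κ ⊕ μ → 𝕜) =>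
      Q₁ x (fun k => y (Sum.inl k)) ∧ Q₂ x (fun k => y (Sum.inr k)) := by
  obtain ⟨P, hP, hPP⟩ := h₁
  obtain ⟨Q, hQ, hQQ⟩ := h₂
  exact ⟨_, AlgebraicProcedure.pair hP hQ, fun x hx y hy =>
    ⟨hPP x hx _ hy.1, hQQ x hx _ hy.2⟩⟩

/-- Arithmetic before a procedure. -/
theorem precomp [Finite ι] [Finite κ] {Pre : (κ → 𝕜) → Prop} {Post : (κ → 𝕜) → (μ → 𝕜) → Prop}
    (h : Solvable Pre Post) (F : (ι → 𝕜) → κ → 𝕜) (hF : ∀ k, IsPoly fun x => F x k) :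
    Solvable (fun x => Pre (F x)) fun x z => Post (F x) z := by
  refine (((arith F hF).mono (Pre' := fun x => Pre (F x)) (Post' := fun x y => y = F x)
    (fun _ _ => trivial) fun _ _ _ h => h).comp h ?_).mono (fun _ h => h) ?_
  · rintro x _ hx rfl
    exact hx
  · rintro x z - ⟨_, rfl, hz⟩
    exact hz

/-- Arithmetic after a procedure. -/
theorem postcomp [Finite κ] [Finite μ] {Pre : (ι → 𝕜) → Prop}
    {Post : (ι → 𝕜) → (κ → 𝕜) → Prop} {Post' : (ι → 𝕜) → (μ → 𝕜) → Prop}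
    (h : Solvable Pre Post) (F : (κ → 𝕜) → μ → 𝕜) (hF : ∀ k, IsPoly fun x => F x k)
    (h' : ∀ x y, Pre x → Post x y → Post' x (F y)) : Solvable Pre Post' := by
  refine (h.comp (arith F hF) fun _ _ _ _ => trivial).mono (fun _ h => h) ?_
  rintro x z hx ⟨y, hy, rfl⟩
  exact h' x y hx hy

/-- The output of a first procedure is appended to the input of a second one. -/
theorem bind [Finite ι] {Pre : (ι → 𝕜) → Prop} {Mid : (ι → 𝕜) → (κ → 𝕜) → Prop}
    {Post : (ι → 𝕜) → (μ → 𝕜) → Prop} (h : Solvable Pre Mid)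
    (h' : Solvable (fun w : ι ⊕ κ → 𝕜 => Pre (fun i => w (Sum.inl i)) ∧
        Mid (fun i => w (Sum.inl i)) fun k => w (Sum.inr k))
      fun w z => Post (fun i => w (Sum.inl i)) z) : Solvable Pre Post := by
  have h1 := ((arith (fun x : ι → 𝕜 => x) IsPoly.coord).mono (Pre' := Pre)
    (Post' := fun x y => y = x) (fun _ _ => trivial) fun _ _ _ h => h).pair h
  refine (h1.comp h' ?_).mono (fun _ h => h) ?_
  · rintro x y hx ⟨hy1, hy2⟩
    rw [hy1]
    exact ⟨hx, hy2⟩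
  · rintro x z hx ⟨y, ⟨hy1, hy2⟩, hz⟩
    rw [hy1] at hz
    exact hz

theorem ite [Finite ι] {Pre₁ Pre₂ : (ι → 𝕜) → Prop} {Post : (ι → 𝕜) → (κ → 𝕜) → Prop}
    (h₁ : Solvable Pre₁ Post) (h₂ : Solvable Pre₂ Post) {F : (ι → 𝕜) → 𝕜} (hF : IsPoly F) :
    Solvable (fun x => (F x = 0 → Pre₁ x) ∧ (F x ≠ 0 → Pre₂ x)) Post := by
  have e : ∀ {Pre : (ι → 𝕜) → Prop}, Solvable Pre Post →
      Solvable (fun w : ι ⊕ Unit → 𝕜 => Pre fun i => w (Sum.inl i))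
        fun w y => Post (fun i => w (Sum.inl i)) y := fun h =>
    h.precomp (fun w i => w (Sum.inl i)) fun i => IsPoly.coord _
  obtain ⟨P, hP, hPP⟩ := e h₁
  obtain ⟨Q, hQ, hQQ⟩ := e h₂
  -- A branch can test only an input coordinate, so the value of `F` is appended to the input.
  have h3 : Solvable (fun w : ι ⊕ Unit → 𝕜 => (w (Sum.inr ()) = 0 → Pre₁ fun i => w (Sum.inl i)) ∧
      (w (Sum.inr ()) ≠ 0 → Pre₂ fun i => w (Sum.inl i)))
      fun w y => Post (fun i => w (Sum.inl i)) y := by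
    refine ⟨_, AlgebraicProcedure.branch (Sum.inr ()) hP hQ, fun w hw y hy => ?_⟩
    by_cases h0 : w (Sum.inr ()) = 0
    · exact hPP w (hw.1 h0) y (hy.1 h0)
    · exact hQQ w (hw.2 h0) y (hy.2 h0)
  refine (h3.precomp (fun x => Sum.elim x fun _ => F x) ?_).mono (fun x hx => by simpa using hx)
    fun x y _ h => by simpa using h
  rintro (i | _)
  · exact IsPoly.coord i
  · exact hF

theorem ite_all [Finite ι] {α : Type*} (s : Finset α) {Pre₁ Pre₂ : (ι → 𝕜) → Prop}
    {Post : (ι → 𝕜) → (κ → 𝕜) → Prop} (h₁ : Solvable Pre₁ Post) (h₂ : Solvable Pre₂ Post)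
    {F : α → (ι → 𝕜) → 𝕜} (hF : ∀ a, IsPoly (F a)) :
    Solvable (fun x => ((∀ a ∈ s, F a x = 0) → Pre₁ x) ∧ ((∃ a ∈ s, F a x ≠ 0) → Pre₂ x))
      Post := by
  classical
  induction s using Finset.induction_on with
  | empty => exact h₁.mono (fun x hx => hx.1 (by simp)) fun _ _ _ h => h
  | insert a s ha ih =>
    refine (ih.ite h₂ (hF a)).mono (fun x hx => ⟨fun h0 => ⟨fun h => hx.1 ?_, ?_⟩, ?_⟩)
      fun _ _ _ h => h
    · intro b hb
      rcases Finset.mem_insert.1 hb with rfl | hb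
      exacts [h0, h b hb]
    · rintro ⟨b, hb, h⟩
      exact hx.2 ⟨b, by simp [hb], h⟩
    · intro h
      exact hx.2 ⟨a, by simp, h⟩

/-- If outputs can be checked by polynomial equations, then finitely many procedures
can be tried in turn. -/
theorem search [Finite ι] [Finite κ] {α θ : Type} [Fintype α] [Finite θ]
    {Pre : θ → (ι → 𝕜) → Prop} {Post : (ι → 𝕜) → (κ → 𝕜) → Prop}
    (F : α → (ι → 𝕜) → (κ → 𝕜) → 𝕜)
    (hF : ∀ a, IsPoly fun w : ι ⊕ κ → 𝕜 => F a (fun i => w (Sum.inl i)) fun k => w (Sum.inr k))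
    (hPost : ∀ x y, (∀ a, F a x y = 0) → Post x y) (hPost' : ∀ x y, Post x y → ∀ a, F a x y = 0)
    (h : ∀ t, Solvable (Pre t) Post) : Solvable (fun x => ∃ t, Pre t x) Post := by
  classical
  have := Fintype.ofFinite θ
  suffices hs : ∀ s : Finset θ, Solvable (fun x => ∃ t ∈ s, Pre t x) Post from
    (hs Finset.univ).mono (fun x ⟨t, ht⟩ => ⟨t, Finset.mem_univ t, ht⟩) fun _ _ _ h => h
  intro s
  induction s using Finset.induction_on with
  | empty =>
    exact (arith (fun _ _ => 0) fun _ => IsPoly.zero).mono (fun _ _ => trivial)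
      fun x _ hx => by simp at hx
  | insert t s ht ih =>
    -- Outside `Pre t` the procedure still returns something, about which nothing is claimed.
    have h1 : Solvable (fun x => ∃ t' ∈ insert t s, Pre t' x) fun x y => Pre t x → Post x y := by
      obtain ⟨P, hP, hPP⟩ := h t
      exact ⟨P, hP, fun x _ y hy hx => hPP x hx y hy⟩
    refine h1.bind ?_
    have h2 : Solvable (fun w : ι ⊕ κ → 𝕜 => ∀ a, F a (fun i => w (Sum.inl i))
        (fun k => w (Sum.inr k)) = 0) fun w z => Post (fun i => w (Sum.inl i)) z :=
      (arith (fun w k => w (Sum.inr k)) fun k => IsPoly.coord _).mono (fun _ _ => trivial)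
        fun w z hw hz => hz ▸ hPost _ _ hw
    have h3 : Solvable (fun w : ι ⊕ κ → 𝕜 => ∃ t' ∈ s, Pre t' fun i => w (Sum.inl i))
        fun w z => Post (fun i => w (Sum.inl i)) z :=
      ih.precomp (fun w i => w (Sum.inl i)) fun i => IsPoly.coord _
    refine (ite_all Finset.univ h2 h3 hF).mono (fun w hw => ⟨fun h => fun a => h a (by simp), ?_⟩)
      fun _ _ _ h => h
    -- A failed check rules out `Pre t`, so one of the remaining preconditions holds.
    rintro ⟨a, -, ha⟩
    obtain ⟨⟨t', ht', hpre⟩, hmid⟩ := hw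
    rcases Finset.mem_insert.1 ht' with rfl | ht'
    · exact absurd (hPost' _ _ (hmid hpre) a) ha
    · exact ⟨t', ht', hpre⟩

/-- Finitely many procedures applied to the same input. -/
theorem pi [Finite ι] [Finite κ] {N : ℕ} {Pre : (ι → 𝕜) → Prop}
    {Post : Fin N → (ι → 𝕜) → (κ → 𝕜) → Prop} (h : ∀ j, Solvable Pre (Post j)) :
    Solvable Pre fun (x : ι → 𝕜) (y : Fin N × κ → 𝕜) => ∀ j, Post j x fun k => y (j, k) := by
  induction N with
  | zero =>
    exact (arith (fun _ _ => 0) fun _ => IsPoly.zero).mono (fun _ _ => trivial)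
      fun _ _ _ _ j => j.elim0
  | succ N ih =>
    refine ((h 0).pair (ih fun j => h j.succ)).postcomp
      (fun w jk => Fin.cases (motive := fun _ => 𝕜) (w (Sum.inl jk.2))
        (fun j => w (Sum.inr (j, jk.2))) jk.1) ?_ ?_
    · rintro ⟨j, k⟩
      induction j using Fin.cases <;> exact IsPoly.coord _
    · rintro x y hx ⟨h1, h2⟩ j
      induction j using Fin.cases with
      | zero => exact h1
      | succ j => exact h2 j

/-- The number of output columns must not depend on the input. As the columns from `dim ker` on are
zero, cutting or padding to any `q ≥ dim ker` keeps the span. -/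
theorem nullBasis [Finite ι] {α β : Type} [Fintype α] [Fintype β]
    (M : (ι → 𝕜) → Matrix α β 𝕜) (hM : ∀ a b, IsPoly fun x => M x a b) (q : ℕ) :
    Solvable (fun x => Module.finrank 𝕜 (matKer (M x)) ≤ q)
      fun x (y : β × Fin q → 𝕜) =>
        Submodule.span 𝕜 (Set.range fun (j : Fin q) (b : β) => y (b, j)) = matKer (M x) := by
  classical
  let eα := Fintype.equivFin α
  let eβ := Fintype.equivFin β
  have h : Solvable (fun _ => True) fun (x : Fin (Fintype.card α) × Fin (Fintype.card β) → 𝕜) y =>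
      IsNullSpaceOutput (Matrix.of fun i j => x (i, j)) (Matrix.of fun i j => y (i, j)) :=
    ⟨_, AlgebraicProcedure.nullSpace _ _, fun x _ y hy => hy⟩
  refine ((h.precomp (fun x ij => M x (eα.symm ij.1) (eβ.symm ij.2))
    fun ij => hM _ _).mono (Pre' := fun x => Module.finrank 𝕜 (matKer (M x)) ≤ q)
    (fun _ _ => trivial) fun _ _ _ h => h).postcomp
    (fun y bj => if h : (bj.2 : ℕ) < Fintype.card β then y (eβ bj.1, ⟨bj.2, h⟩) else 0) ?_ ?_
  · rintro ⟨b, j⟩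
    dsimp only
    split_ifs
    exacts [IsPoly.coord _, IsPoly.zero]
  · intro x y hq hy
    obtain ⟨hy1, hy2⟩ := hy
    set M' : Matrix (Fin (Fintype.card α)) (Fin (Fintype.card β)) 𝕜 :=
      Matrix.of fun i j => M x (eα.symm i) (eβ.symm j) with hM'
    let e : (Fin (Fintype.card β) → 𝕜) ≃ₗ[𝕜] (β → 𝕜) := LinearEquiv.funCongrLeft 𝕜 𝕜 eβ
    have hker : (matKer M').map e.toLinearMap = matKer (M x) := by
      ext v
      rw [Submodule.mem_map_equiv]
      change M' *ᵥ (e.symm v) = 0 ↔ M x *ᵥ v = 0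
      have : M' *ᵥ (e.symm v) = (M x *ᵥ v) ∘ eα.symm := by
        ext i
        simp only [Matrix.mulVec, dotProduct, hM', Matrix.of_apply, Function.comp_apply]
        rw [← Equiv.sum_comp eβ]
        simp [e, LinearEquiv.funCongrLeft]
      rw [this]
      constructor
      · intro h
        ext a
        simpa using congrFun h (eα a)
      · intro h
        rw [h]; rfl
    have hfin : Module.finrank 𝕜 (matKer M') ≤ q := by
      rw [← hker] at hq
      rwa [LinearEquiv.finrank_map_eq e (matKer M')] at hq
    rw [← hker, ← hy1, Submodule.map_span]
    refine le_antisymm (Submodule.span_le.2 ?_) (Submodule.span_le.2 ?_)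
    · rintro _ ⟨j, rfl⟩
      by_cases hj : (j : ℕ) < Fintype.card β
      · refine Submodule.subset_span ⟨_, ⟨⟨j, hj⟩, rfl⟩, ?_⟩
        ext b
        simp [e, LinearEquiv.funCongrLeft, hj]
      · simp only [hj, dite_false]
        exact Submodule.zero_mem _
    · rintro _ ⟨_, ⟨j, rfl⟩, rfl⟩
      by_cases hj : (j : ℕ) < q
      · refine Submodule.subset_span ⟨⟨j, hj⟩, ?_⟩
        ext b
        simp [e, LinearEquiv.funCongrLeft]
      · rw [hy2 j (hfin.trans (not_lt.1 hj)), map_zero]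
        exact Submodule.zero_mem _

theorem gevd [Finite ι] {n : ℕ} (M N : (ι → 𝕜) → Matrix (Fin n) (Fin n) 𝕜)
    (hM : ∀ i j, IsPoly fun x => M x i j) (hN : ∀ i j, IsPoly fun x => N x i j) :
    Solvable (fun x => ∃ V d, IsGEVD (M x) (N x) V d)
      fun x (y : (Fin n × Fin n) ⊕ Fin n → 𝕜) =>
        IsGEVD (M x) (N x) (Matrix.of fun i j => y (Sum.inl (i, j))) fun i => y (Sum.inr i) := by
  have h : Solvable (fun x : (Fin n × Fin n) ⊕ (Fin n × Fin n) → 𝕜 =>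
      ∃ V d, IsGEVD (Matrix.of fun i j => x (Sum.inl (i, j)))
        (Matrix.of fun i j => x (Sum.inr (i, j))) V d)
      fun x y => IsGEVD (Matrix.of fun i j => x (Sum.inl (i, j)))
        (Matrix.of fun i j => x (Sum.inr (i, j))) (Matrix.of fun i j => y (Sum.inl (i, j)))
        fun i => y (Sum.inr i) :=
    ⟨_, AlgebraicProcedure.gevd n, fun x hx y hy => hy hx⟩
  exact h.precomp (fun x => Sum.elim (fun ij => M x ij.1 ij.2) fun ij => N x ij.1 ij.2)
    (by rintro (ij | ij); exacts [hM _ _, hN _ _])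

end Solvable

/-! ### Recovering the factor matrices from the normal vectors -/

/-- The line of `c r` is the intersection of the hyperplanes that contain it; those spanned by `K -
1` elements of one `K`-set containing `r` suffice. -/
theorem IsNormalFamily.mem_span_singleton {N : ℕ} {c : Fin R → Fin K → 𝕜}
    {S : Fin N ≃ {s : Finset (Fin R) // s.card = K - 1}} {x : Fin N → Fin K → 𝕜}
    (hx : IsNormalFamily c S x) (hc : GeneralPosition K c) (hK : 2 ≤ K) (hKR : K ≤ R) (r : Fin R)
    (v : Fin K → 𝕜) :
    (∀ j, r ∈ (S j).1 → x j ⬝ᵥ v = 0) ↔ v ∈ Submodule.span 𝕜 {c r} := by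
  classical
  constructor
  · intro hv
    obtain ⟨s, hrs, -, hs⟩ := Finset.exists_subsuperset_card_eq (Finset.subset_univ {r})
      (by simp; omega : _ ≤ K) (by simpa using hKR)
    have hrs' : r ∈ s := hrs (by simp)
    obtain ⟨a, ha⟩ := mem_span_singleton_of_forall_mem_span (hc s hs.le) hrs' (by omega) (y := v)
      fun i hi hir => by
        have hcard : (s.erase i).card = K - 1 := by rw [Finset.card_erase_of_mem hi, hs]
        obtain ⟨j, hj⟩ := S.surjective ⟨s.erase i, hcard⟩
        refine hc.mem_span_of_dotProduct_eq_zero (by omega) hKR hcard (x := x j)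
          (fun q => by rw [hx j q, hj]) ?_
        rw [dotProduct_comm]
        exact hv j (by rw [hj]; exact Finset.mem_erase.2 ⟨hir.symm, hrs'⟩)
    exact Submodule.mem_span_singleton.2 ⟨a, ha.symm⟩
  · intro hv j hj
    obtain ⟨a, rfl⟩ := Submodule.mem_span_singleton.1 hv
    rw [dotProduct_smul, dotProduct_comm, (hx j r).2 hj, smul_zero]

theorem IsRigid.supp_normal {N m : ℕ} {A : Matrix (Fin I) (Fin R) 𝕜} {B : Matrix (Fin J) (Fin R) 𝕜}
    {C : Matrix (Fin K) (Fin R) 𝕜} {S : Fin N ≃ {s : Finset (Fin R) // s.card = K - 1}}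
    {x : Fin N → Fin K → 𝕜} (h : IsRigid m A B C) (hx : IsNormalFamily C.col S x) (j : Fin N) :
    supp (Cᵀ *ᵥ x j) = (S j).1ᶜ ∧ (supp (Cᵀ *ᵥ x j)).card + 1 = m := by
  classical
  have h1 : supp (Cᵀ *ᵥ x j) = (S j).1ᶜ := by
    ext q
    rw [mem_supp, Ne, show (Cᵀ *ᵥ x j) q = C.col q ⬝ᵥ x j from rfl, hx, Finset.mem_compl]
  refine ⟨h1, ?_⟩
  have h2 := h.two_le
  have h3 := h.add_eq
  have h4 := h.le
  rw [h1, Finset.card_compl, (S j).2, Fintype.card_fin]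
  omega

/-- The contraction with `x j` has as range the span of the columns of `A` outside `S j`. Those
containing column `r` intersect in its line. -/
theorem IsRigid.iInf_matRange {N m : ℕ} {A : Matrix (Fin I) (Fin R) 𝕜}
    {B : Matrix (Fin J) (Fin R) 𝕜} {C : Matrix (Fin K) (Fin R) 𝕜}
    {S : Fin N ≃ {s : Finset (Fin R) // s.card = K - 1}} {x : Fin N → Fin K → 𝕜}
    (h : IsRigid m A B C) (hx : IsNormalFamily C.col S x) (r : Fin R) {s : Finset (Fin N)}
    (hs : ∀ j, j ∈ s ↔ r ∉ (S j).1) :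
    ⨅ j ∈ s, matRange (A * Matrix.diagonal (Cᵀ *ᵥ x j) * Bᵀ) = Submodule.span 𝕜 {A.col r} := by
  classical
  have hK := h.two_le
  have hKR := h.le
  have hm := h.add_eq
  have hrange : ∀ j, matRange (A * Matrix.diagonal (Cᵀ *ᵥ x j) * Bᵀ) =
      Submodule.span 𝕜 (A.col '' ((S j).1ᶜ : Finset (Fin R))) := fun j => by
    rw [(h.finrank_matRange (h.supp_normal hx j).2).1, (h.supp_normal hx j).1]
  ext v
  simp only [Submodule.mem_iInf, hrange]
  constructor
  · intro hv
    obtain ⟨t, hrt, -, ht⟩ := Finset.exists_subsuperset_card_eq (Finset.subset_univ {r})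
      (by simp; omega : _ ≤ m) (by simp; omega)
    have hrt' : r ∈ t := hrt (by simp)
    obtain ⟨a, ha⟩ := mem_span_singleton_of_forall_mem_span (h.posA t ht.le) hrt' (by omega)
      (y := v) fun i hi hir => by
        have hcard : ((t.erase i)ᶜ).card = K - 1 := by
          rw [Finset.card_compl, Finset.card_erase_of_mem hi, ht, Fintype.card_fin]; omega
        obtain ⟨j, hj⟩ := S.surjective ⟨(t.erase i)ᶜ, hcard⟩
        have := hv j ((hs j).2 (by rw [hj]; simp [hir.symm, hrt']))
        rwa [hj, compl_compl] at this
    exact Submodule.mem_span_singleton.2 ⟨a, ha.symm⟩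
  · intro hv j hj
    refine Submodule.span_mono ?_ hv
    rw [Set.singleton_subset_iff]
    exact ⟨r, by simpa using (hs j).1 hj, rfl⟩

/-- The matrix of the linear system for the scalings of the terms. -/
def scalingMatrix (T : Tensor 𝕜 I J K) (a : Fin R → Fin I → 𝕜) (b : Fin R → Fin J → 𝕜)
    (c : Fin R → Fin K → 𝕜) : Matrix (Fin I × Fin J × Fin K) (Option (Fin R)) 𝕜 :=
  -- The label `none` carries the right-hand side, which turns the inhomogeneous system into a null
  -- space computation.
  Matrix.of fun t o => o.elim (-T t.1 t.2.1 t.2.2) fun r => a r t.1 * b r t.2.1 * c r t.2.2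

theorem mem_ker_scalingMatrix {T : Tensor 𝕜 I J K} {a : Fin R → Fin I → 𝕜}
    {b : Fin R → Fin J → 𝕜} {c : Fin R → Fin K → 𝕜} {v : Option (Fin R) → 𝕜} :
    v ∈ matKer (scalingMatrix T a b c) ↔
      ∀ i j k, ∑ r, a r i * b r j * c r k * v (some r) = T i j k * v none := by
  change scalingMatrix T a b c *ᵥ v = 0 ↔ _
  rw [funext_iff]
  simp only [Prod.forall, Matrix.mulVec, dotProduct, scalingMatrix, Matrix.of_apply,
    Fintype.sum_option, Option.elim, Pi.zero_apply, neg_mul]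
  refine forall_congr' fun i => forall_congr' fun j => forall_congr' fun k => ?_
  rw [neg_add_eq_zero, eq_comm]

theorem exists_smul_of_span_eq {E : Type*} [AddCommGroup E] [Module 𝕜 E] {y v : E} (hv : v ≠ 0)
    (h : Submodule.span 𝕜 {y} = Submodule.span 𝕜 {v}) : ∃ a : 𝕜, a ≠ 0 ∧ y = a • v := by
  obtain ⟨a, ha⟩ := Submodule.mem_span_singleton.1
    (h ▸ Submodule.mem_span_singleton_self y : y ∈ Submodule.span 𝕜 {v})
  refine ⟨a, ?_, ha.symm⟩
  rintro rfl
  rw [zero_smul] at ha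
  rw [← ha, Submodule.span_zero_singleton, eq_comm, Submodule.span_singleton_eq_bot] at h
  exact hv h

theorem IsRigid.ker_scalingMatrix {m : ℕ} {A : Matrix (Fin I) (Fin R) 𝕜}
    {B : Matrix (Fin J) (Fin R) 𝕜} {C : Matrix (Fin K) (Fin R) 𝕜} (h : IsRigid m A B C)
    {a : Fin R → Fin I → 𝕜} {b : Fin R → Fin J → 𝕜} {c : Fin R → Fin K → 𝕜}
    (ha : ∀ r, ∃ t : 𝕜, t ≠ 0 ∧ a r = t • A.col r) (hb : ∀ r, ∃ t : 𝕜, t ≠ 0 ∧ b r = t • B.col r)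
    (hc : ∀ r, ∃ t : 𝕜, t ≠ 0 ∧ c r = t • C.col r) :
    ∃ v : Option (Fin R) → 𝕜, v none = 1 ∧
      matKer (scalingMatrix (polyadic A B C) a b c) = Submodule.span 𝕜 {v} := by
  choose α hα haα using ha
  choose β hβ hbβ using hb
  choose γ hγ hcγ using hc
  -- The inverse of the accumulated scale is the only possible coefficient, because the columns of
  -- `A ⊙ B` are independent.
  refine ⟨fun o => o.elim 1 fun r => (α r * β r * γ r)⁻¹, rfl, ?_⟩
  ext w
  rw [mem_ker_scalingMatrix, Submodule.mem_span_singleton]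
  simp only [haα, hbβ, hcγ, Pi.smul_apply, smul_eq_mul, Matrix.col_apply, polyadic, outer,
    Finset.sum_apply, Finset.sum_mul]
  constructor
  · intro hw
    refine ⟨w none, ?_⟩
    ext o
    cases o with
    | none => simp
    | some r =>
      have hCne : C.col r ≠ 0 := (h.posC {r} (by have := h.two_le; simp; omega)).ne_zero (by simp)
      obtain ⟨k, hk⟩ := Function.ne_iff.1 hCne
      have hz : (fun s => (α s * β s * γ s * w (some s) - w none) * C.col s k) = 0 := by
        refine eq_zero_of_khatriRao h.khatriRao fun i j => ?_
        have h1 := sub_eq_zero.2 (hw i j k)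
        rw [← Finset.sum_sub_distrib] at h1
        rw [← h1]
        exact Finset.sum_congr rfl fun s _ => by rw [Matrix.col_apply]; ring
      have h2 := sub_eq_zero.1 ((mul_eq_zero.1 (congrFun hz r)).resolve_right hk)
      have h3 := mul_ne_zero (mul_ne_zero (hα r) (hβ r)) (hγ r)
      simp only [Pi.smul_apply, Option.elim, smul_eq_mul]
      rw [← h2, mul_comm, inv_mul_cancel_left₀ h3]
  · rintro ⟨t, rfl⟩ i j k
    refine Finset.sum_congr rfl fun r _ => ?_
    have h3 := hα r
    have h4 := hβ r
    have h5 := hγ r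
    simp only [Pi.smul_apply, Option.elim, smul_eq_mul]
    field_simp

/-! ### The generalized eigenvalue decomposition -/

/-- Row rank equals column rank. The choice `g` depends on the data but ranges over a finite set
that can be searched. -/
theorem exists_det_ne_zero {N : ℕ} {α : Type*} [Finite α] {q : Fin N → α → 𝕜}
    (hq : LinearIndependent 𝕜 q) :
    ∃ g : Fin N → α, (Matrix.of fun i s => q s (g i)).det ≠ 0 := by
  classical
  have := Fintype.ofFinite α
  obtain ⟨b, -, -, hspan, hb⟩ := exists_linearIndepOn_extension
    (linearIndepOn_empty 𝕜 fun (k : α) (s : Fin N) => q s k) (Set.empty_subset Set.univ)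
  have htop : Submodule.span 𝕜 ((fun (k : α) (s : Fin N) => q s k) '' b) = ⊤ := by
    refine eq_top_iff.2 fun v _ => mem_of_forall_dotProduct_eq_zero fun x hx => ?_
    have h0 : ∑ s, x s • q s = 0 := by
      ext k
      have := hx _ (hspan ⟨k, trivial, rfl⟩)
      simpa [dotProduct, mul_comm] using this
    have hx0 : x = 0 := funext (Fintype.linearIndependent_iff.1 hq x h0)
    rw [hx0, dotProduct_zero]
  have hb' : LinearIndependent 𝕜 (fun (k : b) (s : Fin N) => q s k) := hb
  have hcard : Fintype.card b = N := by
    rw [← finrank_span_eq_card hb', ← Set.image_eq_range (fun (k : α) (s : Fin N) => q s k), htop]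
    simp
  let e : Fin N ≃ b := (Fintype.equivFinOfCardEq hcard).symm
  refine ⟨fun i => e i, ?_⟩
  rw [← isUnit_iff_ne_zero, ← Matrix.isUnit_iff_isUnit_det, ← Matrix.linearIndependent_rows_iff_isUnit]
  exact hb'.comp e e.injective

/-- The vector `(1, t, t², …)`. -/
def momentVector (𝕜 : Type*) [RCLike 𝕜] (K t : ℕ) : Fin K → 𝕜 := fun k => (t : 𝕜) ^ (k : ℕ)

/-- The pairings are nonzero polynomials in `t` of degree at most `K`. Their product cannot vanish
at more integers than its degree, so a finite list of candidates works for every input. -/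
theorem exists_momentVector {α : Type*} [Fintype α] (v : α → Fin K → 𝕜) (hv : ∀ i, v i ≠ 0) :
    ∃ t : Fin (Fintype.card α * K + 1), ∀ i, v i ⬝ᵥ momentVector 𝕜 K t ≠ 0 := by
  classical
  let f : α → Polynomial 𝕜 := fun i => ∑ k : Fin K, Polynomial.C (v i k) * Polynomial.X ^ (k : ℕ)
  have hf : ∀ i, f i ≠ 0 := by
    intro i h0
    obtain ⟨k, hk⟩ := Function.ne_iff.1 (hv i)
    apply hk
    have := congrArg (fun p => p.coeff (k : ℕ)) h0
    simpa [f, Polynomial.finsetSum_coeff, Polynomial.coeff_C_mul, Polynomial.coeff_X_pow,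
      Fin.val_inj] using this
  have hdeg : ∀ i, (f i).natDegree ≤ K := fun i =>
    Polynomial.natDegree_sum_le_of_forall_le _ _ fun k _ =>
      (Polynomial.natDegree_C_mul_X_pow_le _ _).trans k.2.le
  by_contra! hcon
  have hzero : ∏ i, f i = 0 := by
    refine Polynomial.eq_zero_of_natDegree_lt_card_of_eval_eq_zero (∏ i, f i)
      (f := fun t : Fin (Fintype.card α * K + 1) => ((t : ℕ) : 𝕜))
      (fun s t hst => Fin.ext (Nat.cast_injective hst)) (fun t => ?_) ?_
    · obtain ⟨i, hi⟩ := hcon t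
      rw [Polynomial.eval_prod]
      refine Finset.prod_eq_zero (Finset.mem_univ i) ?_
      rw [← hi]
      simp [f, Polynomial.eval_finsetSum, dotProduct, momentVector]
    · rw [Fintype.card_fin]
      refine Nat.lt_succ_of_le ((Polynomial.natDegree_prod_le _ _).trans ?_)
      refine (Finset.sum_le_card_nsmul _ _ K fun i _ => hdeg i).trans ?_
      simp
  obtain ⟨i, -, hi⟩ := Finset.prod_eq_zero_iff.1 hzero
  exact hf i hi

/-- The pencil matrix: selected rows `g` of the contraction of the columns of `W` in position
`p` with the vector `y`. -/
def pencil {N n : ℕ} (p : Fin n) (g : Fin N → Fin n → Fin K) (y : Fin K → 𝕜)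
    (W : (Fin n → Fin K) → Fin N → 𝕜) : Matrix (Fin N) (Fin N) 𝕜 :=
  Matrix.of fun i j => ∑ t, y t * W (Function.update (g i) p t) j

/-- The contraction of the columns of `W V` with `z` in all positions but `p`. -/
def contractAll {N n : ℕ} (p : Fin n) (z : Fin K → 𝕜) (W : (Fin n → Fin K) → Fin N → 𝕜)
    (V : Matrix (Fin N) (Fin N) 𝕜) : Fin N → Fin K → 𝕜 :=
  fun j t => ∑ k : Fin n → Fin K, (∑ s, W k s * V s j) *
    ∏ q, Function.update (fun _ => z) p (Pi.single t (1 : 𝕜)) q (k q)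

theorem tensorForm_tensorPow {n : ℕ} (x : Fin K → 𝕜) (h : Fin n → Fin K → 𝕜) :
    tensorForm (tensorPow n x) h = ∏ q, h q ⬝ᵥ x := by
  rw [tensorForm_apply]
  simp only [dotProduct]
  rw [Finset.prod_univ_sum, Fintype.piFinset_univ]
  refine Finset.sum_congr rfl fun k _ => ?_
  rw [Finset.prod_mul_distrib, mul_comm]
  rfl

/-- `M` is the change of basis from the unknown family `Q` to a computed basis `W` of the same
space. -/
theorem exists_isUnit_of_span_eq {N : ℕ} {α : Type*} {Q : Fin N → α → 𝕜}
    (hQ : LinearIndependent 𝕜 Q) {W : α → Fin N → 𝕜}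
    (hW : Submodule.span 𝕜 (Set.range fun j k => W k j) = Submodule.span 𝕜 (Set.range Q)) :
    ∃ M : Matrix (Fin N) (Fin N) 𝕜, IsUnit M.det ∧ ∀ k j, W k j = ∑ s, Q s k * M s j := by
  have h1 : ∀ j, ∃ c : Fin N → 𝕜, ∑ s, c s • Q s = fun k => W k j := fun j =>
    (Submodule.mem_span_range_iff_exists_fun 𝕜).1
      (hW ▸ Submodule.subset_span ⟨j, rfl⟩)
  have h2 : ∀ s, ∃ c : Fin N → 𝕜, ∑ j, c j • (fun k => W k j) = Q s := fun s =>
    (Submodule.mem_span_range_iff_exists_fun 𝕜).1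
      (hW.symm ▸ Submodule.subset_span ⟨s, rfl⟩)
  choose M hM using h1
  choose M' hM' using h2
  have hMW : ∀ k j, W k j = ∑ s, Q s k * M j s := fun k j => by
    have := congrFun (hM j) k
    rw [← this]
    simp [mul_comm]
  refine ⟨Matrix.of fun s j => M j s, ?_, hMW⟩
  have hmul : (Matrix.of fun s j => M j s) * (Matrix.of fun j s => M' s j) = 1 := by
    ext s t
    have h3 : ∑ s, ((∑ j, M j s * M' t j) - (1 : Matrix (Fin N) (Fin N) 𝕜) s t) • Q s = 0 := by
      simp only [sub_smul, Finset.sum_sub_distrib, Finset.sum_smul, Matrix.one_apply, ite_smul,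
        one_smul, zero_smul]
      rw [Finset.sum_comm, sub_eq_zero]
      simp only [mul_comm (M _ _), mul_smul, ← Finset.smul_sum, hM]
      simpa using hM' t
    exact sub_eq_zero.1 (Fintype.linearIndependent_iff.1 hQ _ h3 s)
  exact (Matrix.isUnit_det_of_right_inverse hmul)

/-- The choices of `p`, `y`, `z`, `g` for which the pencil determines the vectors `x`. -/
structure IsGenericChoice {N n : ℕ} (p : Fin n) (g : Fin N → Fin n → Fin K) (y z : Fin K → 𝕜)
    (x : Fin N → Fin K → 𝕜) : Prop where
  det_ne_zero : (Matrix.of fun i s => ∏ q ∈ Finset.univ.erase p, x s (g i q)).det ≠ 0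
  ne_zero : ∀ s, x s ⬝ᵥ z ≠ 0
  ne : ∀ s t, s ≠ t → (x s ⬝ᵥ y) * (x t ⬝ᵥ z) ≠ (x t ⬝ᵥ y) * (x s ⬝ᵥ z)

section

variable {N n : ℕ} {p : Fin n} {g : Fin N → Fin n → Fin K} {y z : Fin K → 𝕜}
  {x : Fin N → Fin K → 𝕜} {W : (Fin n → Fin K) → Fin N → 𝕜} {M : Matrix (Fin N) (Fin N) 𝕜}

/-- Only the diagonal factor depends on `y`, so the pencils for `y` and `z` are diagonalized
simultaneously. -/
theorem pencil_eq (hM : ∀ k j, W k j = ∑ s, tensorPow n (x s) k * M s j) (y : Fin K → 𝕜) :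
    pencil p g y W = (Matrix.of fun i s => ∏ q ∈ Finset.univ.erase p, x s (g i q)) *
      Matrix.diagonal (fun s => x s ⬝ᵥ y) * M := by
  classical
  ext i j
  rw [Matrix.mul_apply]
  simp only [pencil, Matrix.of_apply, hM, Matrix.mul_diagonal, Finset.mul_sum]
  rw [Finset.sum_comm]
  refine Finset.sum_congr rfl fun s _ => ?_
  have h1 : ∀ t, tensorPow n (x s) (Function.update (g i) p t) =
      x s t * ∏ q ∈ Finset.univ.erase p, x s (g i q) := fun t => by
    rw [tensorPow, ← Finset.mul_prod_erase _ _ (Finset.mem_univ p), Function.update_self]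
    congr 1
    exact Finset.prod_congr rfl fun q hq => by
      rw [Function.update_of_ne (Finset.ne_of_mem_erase hq)]
  simp only [h1, dotProduct, Finset.sum_mul, Finset.mul_sum]
  exact Finset.sum_congr rfl fun t _ => by ring

theorem IsGenericChoice.exists_isGEVD (h : IsGenericChoice p g y z x) (hu : IsUnit M.det)
    (hM : ∀ k j, W k j = ∑ s, tensorPow n (x s) k * M s j) :
    ∃ V d, IsGEVD (pencil p g y W) (pencil p g z W) V d := by
  classical
  -- The eigenvalues are the ratios of the two diagonal factors.
  refine ⟨M⁻¹, fun s => (x s ⬝ᵥ y) / (x s ⬝ᵥ z), ?_, ?_, ?_⟩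
  · rw [pencil_eq hM, Matrix.det_mul, Matrix.det_mul, Matrix.det_diagonal]
    exact ((isUnit_iff_ne_zero.2 h.det_ne_zero).mul
      (isUnit_iff_ne_zero.2 (Finset.prod_ne_zero_iff.2 fun s _ => h.ne_zero s))).mul hu
  · exact M.isUnit_nonsing_inv_det hu
  · rw [pencil_eq hM, pencil_eq hM, Matrix.mul_nonsing_inv_cancel_right _ _ hu,
      Matrix.mul_nonsing_inv_cancel_right _ _ hu, Matrix.mul_assoc, Matrix.diagonal_mul_diagonal]
    congr 2
    ext s
    rw [mul_div_cancel₀ _ (h.ne_zero s)]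

/-- The ratios are distinct, so each column of `M * V` has a single nonzero entry and each column of
`W V` is a multiple of one power. Contracting all positions but `p` with `z` leaves a nonzero
multiple of the normal vector. -/
theorem IsGenericChoice.exists_perm (h : IsGenericChoice p g y z x) (hu : IsUnit M.det)
    (hM : ∀ k j, W k j = ∑ s, tensorPow n (x s) k * M s j) {V : Matrix (Fin N) (Fin N) 𝕜}
    {d : Fin N → 𝕜} (hV : IsGEVD (pencil p g y W) (pencil p g z W) V d) :
    ∃ (π : Equiv.Perm (Fin N)) (a : Fin N → 𝕜),
      ∀ j, a j ≠ 0 ∧ contractAll p z W V j = a j • x (π j) := by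
  classical
  obtain ⟨-, hVu, hVd⟩ := hV
  set Z := M * V with hZ
  have hZu : IsUnit Z.det := by rw [hZ, Matrix.det_mul]; exact hu.mul hVu
  have hrel : ∀ s j, (x s ⬝ᵥ y) * Z s j = (x s ⬝ᵥ z) * Z s j * d j := by
    intro s j
    rw [pencil_eq hM, pencil_eq hM] at hVd
    simp only [Matrix.mul_assoc] at hVd
    let _ := Matrix.invertibleOfIsUnitDet _ (isUnit_iff_ne_zero.2 h.det_ne_zero)
    have h1 := (Matrix.mul_right_inj_of_invertible (Matrix.of fun i s =>
      ∏ q ∈ Finset.univ.erase p, x s (g i q))).1 hVd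
    have h2 := congrFun (congrFun h1 s) j
    rw [Matrix.diagonal_mul, Matrix.diagonal_mul, ← Matrix.mul_assoc, Matrix.mul_diagonal] at h2
    rw [h2, mul_assoc]
  have hcol : ∀ j, ∃ s, Z s j ≠ 0 := by
    intro j
    by_contra! h0
    exact hZu.ne_zero (Matrix.det_eq_zero_of_column_eq_zero j h0)
  have hrow : ∀ s, ∃ j, Z s j ≠ 0 := by
    intro s
    by_contra! h0
    exact hZu.ne_zero (Matrix.det_eq_zero_of_row_eq_zero s h0)
  have huniq : ∀ s t j, Z s j ≠ 0 → Z t j ≠ 0 → s = t := by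
    intro s t j hs ht
    by_contra hne
    have h1 : x s ⬝ᵥ y = (x s ⬝ᵥ z) * d j := mul_right_cancel₀ hs (by rw [hrel]; ring)
    have h2 : x t ⬝ᵥ y = (x t ⬝ᵥ z) * d j := mul_right_cancel₀ ht (by rw [hrel]; ring)
    exact h.ne s t hne (by rw [h1, h2]; ring)
  choose π hπ using hcol
  have hsurj : Function.Surjective π := fun s => by
    obtain ⟨j, hj⟩ := hrow s
    exact ⟨j, huniq _ _ j (hπ j) hj⟩
  refine ⟨Equiv.ofBijective π (Finite.surjective_iff_bijective.1 hsurj),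
    fun j => Z (π j) j * ∏ q ∈ Finset.univ.erase p, x (π j) ⬝ᵥ z, fun j => ⟨?_, ?_⟩⟩
  · exact mul_ne_zero (hπ j) (Finset.prod_ne_zero_iff.2 fun q _ => h.ne_zero _)
  · ext t
    have hWV : ∀ k, ∑ s, W k s * V s j = Z (π j) j * tensorPow n (x (π j)) k := by
      intro k
      have h1 : ∑ s, W k s * V s j = ∑ s, tensorPow n (x s) k * Z s j := by
        simp only [hM, hZ, Matrix.mul_apply, Finset.sum_mul, Finset.mul_sum]
        rw [Finset.sum_comm]
        exact Finset.sum_congr rfl fun s _ => Finset.sum_congr rfl fun q _ => by ring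
      rw [h1, Finset.sum_eq_single (π j)]
      · ring
      · intro s _ hs
        have : Z s j = 0 := by
          by_contra h0
          exact hs (huniq _ _ j h0 (hπ j))
        rw [this, mul_zero]
      · simp
    have h2 := tensorForm_tensorPow (x (π j))
      (Function.update (fun _ : Fin n => z) p (Pi.single t (1 : 𝕜)))
    rw [tensorForm_apply, ← Finset.mul_prod_erase _ _ (Finset.mem_univ p),
      Function.update_self] at h2
    simp only [contractAll, hWV, mul_assoc, ← Finset.mul_sum, h2, Pi.smul_apply, smul_eq_mul,
      Equiv.ofBijective_apply]
    rw [single_one_dotProduct, mul_comm (x (π j) t)]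
    congr 2
    exact Finset.prod_congr rfl fun q hq => by
      rw [Function.update_of_ne (Finset.ne_of_mem_erase hq), dotProduct_comm]

end

/-- Position `p` is reserved for `y` and `z`; the other `n - 1` positions suffice for independence.
-/
theorem IsNormalFamily.exists_isGenericChoice {N n : ℕ} {c : Fin R → Fin K → 𝕜}
    {S : Fin N ≃ {s : Finset (Fin R) // s.card = K - 1}} {x : Fin N → Fin K → 𝕜}
    (hx : IsNormalFamily c S x) (hK : 1 ≤ K) (hKR : K ≤ R) (hn : R - (K - 1) + 1 ≤ n)
    (p : Fin n) :
    ∃ (g : Fin N → Fin n → Fin K)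
      (t : Fin (Fintype.card {q : Fin N × Fin N // q.1 ≠ q.2} * K + 1))
      (u : Fin (Fintype.card (Fin N) * K + 1)),
      IsGenericChoice p g (momentVector 𝕜 K t) (momentVector 𝕜 K u) x := by
  classical
  obtain ⟨g, hg⟩ := exists_det_ne_zero (hx.linearIndependent hK hKR (P := Finset.univ.erase p)
    (by rw [Finset.card_erase_of_mem (Finset.mem_univ p), Finset.card_univ, Fintype.card_fin]
        omega))
  have hne : ∀ j, x j ≠ 0 := by
    intro j h0
    have hall : (S j).1 = Finset.univ := Finset.eq_univ_iff_forall.2 fun r =>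
      (hx j r).1 (by rw [h0, dotProduct_zero])
    have := (S j).2
    rw [hall, Finset.card_univ, Fintype.card_fin] at this
    omega
  obtain ⟨u, hu⟩ := exists_momentVector x hne
  -- The ratios for `i` and `j` differ unless this combination is orthogonal to `y`. It is nonzero,
  -- as proportional normal vectors would have the same zero set.
  obtain ⟨t, ht⟩ := exists_momentVector (α := {q : Fin N × Fin N // q.1 ≠ q.2})
    (fun q => (x q.1.2 ⬝ᵥ momentVector 𝕜 K u) • x q.1.1 -
      (x q.1.1 ⬝ᵥ momentVector 𝕜 K u) • x q.1.2) (by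
      rintro ⟨⟨i, j⟩, hij⟩ h0
      have h1 := sub_eq_zero.1 h0
      refine hij (S.injective (Subtype.ext (Finset.ext fun r => ?_)))
      have h2 := congrArg (fun v => c r ⬝ᵥ v) h1
      simp only [dotProduct_smul, smul_eq_mul] at h2
      rw [← hx i r, ← hx j r]
      constructor
      · intro h3
        rw [h3, mul_zero, eq_comm] at h2
        exact (mul_eq_zero.1 h2).resolve_left (hu i)
      · intro h3
        rw [h3, mul_zero] at h2
        exact (mul_eq_zero.1 h2).resolve_left (hu j))
  refine ⟨g, t, u, hg, hu, fun i j hij heq => ht ⟨(i, j), hij⟩ ?_⟩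
  simp only [sub_dotProduct, smul_dotProduct, smul_eq_mul]
  rw [sub_eq_zero, mul_comm, heq, mul_comm]

theorem IsNormalFamily.smul_perm {N : ℕ} {c : Fin R → Fin K → 𝕜}
    {S : Fin N ≃ {s : Finset (Fin R) // s.card = K - 1}} {x x' : Fin N → Fin K → 𝕜}
    (hx : IsNormalFamily c S x) {π : Equiv.Perm (Fin N)} {a : Fin N → 𝕜}
    (h : ∀ j, a j ≠ 0 ∧ x' j = a j • x (π j)) : IsNormalFamily c (π.trans S) x' := by
  intro j r
  rw [(h j).2, dotProduct_smul, smul_eq_mul, mul_eq_zero, or_iff_right (h j).1]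
  exact hx (π j) r

/-! ### The algebraic procedure -/

namespace Solvable

variable {ι : Type} [Finite ι]

theorem nullVec {α β : Type} [Fintype α] [Fintype β] (M : (ι → 𝕜) → Matrix α β 𝕜)
    (hM : ∀ a b, IsPoly fun x => M x a b) :
    Solvable (fun x => ∃ v, matKer (M x) = Submodule.span 𝕜 {v})
      fun x (y : β → 𝕜) => Submodule.span 𝕜 {y} = matKer (M x) := by
  refine ((nullBasis M hM 1).mono (Pre' := fun x => ∃ v, matKer (M x) = Submodule.span 𝕜 {v})
    ?_ fun _ _ _ h => h).postcomp (fun y b => y (b, 0)) (fun b => IsPoly.coord _) ?_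
  · rintro x ⟨v, hv⟩
    rw [hv]
    exact (finrank_span_le_card {v}).trans (by simp)
  · rintro x y - hy
    rw [← hy, Set.range_unique]
    rfl

/-- The range of a matrix is the orthogonal complement of the null space of its transpose, so the
intersection is the null space of the stacked null space bases. -/
theorem iInfRange {N : ℕ} (F : Fin N → (ι → 𝕜) → Matrix (Fin I) (Fin J) 𝕜)
    (hF : ∀ j a b, IsPoly fun x => F j x a b) (s : Finset (Fin N)) :
    Solvable (fun x => ∃ v, ⨅ j ∈ s, matRange (F j x) = Submodule.span 𝕜 {v})
      fun x (y : Fin I → 𝕜) => Submodule.span 𝕜 {y} = ⨅ j ∈ s, matRange (F j x) := by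
  classical
  have h1 := pi (𝕜 := 𝕜) fun j => (nullBasis (fun x => (F j x)ᵀ) (fun a b => hF j b a) I).mono
    (Pre' := fun x => ∃ v, ⨅ j ∈ s, matRange (F j x) = Submodule.span 𝕜 {v})
    (fun x _ => by simpa using (matKer (F j x)ᵀ).finrank_le) fun _ _ _ h => h
  refine h1.bind ?_
  let M : (ι ⊕ Fin N × Fin I × Fin I → 𝕜) → Matrix (Fin N × Fin I) (Fin I) 𝕜 :=
    fun w => Matrix.of fun jt i => if jt.1 ∈ s then w (Sum.inr (jt.1, i, jt.2)) else 0
  have hM : ∀ a b, IsPoly fun w => M w a b := fun a b =>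
    IsPoly.ite _ (IsPoly.coord _) IsPoly.zero
  have hker : ∀ w : ι ⊕ Fin N × Fin I × Fin I → 𝕜, (∀ j : Fin N, Submodule.span 𝕜
      (Set.range fun t i => w (Sum.inr (j, i, t))) = matKer (F j fun i => w (Sum.inl i))ᵀ) →
      matKer (M w) = ⨅ j ∈ s, matRange (F j fun i => w (Sum.inl i)) := by
    intro w hw
    ext v
    have hv : v ∈ matKer (M w) ↔ ∀ j ∈ s, ∀ t, (fun i => w (Sum.inr (j, i, t))) ⬝ᵥ v = 0 := by
      change M w *ᵥ v = 0 ↔ _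
      rw [funext_iff]
      simp only [Prod.forall, Matrix.mulVec, dotProduct, M, Matrix.of_apply, Pi.zero_apply]
      refine forall_congr' fun j => ?_
      by_cases hj : j ∈ s <;> simp [hj]
    rw [hv]
    simp only [Submodule.mem_iInf]
    refine forall_congr' fun j => forall_congr' fun _ => ?_
    constructor
    · intro h
      refine mem_of_forall_dotProduct_eq_zero fun u hu => ?_
      have hu' : u ∈ matKer (F j fun i => w (Sum.inl i))ᵀ := by
        change (F j fun i => w (Sum.inl i))ᵀ *ᵥ u = 0
        ext b
        refine hu _ ⟨Pi.single b 1, ?_⟩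
        rw [Matrix.mulVecLin_apply, Matrix.mulVec_single_one]
        rfl
      rw [← hw j] at hu'
      rw [dotProduct_comm]
      clear hu
      induction hu' using Submodule.span_induction with
      | mem u hu => obtain ⟨t, rfl⟩ := hu; exact h t
      | zero => simp
      | add u u' _ _ h1 h2 => rw [add_dotProduct, h1, h2, add_zero]
      | smul a u _ h1 => rw [smul_dotProduct, h1, smul_zero]
    · rintro ⟨b, rfl⟩ t
      have ht : (fun i => w (Sum.inr (j, i, t))) ∈ matKer (F j fun i => w (Sum.inl i))ᵀ :=
        hw j ▸ Submodule.subset_span ⟨t, rfl⟩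
      have ht' : (F j fun i => w (Sum.inl i))ᵀ *ᵥ (fun i => w (Sum.inr (j, i, t))) = 0 := ht
      rw [Matrix.mulVecLin_apply, Matrix.dotProduct_mulVec, ← Matrix.mulVec_transpose, ht',
        zero_dotProduct]
  refine (nullVec M hM).mono ?_ ?_
  · rintro w ⟨⟨v, hv⟩, hw⟩
    exact ⟨v, by rw [hker w hw, hv]⟩
  · rintro w y ⟨-, hw⟩ hy
    rw [hy, hker w hw]

end Solvable

/-! ### Stages of the procedure, from the last one back to the first -/

/-- The tensor with the given entries. -/
def tensorOf (x : Fin I × Fin J × Fin K → 𝕜) : Tensor 𝕜 I J K := fun i j k => x (i, j, k)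

/-- The tensor `[A, B, C]_R` for the factor matrices with the given entries. -/
def polyadicOf (z : (Fin I × Fin R) ⊕ (Fin J × Fin R) ⊕ (Fin K × Fin R) → 𝕜) : Tensor 𝕜 I J K :=
  polyadic (Matrix.of fun i r => z (Sum.inl (i, r))) (Matrix.of fun j r => z (Sum.inr (Sum.inl (j, r))))
    (Matrix.of fun k r => z (Sum.inr (Sum.inr (k, r))))

theorem IsPoly.contract {ι : Type} {T : (ι → 𝕜) → Tensor 𝕜 I J K} {x : (ι → 𝕜) → Fin K → 𝕜}
    (hT : ∀ i j k, IsPoly fun w => T w i j k) (hx : ∀ k, IsPoly fun w => x w k) (i : Fin I)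
    (j : Fin J) : IsPoly fun w => contract (T w) (x w) i j := by
  simpa only [CPD.contract, Matrix.of_apply] using
    IsPoly.sum Finset.univ fun k _ => (hT i j k).mul (hx k)

theorem solvable_of_columns (m : ℕ) :
    Solvable (fun w : (Fin I × Fin J × Fin K) ⊕ (Fin R × Fin I) ⊕ (Fin R × Fin J) ⊕
        (Fin R × Fin K) → 𝕜 => ∃ A B C, IsRigid m A B C ∧
          tensorOf (fun t => w (Sum.inl t)) = polyadic A B C ∧
          (∀ r, ∃ t : 𝕜, t ≠ 0 ∧ (fun i => w (Sum.inr (Sum.inl (r, i)))) = t • A.col r) ∧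
          (∀ r, ∃ t : 𝕜, t ≠ 0 ∧ (fun j => w (Sum.inr (Sum.inr (Sum.inl (r, j))))) = t • B.col r) ∧
          (∀ r, ∃ t : 𝕜, t ≠ 0 ∧ (fun k => w (Sum.inr (Sum.inr (Sum.inr (r, k))))) = t • C.col r))
      fun w (z : (Fin I × Fin R) ⊕ (Fin J × Fin R) ⊕ (Fin K × Fin R) → 𝕜) =>
        tensorOf (fun t => w (Sum.inl t)) = polyadicOf z := by
  let M : ((Fin I × Fin J × Fin K) ⊕ (Fin R × Fin I) ⊕ (Fin R × Fin J) ⊕ (Fin R × Fin K) → 𝕜) →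
      Matrix (Fin I × Fin J × Fin K) (Option (Fin R)) 𝕜 := fun w =>
    scalingMatrix (tensorOf fun t => w (Sum.inl t)) (fun r i => w (Sum.inr (Sum.inl (r, i))))
      (fun r j => w (Sum.inr (Sum.inr (Sum.inl (r, j)))))
      fun r k => w (Sum.inr (Sum.inr (Sum.inr (r, k))))
  have hM : ∀ t o, IsPoly fun w => M w t o := by
    rintro t (_ | r)
    · exact (IsPoly.coord _).neg
    · exact ((IsPoly.coord _).mul (IsPoly.coord _)).mul (IsPoly.coord _)
  refine ((Solvable.nullVec M hM).mono ?_ fun _ _ _ h => h).bind ?_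
  · rintro w ⟨A, B, C, h, hT, ha, hb, hc⟩
    obtain ⟨v, -, hv⟩ := h.ker_scalingMatrix ha hb hc
    exact ⟨v, by simp only [M, hT, hv]⟩
  -- The null vector is normalized by its nonzero coordinate `none`, and all scalings are put into
  -- the first factor.
  refine (Solvable.arith_div
    (fun w => Sum.elim (fun ir => w (Sum.inl (Sum.inr (Sum.inl (ir.2, ir.1)))) *
        w (Sum.inr (some ir.2)))
      (Sum.elim (fun jr => w (Sum.inl (Sum.inr (Sum.inr (Sum.inl (jr.2, jr.1))))))
        fun kr => w (Sum.inl (Sum.inr (Sum.inr (Sum.inr (kr.2, kr.1)))))))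
    (fun w => Sum.elim (fun _ => w (Sum.inr none)) fun _ => 1) ?_ ?_).mono
    (fun _ _ => trivial) ?_
  · rintro (_ | _ | _)
    · exact (IsPoly.coord _).mul (IsPoly.coord _)
    · exact IsPoly.coord _
    · exact IsPoly.coord _
  · rintro (_ | _)
    · exact IsPoly.coord _
    · exact IsPoly.one
  · rintro w z ⟨⟨A, B, C, h, hT, ha, hb, hc⟩, hw⟩ hz
    obtain ⟨v, hv1, hv⟩ := h.ker_scalingMatrix ha hb hc
    have hw1 := hw
    simp only [M, hT, hv] at hw1
    obtain ⟨s, hs, hsv⟩ := exists_smul_of_span_eq (by rintro rfl; simp at hv1) hw1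
    have hnone : w (Sum.inr none) = s := by
      rw [congrFun hsv none, Pi.smul_apply, hv1, smul_eq_mul, mul_one]
    have hmem : (fun o => w (Sum.inr o)) ∈ matKer (M fun i => w (Sum.inl i)) :=
      hw ▸ Submodule.mem_span_singleton_self _
    rw [mem_ker_scalingMatrix] at hmem
    ext i j k
    have h1 := hmem i j k
    rw [hnone] at h1
    rw [← mul_div_cancel_right₀ (tensorOf (fun t => w (Sum.inl (Sum.inl t))) i j k) hs, ← h1,
      Finset.sum_div]
    simp only [polyadicOf, polyadic, outer, Finset.sum_apply, Matrix.col_apply, Matrix.of_apply, hz,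
      Sum.elim_inl, Sum.elim_inr, hnone, div_one]
    exact Finset.sum_congr rfl fun r _ => by ring

/-- `L` lists, for each term `r`, the normal vectors orthogonal to its third column; with it known,
every factor column is an intersection computable up to scale. -/
theorem solvable_of_labels {N : ℕ} (m : ℕ) (L : Fin R → Finset (Fin N)) :
    Solvable (fun w : (Fin I × Fin J × Fin K) ⊕ (Fin N × Fin K) → 𝕜 =>
        ∃ (A : Matrix (Fin I) (Fin R) 𝕜) (B : Matrix (Fin J) (Fin R) 𝕜)
          (C : Matrix (Fin K) (Fin R) 𝕜) (S : Fin N ≃ {s : Finset (Fin R) // s.card = K - 1}),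
          IsRigid m A B C ∧ tensorOf (fun t => w (Sum.inl t)) = polyadic A B C ∧
          IsNormalFamily C.col S (fun j k => w (Sum.inr (j, k))) ∧
          ∀ r j, j ∈ L r ↔ r ∈ (S j).1)
      fun w (z : (Fin I × Fin R) ⊕ (Fin J × Fin R) ⊕ (Fin K × Fin R) → 𝕜) =>
        tensorOf (fun t => w (Sum.inl t)) = polyadicOf z := by
  classical
  let Pre : ((Fin I × Fin J × Fin K) ⊕ (Fin N × Fin K) → 𝕜) → Prop := fun w =>
    ∃ (A : Matrix (Fin I) (Fin R) 𝕜) (B : Matrix (Fin J) (Fin R) 𝕜)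
      (C : Matrix (Fin K) (Fin R) 𝕜) (S : Fin N ≃ {s : Finset (Fin R) // s.card = K - 1}),
      IsRigid m A B C ∧ tensorOf (fun t => w (Sum.inl t)) = polyadic A B C ∧
      IsNormalFamily C.col S (fun j k => w (Sum.inr (j, k))) ∧ ∀ r j, j ∈ L r ↔ r ∈ (S j).1
  let F : Fin N → ((Fin I × Fin J × Fin K) ⊕ (Fin N × Fin K) → 𝕜) → Matrix (Fin I) (Fin J) 𝕜 :=
    fun j w => contract (tensorOf fun t => w (Sum.inl t)) fun k => w (Sum.inr (j, k))
  let G : Fin R → ((Fin I × Fin J × Fin K) ⊕ (Fin N × Fin K) → 𝕜) → Matrix (Fin N) (Fin K) 𝕜 :=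
    fun r w => Matrix.of fun j k => if j ∈ L r then w (Sum.inr (j, k)) else 0
  have hF : ∀ j a b, IsPoly fun w => F j w a b := fun j a b =>
    IsPoly.contract (fun _ _ _ => IsPoly.coord _) (fun _ => IsPoly.coord _) a b
  have hG : ∀ r a b, IsPoly fun w => G r w a b := fun r a b =>
    IsPoly.ite _ (IsPoly.coord _) IsPoly.zero
  have keyA : ∀ (w : (Fin I × Fin J × Fin K) ⊕ (Fin N × Fin K) → 𝕜)
      {A : Matrix (Fin I) (Fin R) 𝕜} {B : Matrix (Fin J) (Fin R) 𝕜} {C : Matrix (Fin K) (Fin R) 𝕜}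
      {S : Fin N ≃ {s : Finset (Fin R) // s.card = K - 1}}, IsRigid m A B C →
      tensorOf (fun t => w (Sum.inl t)) = polyadic A B C →
      IsNormalFamily C.col S (fun j k => w (Sum.inr (j, k))) → (∀ r j, j ∈ L r ↔ r ∈ (S j).1) →
      ∀ r, ⨅ j ∈ (L r)ᶜ, matRange (F j w) = Submodule.span 𝕜 {A.col r} := by
    intro w A B C S h hT hx hL r
    simp only [F, hT, contract_polyadic]
    exact h.iInf_matRange hx r fun j => by rw [Finset.mem_compl, hL]
  have keyB : ∀ (w : (Fin I × Fin J × Fin K) ⊕ (Fin N × Fin K) → 𝕜)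
      {A : Matrix (Fin I) (Fin R) 𝕜} {B : Matrix (Fin J) (Fin R) 𝕜} {C : Matrix (Fin K) (Fin R) 𝕜}
      {S : Fin N ≃ {s : Finset (Fin R) // s.card = K - 1}}, IsRigid m A B C →
      tensorOf (fun t => w (Sum.inl t)) = polyadic A B C →
      IsNormalFamily C.col S (fun j k => w (Sum.inr (j, k))) → (∀ r j, j ∈ L r ↔ r ∈ (S j).1) →
      ∀ r, ⨅ j ∈ (L r)ᶜ, matRange (F j w)ᵀ = Submodule.span 𝕜 {B.col r} := by
    intro w A B C S h hT hx hL r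
    simp only [F, hT, contract_polyadic, Matrix.transpose_mul, Matrix.transpose_transpose,
      Matrix.diagonal_transpose, ← Matrix.mul_assoc]
    exact h.transpose.iInf_matRange hx r fun j => by rw [Finset.mem_compl, hL]
  have keyC : ∀ (w : (Fin I × Fin J × Fin K) ⊕ (Fin N × Fin K) → 𝕜)
      {A : Matrix (Fin I) (Fin R) 𝕜} {B : Matrix (Fin J) (Fin R) 𝕜} {C : Matrix (Fin K) (Fin R) 𝕜}
      {S : Fin N ≃ {s : Finset (Fin R) // s.card = K - 1}}, IsRigid m A B C →
      IsNormalFamily C.col S (fun j k => w (Sum.inr (j, k))) → (∀ r j, j ∈ L r ↔ r ∈ (S j).1) →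
      ∀ r, matKer (G r w) = Submodule.span 𝕜 {C.col r} := by
    intro w A B C S h hx hL r
    ext v
    rw [← hx.mem_span_singleton h.posC h.two_le h.le r v]
    change G r w *ᵥ v = 0 ↔ _
    rw [funext_iff]
    refine forall_congr' fun j => ?_
    simp only [Matrix.mulVec, dotProduct, G, Matrix.of_apply, Pi.zero_apply, ← hL]
    by_cases hj : j ∈ L r <;> simp [hj]
  clear_value F G
  have hA : Solvable Pre fun w (y : Fin R × Fin I → 𝕜) => ∀ r,
      Submodule.span 𝕜 {fun i => y (r, i)} = ⨅ j ∈ (L r)ᶜ, matRange (F j w) :=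
    Solvable.pi fun r => (Solvable.iInfRange F hF (L r)ᶜ).mono
      (fun w ⟨A, B, C, S, h, hT, hx, hL⟩ => ⟨A.col r, keyA w h hT hx hL r⟩) fun _ _ _ h => h
  have hB : Solvable Pre fun w (y : Fin R × Fin J → 𝕜) => ∀ r,
      Submodule.span 𝕜 {fun i => y (r, i)} = ⨅ j ∈ (L r)ᶜ, matRange (F j w)ᵀ :=
    Solvable.pi fun r =>
      (Solvable.iInfRange (fun j w => (F j w)ᵀ) (fun j a b => hF j b a) (L r)ᶜ).mono
      (fun w ⟨A, B, C, S, h, hT, hx, hL⟩ => ⟨B.col r, keyB w h hT hx hL r⟩) fun _ _ _ h => h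
  have hC : Solvable Pre fun w (y : Fin R × Fin K → 𝕜) => ∀ r,
      Submodule.span 𝕜 {fun i => y (r, i)} = matKer (G r w) :=
    Solvable.pi fun r => (Solvable.nullVec (G r) (hG r)).mono
      (fun w ⟨A, B, C, S, h, hT, hx, hL⟩ => ⟨C.col r, keyC w h hx hL r⟩) fun _ _ _ h => h
  refine (hA.pair (hB.pair hC)).bind ?_
  refine ((solvable_of_columns (I := I) (J := J) (K := K) (R := R) (𝕜 := 𝕜) m).precomp
    (fun w => Sum.elim (fun t => w (Sum.inl (Sum.inl t))) fun y => w (Sum.inr y)) ?_).mono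
    ?_ fun w z _ hz => hz
  · rintro (_ | _) <;> exact IsPoly.coord _
  · rintro w ⟨⟨A, B, C, S, h, hT, hx, hL⟩, hyA, hyB, hyC⟩
    have hne : ∀ {q : ℕ} {v : Fin R → Fin q → 𝕜} {p : ℕ}, 1 ≤ p → GeneralPosition p v →
        ∀ r, v r ≠ 0 := fun hp hv r => (hv {r} (by simpa using hp)).ne_zero (by simp)
    have hK := h.two_le
    have hm := h.add_eq
    have hKR := h.le
    refine ⟨A, B, C, h, hT, fun r => ?_, fun r => ?_, fun r => ?_⟩
    · exact exists_smul_of_span_eq (hne (by omega) h.posA r)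
        ((hyA r).trans (keyA _ h hT hx hL r))
    · exact exists_smul_of_span_eq (hne (by omega) h.posB r)
        ((hyB r).trans (keyB _ h hT hx hL r))
    · exact exists_smul_of_span_eq (hne (by omega) h.posC r)
        ((hyC r).trans (keyC _ h hx hL r))

/-- A candidate is checked by polynomial equations, namely that it reproduces the tensor. -/
theorem Solvable.search_decomposition {ι θ : Type} [Finite ι] [Finite θ]
    {Pre : θ → ((Fin I × Fin J × Fin K) ⊕ ι → 𝕜) → Prop}
    (h : ∀ t, Solvable (Pre t)
      fun w (z : (Fin I × Fin R) ⊕ (Fin J × Fin R) ⊕ (Fin K × Fin R) → 𝕜) =>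
        tensorOf (fun t => w (Sum.inl t)) = polyadicOf z) :
    Solvable (fun w => ∃ t, Pre t w)
      fun w (z : (Fin I × Fin R) ⊕ (Fin J × Fin R) ⊕ (Fin K × Fin R) → 𝕜) =>
        tensorOf (fun t => w (Sum.inl t)) = polyadicOf z := by
  refine Solvable.search (fun (a : Fin I × Fin J × Fin K) w z =>
    w (Sum.inl a) - polyadicOf z a.1 a.2.1 a.2.2) ?_ ?_ ?_ h
  · rintro ⟨i, j, k⟩
    simp only [polyadicOf, polyadic, outer, Finset.sum_apply, Matrix.col_apply, Matrix.of_apply]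
    exact (IsPoly.coord _).sub (IsPoly.sum _ fun r _ =>
      ((IsPoly.coord _).mul (IsPoly.coord _)).mul (IsPoly.coord _))
  · intro w z hz
    ext i j k
    exact sub_eq_zero.1 (hz (i, j, k))
  · rintro w z hz ⟨i, j, k⟩
    exact sub_eq_zero.2 (congrFun (congrFun (congrFun hz i) j) k)

/-- The entries of the tensor together with the entries of a basis of a space of tensors. -/
abbrev BasisState (I J K N n : ℕ) : Type :=
  (Fin I × Fin J × Fin K) ⊕ ((Fin n → Fin K) × Fin N)

/-- The eigenvectors come in unknown order, so after the decomposition of the pencil all labellings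
`L` are tried. -/
theorem solvable_of_choice {N n : ℕ} (m : ℕ) (p : Fin n) (g : Fin N → Fin n → Fin K)
    (y z : ℕ) (hn : R - (K - 1) ≤ n) :
    Solvable (fun w : BasisState I J K N n → 𝕜 =>
        ∃ (A : Matrix (Fin I) (Fin R) 𝕜) (B : Matrix (Fin J) (Fin R) 𝕜)
          (C : Matrix (Fin K) (Fin R) 𝕜) (S : Fin N ≃ {s : Finset (Fin R) // s.card = K - 1})
          (x : Fin N → Fin K → 𝕜),
          IsRigid m A B C ∧ tensorOf (fun t => w (Sum.inl t)) = polyadic A B C ∧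
          IsNormalFamily C.col S x ∧
          Submodule.span 𝕜 (Set.range fun j k => w (Sum.inr (k, j))) =
            Submodule.span 𝕜 (Set.range fun j => tensorPow n (x j)) ∧
          IsGenericChoice p g (momentVector 𝕜 K y) (momentVector 𝕜 K z) x)
      fun w (z : (Fin I × Fin R) ⊕ (Fin J × Fin R) ⊕ (Fin K × Fin R) → 𝕜) =>
        tensorOf (fun t => w (Sum.inl t)) = polyadicOf z := by
  classical
  have hmoment : ∀ {ι : Type} (y : ℕ) (t : Fin K),
      IsPoly fun _ : ι → 𝕜 => momentVector 𝕜 K y t := fun y t => by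
    simpa [momentVector] using IsPoly.natCast (𝕜 := 𝕜) (y ^ (t : ℕ))
  have hpencil : ∀ y i j, IsPoly fun w : BasisState I J K N n → 𝕜 =>
      pencil p g (momentVector 𝕜 K y) (fun k j => w (Sum.inr (k, j))) i j := fun y i j => by
    simpa only [pencil, Matrix.of_apply] using
      IsPoly.sum Finset.univ fun t _ => (hmoment y t).mul (IsPoly.coord _)
  refine ((Solvable.gevd
    (fun w : BasisState I J K N n → 𝕜 =>
      pencil p g (momentVector 𝕜 K y) fun k j => w (Sum.inr (k, j)))
    (fun w => pencil p g (momentVector 𝕜 K z) fun k j => w (Sum.inr (k, j)))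
    (hpencil y) (hpencil z)).mono ?_ fun _ _ _ h => h).bind ?_
  · rintro w ⟨A, B, C, S, x, h, -, hx, hspan, hgen⟩
    have hK := h.two_le
    obtain ⟨M, hu, hM⟩ := exists_isUnit_of_span_eq
      (hx.linearIndependent_tensorPow (by omega) h.le hn) hspan
    exact hgen.exists_isGEVD hu hM
  refine ((Solvable.search_decomposition (solvable_of_labels (𝕜 := 𝕜) (I := I) (J := J) (K := K)
    (R := R) (N := N) m)).precomp
    (fun w => Sum.elim (fun t => w (Sum.inl (Sum.inl t))) fun jk =>
      contractAll p (momentVector 𝕜 K z) (fun k j => w (Sum.inl (Sum.inr (k, j))))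
        (Matrix.of fun i j => w (Sum.inr (Sum.inl (i, j)))) jk.1 jk.2) ?_).mono
    ?_ fun w z _ hz => hz
  · rintro (_ | ⟨j, t⟩)
    · exact IsPoly.coord _
    · refine IsPoly.sum _ fun k _ => (IsPoly.sum _ fun s _ =>
        (IsPoly.coord _).mul (IsPoly.coord _)).mul (IsPoly.prod _ fun q _ => ?_)
      by_cases hq : q = p
      · subst hq
        simp only [Function.update_self, Pi.single_apply]
        exact IsPoly.ite _ IsPoly.one IsPoly.zero
      · simp only [Function.update_of_ne hq]
        exact hmoment z (k q)
  · rintro w ⟨⟨A, B, C, S, x, h, hT, hx, hspan, hgen⟩, hV⟩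
    have hK := h.two_le
    obtain ⟨M, hu, hM⟩ := exists_isUnit_of_span_eq
      (hx.linearIndependent_tensorPow (by omega) h.le hn) hspan
    obtain ⟨π, a, ha⟩ := hgen.exists_perm hu hM hV
    exact ⟨fun r => Finset.univ.filter fun j => r ∈ ((π.trans S) j).1, A, B, C, π.trans S, h, hT,
      hx.smul_perm ha, fun r j =>
        Finset.mem_filter.trans (and_iff_right (Finset.mem_univ j))⟩

/-- The null space of this matrix consists of the symmetric tensors in `ker R_{m,l}(T)`. -/
def RMatSym (m l : ℕ) (T : Tensor 𝕜 I J K) :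
    Matrix (((Fin (m + l) → Fin I) × (Fin (m + l) → Fin J)) ⊕
      (Equiv.Perm (Fin (m + l)) × (Fin (m + l) → Fin K))) (Fin (m + l) → Fin K) 𝕜 :=
  Matrix.of fun a k => a.elim (fun ij => RMat m l T ij k) fun σk =>
    -- These rows express invariance under permuting positions, which characterizes symmetric
    -- tensors by `mem_symSubspace_iff`.
    (if σk.2 ∘ σk.1 = k then 1 else 0) - if σk.2 = k then 1 else 0

theorem matKer_RMatSym (m l : ℕ) (T : Tensor 𝕜 I J K) :
    matKer (RMatSym m l T) = matKer (RMat m l T) ⊓ symSubspace 𝕜 (m + l) K := by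
  classical
  ext v
  rw [Submodule.mem_inf, mem_symSubspace_iff]
  change RMatSym m l T *ᵥ v = 0 ↔ RMat m l T *ᵥ v = 0 ∧ _
  rw [funext_iff, funext_iff, Sum.forall]
  refine and_congr Iff.rfl (Prod.forall.trans (forall_congr' fun σ => forall_congr' fun k => ?_))
  rw [← sub_eq_zero (a := v (k ∘ σ))]
  simp [RMatSym, Matrix.mulVec, dotProduct, sub_mul]

theorem IsPoly.RMatSym {ι : Type} {m l : ℕ} {T : (ι → 𝕜) → Tensor 𝕜 I J K}
    (hT : ∀ i j k, IsPoly fun w => T w i j k) (a) (k) : IsPoly fun w => RMatSym m l (T w) a k := by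
  rcases a with ij | σk
  · have h1 : IsPoly fun _ : ι → 𝕜 => ((m ! : 𝕜) * ((m + l)! : 𝕜))⁻¹ := by
      simpa using IsPoly.ratCast (𝕜 := 𝕜) (ι := ι) (((m ! : ℚ) * ((m + l)! : ℚ))⁻¹)
    exact h1.mul (IsPoly.sum _ fun σ _ => (IsPoly.det fun _ _ => hT _ _ _).mul
      (IsPoly.prod _ fun _ _ => hT _ _ _))
  · exact (IsPoly.ite _ IsPoly.one IsPoly.zero).sub (IsPoly.ite _ IsPoly.one IsPoly.zero)

/-- The conditions under which the procedure is shown to work. -/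
def IsComputableCase (m l : ℕ) (A : Matrix (Fin I) (Fin R) 𝕜) (B : Matrix (Fin J) (Fin R) 𝕜)
    (C : Matrix (Fin K) (Fin R) 𝕜) : Prop :=
  IsRigid m A B C ∧
    ∀ v, Phi m l A B *ᵥ ((SMat m l C)ᵀ *ᵥ v) = 0 → (SMat m l C)ᵀ *ᵥ v = 0

theorem solvable_decomposition (m l : ℕ) (hmR : R - (K - 1) + 1 ≤ m + l) :
    Solvable (fun x : Fin I × Fin J × Fin K → 𝕜 => ∃ (A : Matrix (Fin I) (Fin R) 𝕜)
        (B : Matrix (Fin J) (Fin R) 𝕜) (C : Matrix (Fin K) (Fin R) 𝕜),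
        IsComputableCase m l A B C ∧ tensorOf x = polyadic A B C)
      fun x (z : (Fin I × Fin R) ⊕ (Fin J × Fin R) ⊕ (Fin K × Fin R) → 𝕜) =>
        tensorOf x = polyadicOf z := by
  have hker : ∀ {A : Matrix (Fin I) (Fin R) 𝕜} {B : Matrix (Fin J) (Fin R) 𝕜}
      {C : Matrix (Fin K) (Fin R) 𝕜}, IsComputableCase m l A B C →
      matKer (RMatSym m l (polyadic A B C)) =
        matKer (SMat m l C)ᵀ ⊓ symSubspace 𝕜 (m + l) K := fun h => by
    rw [matKer_RMatSym, ker_RMat_eq h.2]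
  refine ((Solvable.nullBasis (fun x => RMatSym m l (tensorOf x))
    (IsPoly.RMatSym fun _ _ _ => IsPoly.coord _) (R.choose (K - 1))).mono ?_
    fun _ _ _ h => h).bind ?_
  · rintro x ⟨A, B, C, h, hT⟩
    rw [hT, hker h]
    exact finrank_ker_SMat_inf_symSubspace_le h.1.posC h.1.two_le h.1.le h.1.add_eq
  let p : Fin (m + l) := ⟨0, by omega⟩
  -- This finite list depends only on the formats and contains a generic choice for every input.
  let θ : Type := (Fin (R.choose (K - 1)) → Fin (m + l) → Fin K) ×
    Fin (Fintype.card {q : Fin (R.choose (K - 1)) × Fin (R.choose (K - 1)) // q.1 ≠ q.2} * K + 1) ×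
    Fin (Fintype.card (Fin (R.choose (K - 1))) * K + 1)
  refine (Solvable.search_decomposition (θ := θ) fun t =>
    solvable_of_choice (𝕜 := 𝕜) (I := I) (J := J) (K := K) (R := R) m p t.1 t.2.1 t.2.2
      (by omega)).mono ?_ fun _ _ _ h => h
  rintro w ⟨⟨A, B, C, h, hT⟩, hW⟩
  rw [hT, hker h] at hW
  have hK := h.1.two_le
  obtain ⟨S, x, hx⟩ := h.1.posC.exists_isNormalFamily (by omega) h.1.le
  obtain ⟨g, y, z, hgen⟩ := hx.exists_isGenericChoice (by omega) h.1.le hmR p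
  exact ⟨(g, y, z), A, B, C, S, x, h.1, hT, hx,
    hW.trans (ker_SMat_inf_symSubspace h.1.posC h.1.two_le h.1.le h.1.add_eq hx), hgen⟩

theorem isComputableCase {m l d : ℕ} (hK : 2 ≤ K) (hKR : K ≤ R) (hm : m + K = R + 2)
    {A : Matrix (Fin I) (Fin R) 𝕜} {B : Matrix (Fin J) (Fin R) 𝕜} {C : Matrix (Fin K) (Fin R) 𝕜}
    {U : Matrix (Tuples m l R) (Fin d) 𝕜} (hC : kRank C = K)
    (hU : ColumnsFormBasis U (matRange (SMat m l C)ᵀ)) (hAB : FullColumnRank (khatriRao A B))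
    (hPhi : FullColumnRank (Phi m l A B * U)) : IsComputableCase m l A B C := by
  have hinj := (fullColumnRank_Phi_mul_iff hU).1 hPhi
  have hC' : GeneralPosition K C.col := by simpa only [hC] using generalPosition_kRank C
  have hli := fun s hs => linearIndepOn_of_injective (s := s) hC' hK hKR hm hinj hs
  exact ⟨⟨hK, hKR, hm, generalPosition_of_card_eq (by omega) fun s hs => (hli s hs).1,
    generalPosition_of_card_eq (by omega) fun s hs => (hli s hs).2, hC', hAB,
    card_supp_lt_of_rank_lt (by omega) hinj⟩, hinj⟩

end CPD

end

theorem mainTheorem6 {𝕜 : Type*} [RCLike 𝕜] (I J K R m l : ℕ)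
    (hK : 2 ≤ K) (hKR : K ≤ R) (hm : m + K = R + 2) :
    (∀ (A : Matrix (Fin I) (Fin R) 𝕜) (B : Matrix (Fin J) (Fin R) 𝕜)
        (C : Matrix (Fin K) (Fin R) 𝕜) (T : CPD.Tensor 𝕜 I J K)
        (d : ℕ) (U : Matrix (CPD.Tuples m l R) (Fin d) 𝕜),
      T = CPD.polyadic A B C → C.rank = K → CPD.kRank C = K →
      CPD.ColumnsFormBasis U (CPD.matRange (CPD.SMat m l C).transpose) →
        (CPD.FullColumnRank (CPD.khatriRao A B) → CPD.FullColumnRank (CPD.Phi m l A B * U) →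
          CPD.tensorRank T = R ∧ CPD.HasUniqueCPD T) ∧
        (CPD.FullColumnRank (CPD.Phi m l A B * U) → m ≤ min (CPD.kRank A) (CPD.kRank B)) ∧
        (CPD.FullColumnRank (CPD.Phi m l A B * U) ↔
          Module.finrank 𝕜 ↥(CPD.matKer (CPD.RMat m l T) ⊓ CPD.symSubspace 𝕜 (m + l) K) =
            R.choose (K - 1))) ∧
    CPD.CPDAlgebraicallyComputableOn R
      {T : CPD.Tensor 𝕜 I J K |
        ∃ (A : Matrix (Fin I) (Fin R) 𝕜) (B : Matrix (Fin J) (Fin R) 𝕜)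
          (C : Matrix (Fin K) (Fin R) 𝕜) (d : ℕ) (U : Matrix (CPD.Tuples m l R) (Fin d) 𝕜),
          T = CPD.polyadic A B C ∧ C.rank = K ∧ CPD.kRank C = K ∧
          CPD.ColumnsFormBasis U (CPD.matRange (CPD.SMat m l C).transpose) ∧
          CPD.FullColumnRank (CPD.khatriRao A B) ∧
          CPD.FullColumnRank (CPD.Phi m l A B * U)} := by
  refine ⟨?_, ?_⟩
  · rintro A B C _ d U rfl - hC hU
    have hC' : CPD.GeneralPosition K C.col := by
      simpa only [hC] using CPD.generalPosition_kRank C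
    refine ⟨fun hAB hPhi => ?_, fun hPhi => ?_, ?_⟩
    · have h := (CPD.isComputableCase hK hKR hm hC hU hAB hPhi).1
      exact ⟨h.tensorRank_eq, h.hasUniqueCPD h.tensorRank_eq⟩
    · have hli := fun s hs => CPD.linearIndepOn_of_injective (s := s) hC' hK hKR hm
        ((CPD.fullColumnRank_Phi_mul_iff hU).1 hPhi) hs
      exact le_min (CPD.le_kRank (by omega) fun s hs => (hli s hs).1)
        (CPD.le_kRank (by omega) fun s hs => (hli s hs).2)
    · rw [CPD.fullColumnRank_Phi_mul_iff hU]
      exact CPD.injective_iff_finrank_ker_RMat hC' hK hKR hm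
  · obtain ⟨P, hP, hPP⟩ := CPD.solvable_decomposition (𝕜 := 𝕜) (I := I) (J := J) (K := K) (R := R)
      m l (by omega)
    refine ⟨P, hP, ?_⟩
    rintro T ⟨A, B, C, d, U, rfl, -, hC, hU, hAB, hPhi⟩
    have h := CPD.isComputableCase hK hKR hm hC hU hAB hPhi
    -- Existence of an output makes the guarantee for all outputs nonvacuous.
    exact ⟨hP.exists_output _, fun y hy =>
      ⟨hPP _ ⟨A, B, C, h, rfl⟩ y hy, h.1.tensorRank_eq⟩⟩
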